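/- Let $(M,g)$ be a connected smooth ($C^\infty$) Lorentzian manifold (signature $(-,+,\dots,+)$, Hausdorff, second countable) of dimension at least $2$, and let $K$ be a static vector field on $M$, i.e. a smooth timelike Killing vector field which is irrotational (its orthogonal distribution $K^\perp$ is involutive). Let $\omega = -g^*(K,\cdot)$, where $g^* = -\frac{1}{g(K,K)}\,g$; that is, $\omega = g(K,\cdot)/g(K,K)$. Let $\Pi:\bar M\to M$ be the universal covering of $M$, endowed with the lifted smooth structure and the metric $\bar g=\Pi^*g$. (1) If $K$ is complete (all its integral curves extend to $\mathbb{R}$), then $(\bar M,\bar g)$ is a standard static manifold: there are a smooth manifold $S$, a Riemannian metric $g_S$ on $S$, a smooth function $\beta:S\to(0,\infty)$ and a diffeomorphism $\bar M\cong\mathbb{R}\times S$ under which $$\bar g_{(t,x)} = -\beta(x)\,dt^2 + (g_S)_x ,$$ and such that, identifying $\bar M$ with $\mathbb{R}\times S$ and writing $\Pi_S:\mathbb{R}\times S\to S$ for the projection, $$dt=\Pi^*\omega,\qquad K_{\Pi(p)} = d\Pi_p(\partial_t|_p),\qquad \beta(\Pi_S(p)) = -g(K_{\Pi(p)},K_{\Pi(p)})\qquad\text{for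 all } p\in\bar M .$$ (2) If $g$ is geodesically complete, then $K$ is complete, and for every decomposition $\bar M\cong\mathbb{R}\times S$ as in (1) the Riemannian metric $g_S$ is (geodesically) complete. -/

import Mathlib

open Manifold Bundle
open scoped ContDiff Manifold

universe u v w

noncomputable section

/-- A smooth pseudo-Riemannian metric on a manifold modelled on `E`: a smooth field of symmetric
nondegenerate bilinear forms on the tangent spaces. -/
structure PseudoRiemannianMetric (E : Type*) [NormedAddCommGroup E] [NormedSpace ℝ E]
    (M : Type*) [TopologicalSpace M] [ChartedSpace E M] [IsManifold 𝓘(ℝ, E) ∞ M] where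
  val (x : M) : TangentSpace 𝓘(ℝ, E) x →L[ℝ] TangentSpace 𝓘(ℝ, E) x →L[ℝ] ℝ
  symm (x : M) (v w : TangentSpace 𝓘(ℝ, E) x) : val x v w = val x w v
  nondegenerate (x : M) (v : TangentSpace 𝓘(ℝ, E) x) : (∀ w, val x v w = 0) → v = 0
  contMDiff : ContMDiff 𝓘(ℝ, E) (𝓘(ℝ, E).prod 𝓘(ℝ, E →L[ℝ] E →L[ℝ] ℝ)) ∞
    (fun x ↦ TotalSpace.mk' (E →L[ℝ] E →L[ℝ] ℝ)
      (E := fun x : M ↦ TangentSpace 𝓘(ℝ, E) x →L[ℝ] TangentSpace 𝓘(ℝ, E) x →L[ℝ] ℝ) x (val x))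

namespace PseudoRiemannianMetric

variable {E : Type*} [NormedAddCommGroup E] [NormedSpace ℝ E]
  {M : Type*} [TopologicalSpace M] [ChartedSpace E M] [IsManifold 𝓘(ℝ, E) ∞ M]

/-- The metric is positive definite. -/
def IsRiemannian (g : PseudoRiemannianMetric E M) : Prop :=
  ∀ (x : M) (v : TangentSpace 𝓘(ℝ, E) x), v ≠ 0 → 0 < g.val x v v

/-- The metric has signature `(-, +, …, +)`: each tangent space contains a timelike vector whose
orthogonal complement is positive definite. -/
def IsLorentzian (g : PseudoRiemannianMetric E M) : Prop :=
  ∀ x : M, ∃ v : TangentSpace 𝓘(ℝ, E) x, g.val x v v < 0 ∧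
    ∀ w : TangentSpace 𝓘(ℝ, E) x, g.val x v w = 0 → w ≠ 0 → 0 < g.val x w w

/-! ### Geodesics -/

/-- The components of the metric in the preferred chart at `x₀`, i.e. the pullback of the metric
by the inverse of this chart. It is meaningful on the target of the chart. -/
def inChart (g : PseudoRiemannianMetric E M) (x₀ : M) (y : E) : E →L[ℝ] E →L[ℝ] ℝ :=
  let B : E →L[ℝ] E →L[ℝ] ℝ := g.val ((extChartAt 𝓘(ℝ, E) x₀).symm y)
  let A : E →L[ℝ] E := mfderiv 𝓘(ℝ, E) 𝓘(ℝ, E) (extChartAt 𝓘(ℝ, E) x₀).symm y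
  B.bilinearComp A A

/-- The Christoffel symbols of the first kind of the Levi-Civita connection, in the preferred chart
at `x₀`: by the Koszul formula,
`g (∇_a b, c) = (1 / 2) (∂_a g(b, c) + ∂_b g(a, c) - ∂_c g(a, b))` for constant coordinate
fields `a`, `b`, `c`. -/
def christoffel (g : PseudoRiemannianMetric E M) (x₀ : M) (y a b c : E) : ℝ :=
  (1 / 2) * (fderiv ℝ (g.inChart x₀) y a b c + fderiv ℝ (g.inChart x₀) y b a c
    - fderiv ℝ (g.inChart x₀) y c a b)

/-- A smooth curve `γ : ℝ → M` is a geodesic if it satisfies `∇_γ' γ' = 0`. This is written in each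
chart; with `u` the coordinate expression of `γ`, the equation reads
`g (u'', c) + g (Γ (u', u'), c) = 0` for every vector `c`. -/
def IsGeodesic (g : PseudoRiemannianMetric E M) (γ : ℝ → M) : Prop :=
  ContMDiff 𝓘(ℝ, ℝ) 𝓘(ℝ, E) ∞ γ ∧
  ∀ (x₀ : M) (t : ℝ), γ t ∈ (chartAt E x₀).source →
    let u : ℝ → E := fun s ↦ extChartAt 𝓘(ℝ, E) x₀ (γ s)
    ∀ c : E, g.inChart x₀ (u t) (deriv (deriv u) t) c +
      g.christoffel x₀ (u t) (deriv u t) (deriv u t) c = 0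

/-- The velocity of a curve, as a point of the tangent bundle. -/
def velocity (γ : ℝ → M) (t : ℝ) : TangentBundle 𝓘(ℝ, E) M :=
  ⟨γ t, mfderiv 𝓘(ℝ, ℝ) 𝓘(ℝ, E) γ t (1 : ℝ)⟩

/-- Geodesic completeness: every tangent vector is the initial velocity of a geodesic defined on
the whole real line. -/
def GeodesicallyComplete (g : PseudoRiemannianMetric E M) : Prop :=
  ∀ V : TangentBundle 𝓘(ℝ, E) M, ∃ γ : ℝ → M, g.IsGeodesic γ ∧ velocity γ 0 = V

/-! ### Static vector fields -/

/-- `K` is a Killing field, `L_K g = 0`, that is,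
`K (g (X, Y)) = g ([K, X], Y) + g (X, [K, Y])` for all vector fields `X`, `Y`. As the identity is
pointwise and tensorial, it is stated at each point for fields differentiable at this point. -/
def IsKilling (g : PseudoRiemannianMetric E M) (K : (x : M) → TangentSpace 𝓘(ℝ, E) x) : Prop :=
  ∀ (x : M) (X Y : (y : M) → TangentSpace 𝓘(ℝ, E) y),
    MDifferentiableAt 𝓘(ℝ, E) 𝓘(ℝ, E).tangent (fun y ↦ (⟨y, X y⟩ : TangentBundle 𝓘(ℝ, E) M)) x →
    MDifferentiableAt 𝓘(ℝ, E) 𝓘(ℝ, E).tangent (fun y ↦ (⟨y, Y y⟩ : TangentBundle 𝓘(ℝ, E) M)) x →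
    mvfderiv 𝓘(ℝ, E) (fun y ↦ g.val y (X y) (Y y)) x (K x) =
      g.val x (VectorField.mlieBracket 𝓘(ℝ, E) K X x) (Y x) +
      g.val x (X x) (VectorField.mlieBracket 𝓘(ℝ, E) K Y x)

/-- `K` is irrotational: the distribution orthogonal to `K` is involutive. As for Killing fields,
this is stated at each point for orthogonal fields differentiable at this point. -/
def IsIrrotational (g : PseudoRiemannianMetric E M)
    (K : (x : M) → TangentSpace 𝓘(ℝ, E) x) : Prop :=
  ∀ (x : M) (X Y : (y : M) → TangentSpace 𝓘(ℝ, E) y),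
    MDifferentiableAt 𝓘(ℝ, E) 𝓘(ℝ, E).tangent (fun y ↦ (⟨y, X y⟩ : TangentBundle 𝓘(ℝ, E) M)) x →
    MDifferentiableAt 𝓘(ℝ, E) 𝓘(ℝ, E).tangent (fun y ↦ (⟨y, Y y⟩ : TangentBundle 𝓘(ℝ, E) M)) x →
    (∀ y, g.val y (K y) (X y) = 0) → (∀ y, g.val y (K y) (Y y) = 0) →
    g.val x (K x) (VectorField.mlieBracket 𝓘(ℝ, E) X Y x) = 0

/-- `K` is a static vector field: a smooth irrotational timelike Killing field. -/
structure IsStaticField (g : PseudoRiemannianMetric E M)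
    (K : (x : M) → TangentSpace 𝓘(ℝ, E) x) : Prop where
  contMDiff : ContMDiff 𝓘(ℝ, E) 𝓘(ℝ, E).tangent ∞
    (fun x ↦ (⟨x, K x⟩ : TangentBundle 𝓘(ℝ, E) M))
  timelike (x : M) : g.val x (K x) (K x) < 0
  killing : g.IsKilling K
  irrotational : g.IsIrrotational K

/-- The conformal metric `g* = -(1 / g (K, K)) g`. -/
def conformal (g : PseudoRiemannianMetric E M) (K : (x : M) → TangentSpace 𝓘(ℝ, E) x) (x : M)
    (v w : TangentSpace 𝓘(ℝ, E) x) : ℝ :=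
  -(1 / g.val x (K x) (K x)) * g.val x v w

/-- The one-form `ω = -g* (K, ·)`. -/
def staticForm (g : PseudoRiemannianMetric E M) (K : (x : M) → TangentSpace 𝓘(ℝ, E) x) (x : M)
    (v : TangentSpace 𝓘(ℝ, E) x) : ℝ :=
  -g.conformal K x (K x) v

/-- The pullback `f^* g` of the metric by a map. -/
def pullback {N : Type*} [TopologicalSpace N] [ChartedSpace E N]
    (g : PseudoRiemannianMetric E M) (f : N → M) (p : N) (v w : TangentSpace 𝓘(ℝ, E) p) : ℝ :=
  g.val (f p) (mfderiv 𝓘(ℝ, E) 𝓘(ℝ, E) f p v) (mfderiv 𝓘(ℝ, E) 𝓘(ℝ, E) f p w)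

end PseudoRiemannianMetric

/-- A vector field is complete if through each point there passes an integral curve defined on the
whole real line. -/
def IsCompleteField {E : Type*} [NormedAddCommGroup E] [NormedSpace ℝ E]
    {M : Type*} [TopologicalSpace M] [ChartedSpace E M]
    (K : (x : M) → TangentSpace 𝓘(ℝ, E) x) : Prop :=
  ∀ x : M, ∃ γ : ℝ → M, γ 0 = x ∧ IsMIntegralCurve γ K

/-- `proj : N → M` is the universal covering of the manifold `M`: a smooth covering map with simply
connected total space, the smooth structure of which is the lifted one. -/
structure IsUniversalCovering (E : Type*) [NormedAddCommGroup E] [NormedSpace ℝ E]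
    {M N : Type*} [TopologicalSpace M] [ChartedSpace E M] [TopologicalSpace N] [ChartedSpace E N]
    (proj : N → M) : Prop where
  simplyConnected : SimplyConnectedSpace N
  isCoveringMap : IsCoveringMap proj
  isLocalDiffeomorph : IsLocalDiffeomorph 𝓘(ℝ, E) 𝓘(ℝ, E) ∞ proj

section StandardStatic

variable {E F : Type*} [NormedAddCommGroup E] [NormedSpace ℝ E]
  [NormedAddCommGroup F] [NormedSpace ℝ F]
  {M N S : Type*} [TopologicalSpace M] [ChartedSpace E M] [IsManifold 𝓘(ℝ, E) ∞ M]
  [TopologicalSpace N] [ChartedSpace E N]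
  [TopologicalSpace S] [ChartedSpace F S] [IsManifold 𝓘(ℝ, F) ∞ S]

/-- The standard static metric `-β(x) dt² + g_S[x]` on `ℝ × S`, where `dt` and `g_S` are pulled back
along the two projections. -/
def standardStaticMetric (gS : PseudoRiemannianMetric F S) (β : S → ℝ) (q : ℝ × S)
    (v w : TangentSpace (𝓘(ℝ, ℝ).prod 𝓘(ℝ, F)) q) : ℝ :=
  -β q.2 * (mvfderiv (𝓘(ℝ, ℝ).prod 𝓘(ℝ, F)) (Prod.fst : ℝ × S → ℝ) q v *
      mvfderiv (𝓘(ℝ, ℝ).prod 𝓘(ℝ, F)) (Prod.fst : ℝ × S → ℝ) q w) +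
    gS.val q.2 (mfderiv (𝓘(ℝ, ℝ).prod 𝓘(ℝ, F)) 𝓘(ℝ, F) (Prod.snd : ℝ × S → S) q v)
      (mfderiv (𝓘(ℝ, ℝ).prod 𝓘(ℝ, F)) 𝓘(ℝ, F) (Prod.snd : ℝ × S → S) q w)

/-- The vector field `∂_t` on `ℝ × S`. -/
def timeField (F : Type*) [NormedAddCommGroup F] [NormedSpace ℝ F] {S : Type*} [TopologicalSpace S]
    [ChartedSpace F S] (q : ℝ × S) : TangentSpace (𝓘(ℝ, ℝ).prod 𝓘(ℝ, F)) q :=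
  ((1, 0) : ℝ × F)

/-- `Φ` is an isometry of `(N, proj^* g)` onto the standard static manifold
`(ℝ × S, -β dt² + g_S)`, such that `dt = proj^* ω`, `K` is the image of `∂_t` under the differential
of `proj`, and `β = -g (K, K)`, where `N` is identified with `ℝ × S` by `Φ`. -/
structure IsStaticSplitting (g : PseudoRiemannianMetric E M)
    (K : (x : M) → TangentSpace 𝓘(ℝ, E) x) (proj : N → M)
    (gS : PseudoRiemannianMetric F S) (β : S → ℝ)
    (Φ : Diffeomorph 𝓘(ℝ, E) (𝓘(ℝ, ℝ).prod 𝓘(ℝ, F)) N (ℝ × S) ∞) : Prop where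
  riemannian : gS.IsRiemannian
  beta_contMDiff : ContMDiff 𝓘(ℝ, F) 𝓘(ℝ, ℝ) ∞ β
  beta_pos (x : S) : 0 < β x
  isometry (p : N) (v w : TangentSpace 𝓘(ℝ, E) p) :
    standardStaticMetric gS β (Φ p)
      (mfderiv 𝓘(ℝ, E) (𝓘(ℝ, ℝ).prod 𝓘(ℝ, F)) Φ p v)
      (mfderiv 𝓘(ℝ, E) (𝓘(ℝ, ℝ).prod 𝓘(ℝ, F)) Φ p w) = g.pullback proj p v w
  dt_eq (p : N) (v : TangentSpace 𝓘(ℝ, E) p) :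
    mvfderiv 𝓘(ℝ, E) (fun p' ↦ (Φ p').1) p v =
      g.staticForm K (proj p) (mfderiv 𝓘(ℝ, E) 𝓘(ℝ, E) proj p v)
  field_eq (q : ℝ × S) :
    mfderiv 𝓘(ℝ, E) 𝓘(ℝ, E) proj (Φ.symm q)
      (mfderiv (𝓘(ℝ, ℝ).prod 𝓘(ℝ, F)) 𝓘(ℝ, E) Φ.symm q (timeField F q)) = K (proj (Φ.symm q))
  beta_eq (p : N) : β (Φ p).2 = -g.val (proj p) (K (proj p)) (K (proj p))

end StandardStatic

end

noncomputable section

/-! Write `θ = g(K, ·) / g(K, K)`, which is the form `ω`. Locally the theorem says that `θ` is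
closed. The fields `v - θ(v) K` and `w - θ(w) K`, built from constant coordinate vectors, are
orthogonal to `K`; by the Killing equation the coefficients of `θ` are constant along `K`, so
applying `θ` to the bracket of these fields gives `-dθ(v, w)`, and this vanishes when the orthogonal
distribution is involutive (`IsSmoothChart.fderiv_dualForm_symm`). A flow box for `K` exists by
smooth dependence of flows on initial data (`exists_contDiffOn_flow`, `exists_flowBox`). Replacing
its time coordinate by a primitive of `θ` gives a chart in which `K = ∂_t` and the metric is `-β dt²
+ g_S`, with no mixed terms and no dependence on `t` (`exists_staticChart`).

For the global splitting, the time coordinates of these charts differ locally by constants, so on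
the simply connected `N` they glue to a function `t` with `dt = proj^* ω` (`exists_primitive`,
`exists_staticTime`). If `K` is complete, so is its lift, by path lifting. In static charts its flow
is a translation of time, so it is isometric and raises `t` by the elapsed time
(`IsStaticFlow.isFlowStaticAt`). Hence `p ↦ (t p, fl (-t p) p)` identifies `N` with the product of
`ℝ` and the slice `t = 0` (`StaticAtlas.splitting`, `StaticAtlas.isStaticSplitting`).

For the completeness of `K`, the key is that the set of times at which the maximal integral curve of
`K` is defined is the same at all points of a geodesic: the local flow maps geodesics to geodesics,
and completeness of `g` prevents the images from stopping (`IsStaticChart.exists_geodesic_flowTo`,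
`FlowTo.exists_geodesic`). Now let `σ` be the geodesic with initial velocity `K p`. In a static
chart the reflection of time about `p` is an isometry which reverses this velocity, so it maps `σ s`
to `σ (-s)`. Thus `σ (-s)` and `σ s` lie on one integral curve, at a time distance `T` which is
nonzero for a suitable `s`. Since the domains of the integral curves through `σ (-s)`, `p` and `σ s`
coincide, this common domain is invariant under translation by `T`; being an interval, it is `ℝ`
(`isCompleteField_of_geodesicallyComplete`).

For the completeness of the base of a splitting, lift a complete geodesic of `M` whose initial
velocity is tangent to a slice. Along the lift the momentum `β τ'` is conserved
(`hasDerivAt_momentum`) and vanishes initially, so the time `τ` is constant, and the projection to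
`S` is a geodesic of `g_S` defined on all of `ℝ` (`IsStaticSplitting.geodesicallyComplete`). -/

open Set Filter Topology

/-! ### Inverse function theorem on a neighbourhood -/

section InverseFunction

variable {E F : Type*} [NormedAddCommGroup E] [NormedSpace ℝ E] [CompleteSpace E]
  [NormedAddCommGroup F] [NormedSpace ℝ F]

/-- The inverse function theorem, on a whole neighbourhood: near a point where the derivative is
invertible, a smooth map is a diffeomorphism. -/
theorem exists_openPartialHomeomorph_contDiff {f : E → F} {U : Set E} (hU : IsOpen U)
    (hf : ContDiffOn ℝ ∞ f U) {a : E} (ha : a ∈ U) {A : E ≃L[ℝ] F}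
    (hA : HasFDerivAt f (A : E →L[ℝ] F) a) :
    ∃ R : OpenPartialHomeomorph E F, a ∈ R.source ∧ ⇑R = f ∧ R.source ⊆ U ∧
      (∀ y ∈ R.source, ∃ B : E ≃L[ℝ] F, HasFDerivAt f (B : E →L[ℝ] F) y) ∧
      ContDiffOn ℝ ∞ R.symm R.target := by
  have hfa : ContDiffAt ℝ ∞ f a := hf.contDiffAt (hU.mem_nhds ha)
  set R₀ := hfa.toOpenPartialHomeomorph f hA (by simp) with hR₀
  -- Invertible operators form an open set. Restricting to points with invertible derivative makes
  -- the inverse smooth on its whole target, not only near the image of `a`.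
  have hopen : IsOpen (U ∩ fderiv ℝ f ⁻¹' (range ((↑) : (E ≃L[ℝ] F) → E →L[ℝ] F))) :=
    (hf.continuousOn_fderiv_of_isOpen hU (by simp)).isOpen_inter_preimage hU
      ContinuousLinearEquiv.isOpen
  set V := U ∩ fderiv ℝ f ⁻¹' (range ((↑) : (E ≃L[ℝ] F) → E →L[ℝ] F)) with hV
  have haV : a ∈ V := ⟨ha, A, hA.fderiv.symm⟩
  set R := R₀.restrOpen V hopen with hR
  have hRf : ⇑R = f := rfl
  have hsrc : R.source ⊆ V := fun x hx => hx.2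
  have hder : ∀ y ∈ R.source, ∃ B : E ≃L[ℝ] F, HasFDerivAt f (B : E →L[ℝ] F) y := by
    intro y hy
    obtain ⟨hyU, B, hB⟩ := hsrc hy
    refine ⟨B, hB ▸ ?_⟩
    exact ((hf.contDiffAt (hU.mem_nhds hyU)).differentiableAt (by simp)).hasFDerivAt
  refine ⟨R, ⟨hfa.mem_toOpenPartialHomeomorph_source hA (by simp), haV⟩, hRf,
    fun x hx => (hsrc hx).1, hder, fun z hz => ?_⟩
  obtain ⟨B, hB⟩ := hder _ (R.map_target hz)
  exact (R.contDiffAt_symm hz (f₀' := B) (by rw [hRf]; exact hB)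
    (hf.contDiffAt (hU.mem_nhds (hsrc (R.map_target hz)).1))).contDiffWithinAt

end InverseFunction

/-! ### Smoothness of composition operators on spaces of continuous functions -/

section Nemytskii

variable {X : Type*} [TopologicalSpace X] [CompactSpace X]

/-- Pointwise application of a continuous bilinear map to continuous functions. -/
def ContinuousMap.bilinearCLM (X : Type*) [TopologicalSpace X] [CompactSpace X]
    {G E F : Type*} [NormedAddCommGroup G] [NormedSpace ℝ G] [NormedAddCommGroup E]
    [NormedSpace ℝ E] [NormedAddCommGroup F] [NormedSpace ℝ F] (B : G →L[ℝ] E →L[ℝ] F) :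
    C(X, G) →L[ℝ] C(X, E) →L[ℝ] C(X, F) :=
  LinearMap.mkContinuous₂
    (LinearMap.mk₂ ℝ (fun (A : C(X, G)) (h : C(X, E)) =>
        (⟨fun s => B (A s) (h s), (B.continuous.comp A.continuous).clm_apply h.continuous⟩ :
          C(X, F)))
      (fun _ _ _ => by ext; simp) (fun _ _ _ => by ext; simp) (fun _ _ _ => by ext; simp)
      (fun _ _ _ => by ext; simp)) ‖B‖
    (fun A h => by
      refine (ContinuousMap.norm_le _ (by positivity)).2 fun s => ?_
      refine (B.le_opNorm₂ (A s) (h s)).trans ?_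
      have h1 := A.norm_coe_le_norm s
      have h2 := h.norm_coe_le_norm s
      gcongr)

/-- Composition with `D` is continuous for the uniform norm, so along the segments from `u s` to `u
s + h s` the derivative of `f` stays close to its value at `u s`, uniformly in `s`. The mean value
inequality turns this into a remainder at most `ε ‖h‖` in the uniform norm. -/
theorem hasFDerivAt_continuousMap_comp {G E F : Type*} [NormedAddCommGroup G] [NormedSpace ℝ G]
    [NormedAddCommGroup E] [NormedSpace ℝ E] [NormedAddCommGroup F] [NormedSpace ℝ F]
    (B : G →L[ℝ] E →L[ℝ] F) (f : C(E, F)) (D : C(E, G)) (hf : ∀ x, HasFDerivAt f (B (D x)) x)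
    (u : C(X, E)) :
    HasFDerivAt (fun u : C(X, E) => f.comp u) (ContinuousMap.bilinearCLM X B (D.comp u)) u := by
  rw [hasFDerivAt_iff_isLittleO_nhds_zero, Asymptotics.isLittleO_iff]
  intro ε hε
  have hcont : Continuous fun w : C(X, E) => D.comp w := D.continuous_postcomp
  obtain ⟨η, hη, hηε⟩ : ∃ η > 0, ‖B‖ * η ≤ ε := by
    refine ⟨ε / (‖B‖ + 1), by positivity, ?_⟩
    rw [mul_div_assoc', div_le_iff₀ (by positivity)]
    nlinarith [norm_nonneg B]
  obtain ⟨δ, hδ, hδη⟩ := Metric.continuousAt_iff.1 hcont.continuousAt η hη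
  filter_upwards [Metric.ball_mem_nhds (0 : C(X, E)) hδ] with h hh
  rw [mem_ball_zero_iff] at hh
  refine (ContinuousMap.norm_le _ (by positivity)).2 fun s => ?_
  have key : ∀ y ∈ segment ℝ (u s) (u s + h s), ‖B (D y) - B (D (u s))‖ ≤ ε := by
    intro y hy
    rw [segment_eq_image'] at hy
    obtain ⟨θ, hθ, rfl⟩ := hy
    have h1 : dist (u + θ • h) u < δ := by
      rw [dist_eq_norm, add_sub_cancel_left, norm_smul, Real.norm_eq_abs, abs_of_nonneg hθ.1]
      exact (mul_le_of_le_one_left (norm_nonneg _) hθ.2).trans_lt hh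
    have h2 := (ContinuousMap.dist_lt_iff hη).1 (hδη h1) s
    rw [dist_eq_norm] at h2
    rw [← map_sub]
    refine (B.le_opNorm _).trans (le_trans ?_ hηε)
    have h3 : ‖D (u s + θ • (u s + h s - u s)) - D (u s)‖ ≤ η := by simpa using h2.le
    gcongr
  have := (convex_segment (𝕜 := ℝ) (u s) (u s + h s)).norm_image_sub_le_of_norm_hasFDerivWithin_le'
    (f := f) (f' := fun x => B (D x)) (φ := B (D (u s))) (C := ε)
    (fun y _ => (hf y).hasFDerivWithinAt) key
    (left_mem_segment ℝ _ _) (right_mem_segment ℝ _ _)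
  rw [add_sub_cancel_left] at this
  refine LE.le.trans this ?_
  gcongr
  exact h.norm_coe_le_norm s

/-- Composition with a map of class `C^n` is of class `C^n` on spaces of continuous functions. -/
theorem contDiff_continuousMap_comp {E : Type u} [NormedAddCommGroup E] [NormedSpace ℝ E] (n : ℕ) :
    ∀ {F : Type u} [NormedAddCommGroup F] [NormedSpace ℝ F] {f : E → F} (hf : ContDiff ℝ n f),
    ContDiff ℝ n (fun u : C(X, E) => (⟨f, hf.continuous⟩ : C(E, F)).comp u) := by
  induction n with
  | zero =>
    intro F _ _ f hf
    exact contDiff_zero.2 (ContinuousMap.continuous_postcomp _)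
  | succ n ih =>
    intro F _ _ f hf
    have hf1 : ContDiff ℝ 1 f := hf.of_le (by norm_cast; omega)
    have hD : ContDiff ℝ n (fderiv ℝ f) := hf.fderiv_right (by norm_cast)
    have key : ∀ (G : Type u) [NormedAddCommGroup G] [NormedSpace ℝ G] (B : G →L[ℝ] E →L[ℝ] F)
        (D : E → G), ContDiff ℝ n D → (∀ x, HasFDerivAt f (B (D x)) x) →
        ContDiff ℝ (n + 1) (fun u : C(X, E) => (⟨f, hf.continuous⟩ : C(E, F)).comp u) := by
      intro G _ _ B D hD hB
      exact contDiff_succ_iff_hasFDerivAt.2 ⟨_, (ContinuousMap.bilinearCLM X B).contDiff.comp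
        (ih hD), fun u => hasFDerivAt_continuousMap_comp B ⟨f, hf.continuous⟩ ⟨D, hD.continuous⟩
          hB u⟩
    exact key (E →L[ℝ] F) (ContinuousLinearMap.id ℝ _) (fderiv ℝ f) hD
      fun x => ((hf1.differentiable one_ne_zero) x).hasFDerivAt

theorem contDiff_infty_continuousMap_comp {E F : Type u} [NormedAddCommGroup E] [NormedSpace ℝ E]
    [NormedAddCommGroup F] [NormedSpace ℝ F] {f : E → F} (hf : ContDiff ℝ ∞ f) :
    ContDiff ℝ ∞ (fun u : C(X, E) => (⟨f, hf.continuous⟩ : C(E, F)).comp u) :=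
  contDiff_infty.2 fun n => contDiff_continuousMap_comp n (contDiff_infty.1 hf n)

end Nemytskii

/-! ### Smooth local flows of vector fields on Banach spaces -/

section LocalFlow

variable {E : Type u} [NormedAddCommGroup E]

/-- The compact interval on which the curves of the local flow are parametrized. -/
abbrev UnitSpan : Type := Icc (-1 : ℝ) 1

theorem neg_one_le_one_real : (-1 : ℝ) ≤ 1 := by norm_num

theorem intervalIntegrable_span (u : C(UnitSpan, E)) (a b : ℝ) :
    IntervalIntegrable (fun τ => u (projIcc (-1) 1 neg_one_le_one_real τ)) MeasureTheory.volume a b :=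
  (u.continuous.comp continuous_projIcc).intervalIntegrable a b

variable [NormedSpace ℝ E]

/-- The primitive vanishing at `0` of a continuous curve. -/
def spanPrimitive (u : C(UnitSpan, E)) : C(UnitSpan, E) :=
  ⟨fun s => ∫ τ in (0 : ℝ)..s, u (projIcc (-1) 1 neg_one_le_one_real τ),
    (intervalIntegral.continuous_primitive
      (fun a b => (u.continuous.comp continuous_projIcc).intervalIntegrable a b) 0).comp
      continuous_subtype_val⟩

/-- `spanPrimitive` as a continuous linear map. -/
def spanPrimitiveCLM (E : Type u) [NormedAddCommGroup E] [NormedSpace ℝ E] :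
    C(UnitSpan, E) →L[ℝ] C(UnitSpan, E) :=
  LinearMap.mkContinuous
    { toFun := spanPrimitive
      map_add' := fun u v => by
        ext s
        exact intervalIntegral.integral_add (intervalIntegrable_span u _ _)
          (intervalIntegrable_span v _ _)
      map_smul' := fun c u => by
        ext s
        exact intervalIntegral.integral_smul c _ } 1
    (fun u => by
      rw [one_mul]
      refine (ContinuousMap.norm_le _ (norm_nonneg _)).2 fun s => ?_
      have h := intervalIntegral.norm_integral_le_of_norm_le_const (a := 0) (b := (s : ℝ))
        (f := fun τ => u (projIcc (-1) 1 neg_one_le_one_real τ)) (C := ‖u‖)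
        (fun τ _ => u.norm_coe_le_norm _)
      refine h.trans (mul_le_of_le_one_right (norm_nonneg _) ?_)
      rw [sub_zero, abs_le]
      exact s.2)

theorem spanPrimitiveCLM_apply (u : C(UnitSpan, E)) (s : UnitSpan) :
    spanPrimitiveCLM E u s = ∫ τ in (0 : ℝ)..s, u (projIcc (-1) 1 neg_one_le_one_real τ) := rfl

/-- Rescaling of the parameter by `s ∈ [-1, 1]`. -/
def spanScale (s : UnitSpan) : C(UnitSpan, UnitSpan) :=
  ⟨fun r => ⟨s * r, by
    have h : |(s : ℝ) * r| ≤ 1 := by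
      rw [abs_mul]
      exact mul_le_one₀ (abs_le.2 s.2) (abs_nonneg _) (abs_le.2 r.2)
    exact abs_le.1 h⟩, by fun_prop⟩

/-- Substitution `τ ↦ s τ` in the integral. It shows that a rescaled solution of the integral
equation of the flow solves the equation with rescaled time. -/
theorem spanPrimitive_scale (u : C(UnitSpan, E)) (s r : UnitSpan) :
    spanPrimitiveCLM E u (spanScale s r) = (s : ℝ) • spanPrimitiveCLM E (u.comp (spanScale s)) r := by
  rw [spanPrimitiveCLM_apply, spanPrimitiveCLM_apply]
  have h := intervalIntegral.smul_integral_comp_mul_left (a := 0) (b := (r : ℝ))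
    (fun τ => u (projIcc (-1) 1 neg_one_le_one_real τ)) (s : ℝ)
  rw [mul_zero] at h
  refine h.symm.trans ?_
  congr 1
  refine intervalIntegral.integral_congr fun τ hτ => ?_
  have hτ1 : τ ∈ Icc (-1 : ℝ) 1 := by
    refine uIcc_subset_Icc ⟨by norm_num, by norm_num⟩ r.2 hτ
  have h2 : (s : ℝ) * τ ∈ Icc (-1 : ℝ) 1 := (spanScale s ⟨τ, hτ1⟩).2
  simp only [ContinuousMap.comp_apply]
  rw [projIcc_of_mem _ h2, projIcc_of_mem _ hτ1]
  rfl

/-- **Smooth dependence on time and initial conditions** for the local flow of a smooth vector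
field on a Banach space. -/
theorem exists_contDiffOn_flow [CompleteSpace E] {f : E → E} (hf : ContDiff ℝ ∞ f) (x₀ : E) :
    ∃ δ > 0, ∃ φ : ℝ × E → E, ContDiffOn ℝ ∞ φ (Metric.ball (0, x₀) δ) ∧
      ∀ q ∈ Metric.ball ((0 : ℝ), x₀) δ, φ (0, q.2) = q.2 ∧
        HasDerivAt (fun t => φ (t, q.2)) (f (φ q)) q.1 := by
  let X := C(UnitSpan, E)
  let N : X → X := fun u => (⟨f, hf.continuous⟩ : C(E, E)).comp u
  have hN : ContDiff ℝ ∞ N := contDiff_infty_continuousMap_comp hf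
  let J := spanPrimitiveCLM E
  let cst : E →L[ℝ] X := ContinuousLinearMap.const ℝ UnitSpan
  -- The curve `u s = flow_{t s}(x)` is the solution of `u = x + t ∫₀ f ∘ u`. The parameters `(t,
  -- x)` are kept as a component of `G`, so that inverting `G` solves this equation smoothly in `(t,
  -- x)`.
  let G : (ℝ × E) × X → (ℝ × E) × X := fun p => (p.1, p.2 - cst p.1.2 - p.1.1 • J (N p.2))
  have hG : ContDiff ℝ ∞ G := by
    have h1 : ContDiff ℝ ∞ fun p : (ℝ × E) × X => N p.2 := hN.comp contDiff_snd
    have h2 : ContDiff ℝ ∞ fun p : (ℝ × E) × X => J (N p.2) := J.contDiff.comp h1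
    have h3 : ContDiff ℝ ∞ fun p : (ℝ × E) × X => cst p.1.2 :=
      cst.contDiff.comp (contDiff_snd.comp contDiff_fst)
    exact contDiff_fst.prodMk ((contDiff_snd.sub h3).sub
      ((contDiff_fst.comp contDiff_fst).smul h2))
  let p₀ : (ℝ × E) × X := ((0, x₀), cst x₀)
  let B : ℝ × E →L[ℝ] X :=
    -(cst.comp (ContinuousLinearMap.snd ℝ ℝ E)) -
      (ContinuousLinearMap.fst ℝ ℝ E).smulRight (J (N (cst x₀)))
  -- At `t = 0` the integral does not contribute to the derivative in `u`, which leaves a triangular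
  -- map with identities on the diagonal.
  let A : ((ℝ × E) × X) ≃L[ℝ] (ℝ × E) × X :=
    (ContinuousLinearEquiv.refl ℝ (ℝ × E)).skewProd (ContinuousLinearEquiv.refl ℝ X) B
  have hA : HasFDerivAt G (A : ((ℝ × E) × X) →L[ℝ] (ℝ × E) × X) p₀ := by
    have h1 : HasFDerivAt (fun p : (ℝ × E) × X => J (N p.2))
        (fderiv ℝ (fun p : (ℝ × E) × X => J (N p.2)) p₀) p₀ := by
      apply DifferentiableAt.hasFDerivAt
      exact (J.contDiff.comp (hN.comp contDiff_snd)).differentiable (by simp) p₀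
    have h2 : HasFDerivAt (fun p : (ℝ × E) × X => p.1.1)
      ((ContinuousLinearMap.fst ℝ ℝ E).comp (ContinuousLinearMap.fst ℝ (ℝ × E) X)) p₀ :=
      ((ContinuousLinearMap.fst ℝ ℝ E).comp (ContinuousLinearMap.fst ℝ (ℝ × E) X)).hasFDerivAt
    have h3 : HasFDerivAt (fun p : (ℝ × E) × X => cst p.1.2)
      (cst.comp ((ContinuousLinearMap.snd ℝ ℝ E).comp (ContinuousLinearMap.fst ℝ (ℝ × E) X))) p₀ :=
      (cst.comp ((ContinuousLinearMap.snd ℝ ℝ E).comp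
        (ContinuousLinearMap.fst ℝ (ℝ × E) X))).hasFDerivAt
    have h4 := (hasFDerivAt_fst (𝕜 := ℝ) (p := p₀)).prodMk
      (((hasFDerivAt_snd (𝕜 := ℝ) (p := p₀)).sub h3).sub (h2.smul h1))
    refine h4.congr_fderiv ?_
    refine ContinuousLinearMap.ext fun p => ?_
    refine Prod.ext ?_ ?_
    · simp [A]
    · simp [A, B, p₀]
      abel
  obtain ⟨R, hpR, hRG, -, -, hRsymm⟩ :=
    exists_openPartialHomeomorph_contDiff isOpen_univ hG.contDiffOn (mem_univ p₀) hA
  have hGp₀ : G p₀ = ((0, x₀), 0) := by simp [G, p₀]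
  obtain ⟨ρ, hρ, hρR⟩ := Metric.isOpen_iff.1 R.open_source p₀ hpR
  let ι : ℝ × E → (ℝ × E) × X := fun q => (q, 0)
  have hι : Continuous ι := by fun_prop
  have htgt : ι (0, x₀) ∈ R.target := by
    have := R.map_source hpR
    rwa [hRG, hGp₀] at this
  have hsymm₀ : R.symm (ι (0, x₀)) = p₀ := by
    have := R.left_inv hpR
    rwa [hRG, hGp₀] at this
  -- The solution is kept in a ball on which `R` is injective. Rescaling a curve does not leave this
  -- ball, which gives uniqueness for rescaled solutions below.
  have hopen : IsOpen (R.target ∩ R.symm ⁻¹' Metric.ball p₀ ρ) :=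
    R.continuousOn_symm.isOpen_inter_preimage R.open_target Metric.isOpen_ball
  obtain ⟨δ, hδ, hδR⟩ := Metric.isOpen_iff.1 (hopen.preimage hι) (0, x₀)
    ⟨htgt, by rw [mem_preimage, hsymm₀]; exact Metric.mem_ball_self hρ⟩
  let U : ℝ × E → X := fun q => (R.symm (ι q)).2
  have hsol : ∀ q ∈ Metric.ball ((0 : ℝ), x₀) δ, R.symm (ι q) = (q, U q) ∧
      U q = cst q.2 + q.1 • J (N (U q)) := by
    intro q hq
    have h1 : G (R.symm (ι q)) = ι q := by
      have := R.right_inv (hδR hq).1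
      rwa [hRG] at this
    have h2 : (R.symm (ι q)).1 = q := congrArg Prod.fst h1
    refine ⟨Prod.ext h2 rfl, ?_⟩
    have h3 := congrArg Prod.snd h1
    simp only [G, ι, h2] at h3
    rw [sub_sub, sub_eq_zero] at h3
    exact h3
  have hscale : ∀ q ∈ Metric.ball ((0 : ℝ), x₀) δ, ∀ s : UnitSpan,
      U ((s : ℝ) * q.1, q.2) = (U q).comp (spanScale s) := by
    intro q hq s
    have habs : |(s : ℝ) * q.1| ≤ |q.1| := by
      rw [abs_mul]; exact mul_le_of_le_one_left (abs_nonneg _) (abs_le.2 s.2)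
    have hmem : (((s : ℝ) * q.1, q.2), (U q).comp (spanScale s)) ∈ Metric.ball p₀ ρ := by
      have h1 := (hδR hq).2
      rw [mem_preimage, (hsol q hq).1] at h1
      simp only [Metric.mem_ball, p₀, Prod.dist_eq, sup_lt_iff, Real.dist_eq, sub_zero] at h1 ⊢
      refine ⟨⟨habs.trans_lt h1.1.1, h1.1.2⟩, ?_⟩
      rw [ContinuousMap.dist_lt_iff hρ] at h1 ⊢
      exact fun r => h1.2 (spanScale s r)
    have hGs : G (((s : ℝ) * q.1, q.2), (U q).comp (spanScale s)) = ι ((s : ℝ) * q.1, q.2) := by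
      refine Prod.ext rfl ?_
      ext r
      have h2 := DFunLike.congr_fun (hsol q hq).2 (spanScale s r)
      have h3 := spanPrimitive_scale (N (U q)) s r
      change U q (spanScale s r) = q.2 + q.1 • J (N (U q)) (spanScale s r) at h2
      change U q (spanScale s r) - q.2 - ((s : ℝ) * q.1) • J ((N (U q)).comp (spanScale s)) r = 0
      rw [h2, h3, smul_smul, mul_comm q.1]
      simp [J]
    have h4 := R.left_inv (hρR hmem)
    rw [hRG, hGs] at h4
    exact congrArg Prod.snd h4
  let one : UnitSpan := ⟨1, by norm_num⟩
  let zero : UnitSpan := ⟨0, by norm_num⟩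
  let φ : ℝ × E → E := fun q => U q one
  have hφ : ∀ q ∈ Metric.ball ((0 : ℝ), x₀) δ, ∀ s : UnitSpan,
      φ ((s : ℝ) * q.1, q.2) = q.2 + q.1 • ∫ τ in (0 : ℝ)..s,
        f (U q (projIcc (-1) 1 neg_one_le_one_real τ)) := by
    intro q hq s
    have h1 : φ ((s : ℝ) * q.1, q.2) = U q s := by
      change U _ one = _
      rw [hscale q hq s]
      change U q (spanScale s one) = _
      congr 1
      exact Subtype.ext (mul_one _)
    rw [h1]
    exact DFunLike.congr_fun (hsol q hq).2 s
  refine ⟨δ, hδ, φ, ?_, fun q hq => ⟨?_, ?_⟩⟩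
  · have h1 : ContDiffOn ℝ ∞ (fun q => R.symm (ι q)) (Metric.ball (0, x₀) δ) :=
      hRsymm.comp (by fun_prop : ContDiff ℝ ∞ ι).contDiffOn fun q hq => (hδR hq).1
    exact (ContinuousMap.evalCLM ℝ one).contDiff.comp_contDiffOn h1.snd
  · have := hφ q hq zero
    simpa [zero] using this
  -- All values at times `t` near `q.1` are read off the single curve with parameter `ε`, at `s = t
  -- / ε`. A fixed positive `ε` above `|q.1|` allows this also when `q.1 = 0`.
  · obtain ⟨ε, hε, hεδ⟩ : ∃ ε, |q.1| < ε ∧ ε < δ := by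
      refine exists_between ?_
      have := (max_lt_iff.1 (Prod.dist_eq (x := q) (y := ((0 : ℝ), x₀)) ▸ Metric.mem_ball.1 hq)).1
      simpa [Real.dist_eq] using this
    have hε0 : 0 < ε := (abs_nonneg _).trans_lt hε
    have hq' : (ε, q.2) ∈ Metric.ball ((0 : ℝ), x₀) δ := by
      have := (max_lt_iff.1 (Prod.dist_eq (x := q) (y := ((0 : ℝ), x₀)) ▸ Metric.mem_ball.1 hq)).2
      simp only [Metric.mem_ball, Prod.dist_eq, sup_lt_iff, Real.dist_eq, sub_zero]
      exact ⟨by rwa [abs_of_pos hε0], this⟩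
    have hcurve : ∀ t, |t| < ε → φ (t, q.2) = q.2 + ε • ∫ τ in (0 : ℝ)..(t / ε),
        f (U (ε, q.2) (projIcc (-1) 1 neg_one_le_one_real τ)) := by
      intro t ht
      have hs : t / ε ∈ Icc (-1 : ℝ) 1 := by
        rw [mem_Icc, ← abs_le, abs_div, abs_of_pos hε0, div_le_one hε0]; exact ht.le
      have := hφ (ε, q.2) hq' ⟨t / ε, hs⟩
      simp only [div_mul_cancel₀ t hε0.ne'] at this
      exact this
    have hval : U (ε, q.2) (projIcc (-1) 1 neg_one_le_one_real (q.1 / ε)) = φ q := by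
      have hs : q.1 / ε ∈ Icc (-1 : ℝ) 1 := by
        rw [mem_Icc, ← abs_le, abs_div, abs_of_pos hε0, div_le_one hε0]; exact hε.le
      have h1 := hscale (ε, q.2) hq' ⟨q.1 / ε, hs⟩
      simp only [div_mul_cancel₀ q.1 hε0.ne'] at h1
      change _ = U (q.1, q.2) one
      rw [h1, projIcc_of_mem _ hs]
      change _ = U (ε, q.2) (spanScale _ one)
      congr 1
      exact Subtype.ext (mul_one _).symm
    have hint : HasDerivAt (fun b => ∫ τ in (0 : ℝ)..b,
        f (U (ε, q.2) (projIcc (-1) 1 neg_one_le_one_real τ)))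
        (f (U (ε, q.2) (projIcc (-1) 1 neg_one_le_one_real (q.1 / ε)))) (q.1 / ε) :=
      ((hf.continuous.comp ((U (ε, q.2)).continuous.comp
        continuous_projIcc)).integral_hasStrictDerivAt 0 (q.1 / ε)).hasDerivAt
    have hdiv : HasDerivAt (fun t : ℝ => t / ε) (1 / ε) q.1 := (hasDerivAt_id q.1).div_const ε
    have h5 := ((hint.scomp q.1 hdiv).const_smul ε).const_add q.2
    rw [hval, smul_smul, mul_one_div_cancel hε0.ne', one_smul] at h5
    refine h5.congr_of_eventuallyEq ?_
    filter_upwards [(isOpen_lt continuous_abs continuous_const).mem_nhds hε] with t ht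
    exact hcurve t ht

end LocalFlow

/-! ### Components of a metric in a parametrization -/

namespace PseudoRiemannianMetric

variable {E : Type*} [NormedAddCommGroup E] [NormedSpace ℝ E]
  {M : Type*} [TopologicalSpace M] [ChartedSpace E M] [IsManifold 𝓘(ℝ, E) ∞ M]
  {W : Type*} [NormedAddCommGroup W] [NormedSpace ℝ W]
  {W' : Type*} [NormedAddCommGroup W'] [NormedSpace ℝ W']

/-- The derivative of a parametrization `h : W → M`, as a linear map between the model spaces. -/
def _root_.paramD (E : Type*) [NormedAddCommGroup E] [NormedSpace ℝ E]
    {M : Type*} [TopologicalSpace M] [ChartedSpace E M]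
    {W : Type*} [NormedAddCommGroup W] [NormedSpace ℝ W] (h : W → M) (q : W) : W →L[ℝ] E :=
  mfderiv 𝓘(ℝ, W) 𝓘(ℝ, E) h q

/-- The metric at a point, as a bilinear form on the model space. -/
def form (g : PseudoRiemannianMetric E M) (x : M) : E →L[ℝ] E →L[ℝ] ℝ := g.val x

theorem form_symm (g : PseudoRiemannianMetric E M) (x : M) (v w : E) :
    g.form x v w = g.form x w v := g.symm x v w

/-- The components of the metric in a parametrization `h : W → M`. -/
def paramMetric (g : PseudoRiemannianMetric E M) (h : W → M) (q : W) : W →L[ℝ] W →L[ℝ] ℝ :=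
  (g.form (h q)).bilinearComp (paramD E h q) (paramD E h q)

theorem paramMetric_apply (g : PseudoRiemannianMetric E M) (h : W → M) (q v w : W) :
    g.paramMetric h q v w = g.form (h q) (paramD E h q v) (paramD E h q w) :=
  rfl

theorem paramMetric_symm (g : PseudoRiemannianMetric E M) (h : W → M) (q v w : W) :
    g.paramMetric h q v w = g.paramMetric h q w v := g.form_symm _ _ _

omit [IsManifold 𝓘(ℝ, E) ∞ M] in
theorem _root_.paramD_comp {h : W' → M} {ψ : W → W'} {q : W}
    (hh : MDifferentiableAt 𝓘(ℝ, W') 𝓘(ℝ, E) h (ψ q)) (hψ : DifferentiableAt ℝ ψ q) :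
    paramD E (fun y => h (ψ y)) q = (paramD E h (ψ q)).comp (fderiv ℝ ψ q) := by
  have h1 := mfderiv_comp q hh hψ.mdifferentiableAt
  rw [mfderiv_eq_fderiv] at h1
  exact h1

omit [IsManifold 𝓘(ℝ, E) ∞ M] in
theorem _root_.paramD_congr {h h' : W → M} {q : W} (hh : h =ᶠ[𝓝 q] h') :
    paramD E h q = paramD E h' q := hh.mfderiv_eq

theorem paramMetric_congr (g : PseudoRiemannianMetric E M) {h h' : W → M} {q : W}
    (hh : h =ᶠ[𝓝 q] h') : g.paramMetric h q = g.paramMetric h' q := by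
  unfold paramMetric
  rw [paramD_congr (E := E) hh, hh.eq_of_nhds]

theorem paramMetric_comp (g : PseudoRiemannianMetric E M) {h : W' → M} {ψ : W → W'} {q : W}
    (hh : MDifferentiableAt 𝓘(ℝ, W') 𝓘(ℝ, E) h (ψ q)) (hψ : DifferentiableAt ℝ ψ q) :
    g.paramMetric (fun y => h (ψ y)) q =
      (g.paramMetric h (ψ q)).bilinearComp (fderiv ℝ ψ q) (fderiv ℝ ψ q) := by
  unfold paramMetric
  rw [paramD_comp (E := E) hh hψ]
  rfl

/-- This field along `h` is the tangent map of `h` applied to the constant section `v` of the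
tangent bundle of `W`. -/
theorem _root_.contMDiffOn_paramD_apply {h : W → M} {U : Set W} (hU : IsOpen U)
    (hh : ContMDiffOn 𝓘(ℝ, W) 𝓘(ℝ, E) ∞ h U) (v : W) :
    ContMDiffOn 𝓘(ℝ, W) 𝓘(ℝ, E).tangent ∞
      (fun q => (⟨h q, paramD E h q v⟩ : TangentBundle 𝓘(ℝ, E) M)) U := by
  have h1 := hh.contMDiffOn_tangentMapWithin (m := ∞) (by simp) hU.uniqueMDiffOn
  have h2 : ContMDiffOn 𝓘(ℝ, W) 𝓘(ℝ, W).tangent ∞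
      (fun q => (⟨q, v⟩ : TangentBundle 𝓘(ℝ, W) W)) U :=
    contMDiffOn_vectorSpace_iff_contDiffOn.2 contDiffOn_const
  refine (h1.comp h2 fun q hq => hq).congr fun q hq => ?_
  simp only [Function.comp_apply, tangentMapWithin, paramD]
  rw [mfderivWithin_of_isOpen hU hq]
  rfl

theorem contDiffOn_paramMetric_apply (g : PseudoRiemannianMetric E M) {h : W → M} {U : Set W}
    (hU : IsOpen U) (hh : ContMDiffOn 𝓘(ℝ, W) 𝓘(ℝ, E) ∞ h U) (v w : W) :
    ContDiffOn ℝ ∞ (fun q => g.paramMetric h q v w) U := by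
  have h0 : ContMDiffOn 𝓘(ℝ, W) (𝓘(ℝ, E).prod 𝓘(ℝ, E →L[ℝ] E →L[ℝ] ℝ)) ∞
      (fun q ↦ TotalSpace.mk' (E →L[ℝ] E →L[ℝ] ℝ)
        (E := fun x : M ↦ TangentSpace 𝓘(ℝ, E) x →L[ℝ] TangentSpace 𝓘(ℝ, E) x →L[ℝ]
          Bundle.Trivial M ℝ x) (h q) (g.val (h q))) U :=
    g.contMDiff.comp_contMDiffOn hh
  have h1 := ContMDiffOn.clm_bundle_apply₂ (F₁ := E) (F₂ := E) (F₃ := ℝ)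
    (E₁ := fun x : M ↦ TangentSpace 𝓘(ℝ, E) x) (E₂ := fun x : M ↦ TangentSpace 𝓘(ℝ, E) x)
    (E₃ := Bundle.Trivial M ℝ) (b := h) (ψ := fun q ↦ g.val (h q)) h0
    (contMDiffOn_paramD_apply hU hh v) (contMDiffOn_paramD_apply hU hh w)
  intro q hq
  have h2 := h1 q hq
  rw [contMDiffWithinAt_totalSpace] at h2
  exact contMDiffWithinAt_iff_contDiffWithinAt.1 h2.2

theorem contDiffOn_paramMetric [FiniteDimensional ℝ W] (g : PseudoRiemannianMetric E M) {h : W → M}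
    {U : Set W} (hU : IsOpen U) (hh : ContMDiffOn 𝓘(ℝ, W) 𝓘(ℝ, E) ∞ h U) :
    ContDiffOn ℝ ∞ (g.paramMetric h) U := by
  refine contDiffOn_clm_apply.2 fun v => contDiffOn_clm_apply.2 fun w => ?_
  exact g.contDiffOn_paramMetric_apply hU hh v w

end PseudoRiemannianMetric

/-! ### Smooth charts with values in arbitrary normed spaces -/

section SmoothChart

variable {E : Type*} [NormedAddCommGroup E] [NormedSpace ℝ E]
  {M : Type*} [TopologicalSpace M] [ChartedSpace E M]
  {W : Type*} [NormedAddCommGroup W] [NormedSpace ℝ W]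
  {W' : Type*} [NormedAddCommGroup W'] [NormedSpace ℝ W']

/-- A smooth chart with values in a normed space, not necessarily the model space. -/
structure IsSmoothChart (E : Type*) [NormedAddCommGroup E] [NormedSpace ℝ E]
    {M : Type*} [TopologicalSpace M] [ChartedSpace E M]
    {W : Type*} [NormedAddCommGroup W] [NormedSpace ℝ W] (e : OpenPartialHomeomorph M W) :
    Prop where
  contMDiffOn : ContMDiffOn 𝓘(ℝ, E) 𝓘(ℝ, W) ∞ e e.source
  contMDiffOn_symm : ContMDiffOn 𝓘(ℝ, W) 𝓘(ℝ, E) ∞ e.symm e.target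

/-- The derivative of a vector-valued map on `M`, as a linear map between the model spaces. -/
def chartD (E : Type*) [NormedAddCommGroup E] [NormedSpace ℝ E]
    {M : Type*} [TopologicalSpace M] [ChartedSpace E M]
    {W : Type*} [NormedAddCommGroup W] [NormedSpace ℝ W] (e : M → W) (x : M) : E →L[ℝ] W :=
  mfderiv 𝓘(ℝ, E) 𝓘(ℝ, W) e x

theorem isSmoothChart_chartAt [IsManifold 𝓘(ℝ, E) ∞ M] (x : M) :
    IsSmoothChart E (chartAt E x) :=
  ⟨contMDiffOn_chart, contMDiffOn_chart_symm⟩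

namespace IsSmoothChart

variable {e : OpenPartialHomeomorph M W}

theorem trans (he : IsSmoothChart E e) {R : OpenPartialHomeomorph W W'}
    (hR : ContDiffOn ℝ ∞ R R.source) (hR' : ContDiffOn ℝ ∞ R.symm R.target) :
    IsSmoothChart E (e.trans R) where
  contMDiffOn := hR.contMDiffOn.comp (he.contMDiffOn.mono inter_subset_left) fun _ hx => hx.2
  contMDiffOn_symm := he.contMDiffOn_symm.comp
    (hR'.contMDiffOn.mono inter_subset_left) fun _ hx => hx.2

theorem contMDiffAt (he : IsSmoothChart E e) {x : M} (hx : x ∈ e.source) :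
    ContMDiffAt 𝓘(ℝ, E) 𝓘(ℝ, W) ∞ e x := he.contMDiffOn.contMDiffAt (e.open_source.mem_nhds hx)

theorem contMDiffAt_symm (he : IsSmoothChart E e) {q : W} (hq : q ∈ e.target) :
    ContMDiffAt 𝓘(ℝ, W) 𝓘(ℝ, E) ∞ e.symm q :=
  he.contMDiffOn_symm.contMDiffAt (e.open_target.mem_nhds hq)

theorem mdifferentiableAt (he : IsSmoothChart E e) {x : M} (hx : x ∈ e.source) :
    MDifferentiableAt 𝓘(ℝ, E) 𝓘(ℝ, W) e x := (he.contMDiffAt hx).mdifferentiableAt (by simp)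

theorem mdifferentiableAt_symm (he : IsSmoothChart E e) {q : W} (hq : q ∈ e.target) :
    MDifferentiableAt 𝓘(ℝ, W) 𝓘(ℝ, E) e.symm q := (he.contMDiffAt_symm hq).mdifferentiableAt (by simp)

theorem chartD_comp_paramD (he : IsSmoothChart E e) {x : M} (hx : x ∈ e.source) :
    (chartD E e x).comp (paramD E e.symm (e x)) = ContinuousLinearMap.id ℝ W := by
  have hx' := e.map_source hx
  have h1 : MDifferentiableAt 𝓘(ℝ, E) 𝓘(ℝ, W) e (e.symm (e x)) := by
    rw [e.left_inv hx]; exact he.mdifferentiableAt hx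
  have h2 := mfderiv_comp (e x) h1 (he.mdifferentiableAt_symm hx')
  have h3 : (e ∘ e.symm) =ᶠ[𝓝 (e x)] id := by
    filter_upwards [e.open_target.mem_nhds hx'] with y hy using e.right_inv hy
  rw [h3.mfderiv_eq, mfderiv_id, e.left_inv hx] at h2
  exact h2.symm

theorem paramD_comp_chartD (he : IsSmoothChart E e) {x : M} (hx : x ∈ e.source) :
    (paramD E e.symm (e x)).comp (chartD E e x) = ContinuousLinearMap.id ℝ E := by
  have hx' := e.map_source hx
  have h2 := mfderiv_comp x (he.mdifferentiableAt_symm hx') (he.mdifferentiableAt hx)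
  have h3 : (e.symm ∘ e) =ᶠ[𝓝 x] id := by
    filter_upwards [e.open_source.mem_nhds hx] with y hy using e.left_inv hy
  rw [h3.mfderiv_eq, mfderiv_id] at h2
  exact h2.symm

theorem chartD_paramD (he : IsSmoothChart E e) {x : M} (hx : x ∈ e.source) (v : W) :
    chartD E e x (paramD E e.symm (e x) v) = v :=
  DFunLike.congr_fun (he.chartD_comp_paramD hx) v

theorem paramD_chartD (he : IsSmoothChart E e) {x : M} (hx : x ∈ e.source) (v : E) :
    paramD E e.symm (e x) (chartD E e x v) = v :=
  DFunLike.congr_fun (he.paramD_comp_chartD hx) v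

/-- The derivative of a smooth chart, as a continuous linear equivalence. -/
def chartDEquiv (he : IsSmoothChart E e) {x : M} (hx : x ∈ e.source) : E ≃L[ℝ] W :=
  ContinuousLinearEquiv.equivOfInverse (chartD E e x) (paramD E e.symm (e x))
    (he.paramD_chartD hx) (he.chartD_paramD hx)

theorem mfderiv_isInvertible (he : IsSmoothChart E e) {x : M} (hx : x ∈ e.source) :
    (mfderiv 𝓘(ℝ, E) 𝓘(ℝ, W) e x).IsInvertible := ⟨he.chartDEquiv hx, rfl⟩

theorem mfderiv_symm_isInvertible (he : IsSmoothChart E e) {q : W} (hq : q ∈ e.target) :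
    (mfderiv 𝓘(ℝ, W) 𝓘(ℝ, E) e.symm q).IsInvertible := by
  refine ⟨(he.chartDEquiv (e.map_target hq)).symm, ?_⟩
  change paramD E e.symm (e (e.symm q)) = paramD E e.symm q
  rw [e.right_inv hq]

theorem mpullback_apply (he : IsSmoothChart E e) {x : M} (hx : x ∈ e.source) (V : W → W) :
    VectorField.mpullback 𝓘(ℝ, E) 𝓘(ℝ, W) e V x = paramD E e.symm (e x) (V (e x)) := by
  have h1 : (mfderiv 𝓘(ℝ, E) 𝓘(ℝ, W) e x).inverse = paramD E e.symm (e x) := by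
    change ((he.chartDEquiv hx : E ≃L[ℝ] W) : E →L[ℝ] W).inverse = _
    rw [ContinuousLinearMap.inverse_equiv]
    rfl
  exact DFunLike.congr_fun h1 _

theorem mpullback_symm_apply (he : IsSmoothChart E e) {q : W} (hq : q ∈ e.target)
    (V : (x : M) → TangentSpace 𝓘(ℝ, E) x) :
    VectorField.mpullback 𝓘(ℝ, W) 𝓘(ℝ, E) e.symm V q = chartD E e (e.symm q) (V (e.symm q)) := by
  have h1 : (mfderiv 𝓘(ℝ, W) 𝓘(ℝ, E) e.symm q).inverse = chartD E e (e.symm q) := by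
    have h2 : mfderiv 𝓘(ℝ, W) 𝓘(ℝ, E) e.symm q =
        ((he.chartDEquiv (e.map_target hq)).symm : W →L[ℝ] E) := by
      change paramD E e.symm q = paramD E e.symm (e (e.symm q))
      rw [e.right_inv hq]
    rw [h2]
    change ContinuousLinearMap.inverse ((he.chartDEquiv (e.map_target hq)).symm : W →L[ℝ] E) = _
    rw [ContinuousLinearMap.inverse_equiv]
    rfl
  exact DFunLike.congr_fun h1 _

end IsSmoothChart

end SmoothChart

/-! ### The Killing and irrotationality conditions in coordinates -/

section StaticInChart

open PseudoRiemannianMetric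

variable {E : Type*} [NormedAddCommGroup E] [NormedSpace ℝ E]
  {M : Type*} [TopologicalSpace M] [ChartedSpace E M] [IsManifold 𝓘(ℝ, E) ∞ M]
  {W : Type*} [NormedAddCommGroup W] [NormedSpace ℝ W]
  {g : PseudoRiemannianMetric E M} {K : (x : M) → TangentSpace 𝓘(ℝ, E) x}
  {e : OpenPartialHomeomorph M W}

theorem IsSmoothChart.contDiffOn_field [CompleteSpace W] (he : IsSmoothChart E e)
    (hK : ContMDiff 𝓘(ℝ, E) 𝓘(ℝ, E).tangent ∞ (fun x ↦ (⟨x, K x⟩ : TangentBundle 𝓘(ℝ, E) M))) :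
    ContDiffOn ℝ ∞ (fun q => chartD E e (e.symm q) (K (e.symm q))) e.target := by
  intro q hq
  have h1 : ContMDiffAt 𝓘(ℝ, W) 𝓘(ℝ, W).tangent ∞
      (fun q => (⟨q, VectorField.mpullback 𝓘(ℝ, W) 𝓘(ℝ, E) e.symm K q⟩ :
        TangentBundle 𝓘(ℝ, W) W)) q :=
    ContMDiffAt.mpullback_vectorField_preimage (hK _) (he.contMDiffAt_symm hq)
      (he.mfderiv_symm_isInvertible hq) (by simp)
  have h2 := (contMDiffAt_vectorSpace_iff_contDiffAt.1 h1).contDiffWithinAt (s := e.target)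
  exact h2.congr (fun y hy => (he.mpullback_symm_apply hy K).symm)
    (he.mpullback_symm_apply hq K).symm

/-- The vector field on `M` whose components in the chart `e` are given by `V`. -/
def pullField (E : Type*) [NormedAddCommGroup E] [NormedSpace ℝ E]
    {M : Type*} [TopologicalSpace M] [ChartedSpace E M]
    {W : Type*} [NormedAddCommGroup W] [NormedSpace ℝ W] (e : OpenPartialHomeomorph M W)
    (V : W → W) : (x : M) → TangentSpace 𝓘(ℝ, E) x :=
  VectorField.mpullback 𝓘(ℝ, E) 𝓘(ℝ, W) e V

theorem mdifferentiableAt_field_of_differentiableAt {V : W → W} {q : W}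
    (hV : DifferentiableAt ℝ V q) : MDifferentiableAt 𝓘(ℝ, W) 𝓘(ℝ, W).tangent
      (fun y ↦ (⟨y, V y⟩ : TangentBundle 𝓘(ℝ, W) W)) q := by
  rw [mdifferentiableAt_totalSpace]
  refine ⟨mdifferentiableAt_id, ?_⟩
  refine hV.mdifferentiableAt.congr_of_eventuallyEq (Eventually.of_forall fun y => ?_)
  simp

theorem mlieBracket_eq_lieBracket (V V' : W → W) (q : W) :
    VectorField.mlieBracket 𝓘(ℝ, W) V V' q = VectorField.lieBracket ℝ V V' q := by
  have h1 := congrFun (VectorField.mlieBracketWithin_eq_lieBracketWithin (𝕜 := ℝ) (V := V)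
    (W := V') (s := univ)) q
  have h2 := congrFun (VectorField.mlieBracketWithin_univ (I := 𝓘(ℝ, W)) (V := V) (W := V')) q
  exact h2.symm.trans (h1.trans (by rw [VectorField.lieBracketWithin_univ]))

theorem IsSmoothChart.mdifferentiableAt_pullField [CompleteSpace E] (he : IsSmoothChart E e) {x : M}
    (hx : x ∈ e.source) {V : W → W} (hV : DifferentiableAt ℝ V (e x)) :
    MDifferentiableAt 𝓘(ℝ, E) 𝓘(ℝ, E).tangent
      (fun y ↦ (⟨y, pullField E e V y⟩ : TangentBundle 𝓘(ℝ, E) M)) x :=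
  MDifferentiableAt.mpullback_vectorField (n := ∞) (mdifferentiableAt_field_of_differentiableAt hV)
    (he.contMDiffAt hx) (he.mfderiv_isInvertible hx) (by norm_cast)

omit [IsManifold 𝓘(ℝ, E) ∞ M] in
theorem IsSmoothChart.eventuallyEq_pullField (he : IsSmoothChart E e) {k : W}
    (hk : ∀ q ∈ e.target, paramD E e.symm q k = K (e.symm q)) {x : M} (hx : x ∈ e.source) :
    K =ᶠ[𝓝 x] pullField E e (fun _ : W => k) := by
  filter_upwards [e.open_source.mem_nhds hx] with y hy
  have h1 := he.mpullback_apply hy (fun _ => k)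
  rw [hk _ (e.map_source hy), e.left_inv hy] at h1
  exact h1.symm

/-- Brackets are natural under pullback by the chart, and on a vector space the manifold bracket is
the usual one. -/
theorem IsSmoothChart.mlieBracket_pullField [CompleteSpace E] [CompleteSpace W]
    (he : IsSmoothChart E e) {x : M} (hx : x ∈ e.source)
    {V V' : W → W} (hV : DifferentiableAt ℝ V (e x)) (hV' : DifferentiableAt ℝ V' (e x)) :
    VectorField.mlieBracket 𝓘(ℝ, E) (pullField E e V) (pullField E e V') x =
      paramD E e.symm (e x) (VectorField.lieBracket ℝ V V' (e x)) := by
  have : IsManifold 𝓘(ℝ, E) (minSmoothness ℝ 2) M := by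
    rw [minSmoothness_of_isRCLikeNormedField]
    exact IsManifold.of_le (n := ∞) (by norm_cast)
  have h1 := VectorField.mpullback_mlieBracket (I := 𝓘(ℝ, E)) (I' := 𝓘(ℝ, W)) (n := ∞) (f := e)
    (x₀ := x) (mdifferentiableAt_field_of_differentiableAt hV)
    (mdifferentiableAt_field_of_differentiableAt hV') (he.contMDiffAt hx)
    (by rw [minSmoothness_of_isRCLikeNormedField]; norm_cast)
  refine h1.symm.trans ?_
  refine Eq.trans ?_ (congrArg _ (mlieBracket_eq_lieBracket V V' (e x)))
  exact he.mpullback_apply hx _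

theorem IsSmoothChart.differentiableAt_paramMetric_apply (he : IsSmoothChart E e) {q : W}
    (hq : q ∈ e.target) (v w : W) :
    DifferentiableAt ℝ (fun q => g.paramMetric e.symm q v w) q :=
  ((g.contDiffOn_paramMetric_apply e.open_target he.contMDiffOn_symm v w).contDiffAt
    (e.open_target.mem_nhds hq)).differentiableAt (by simp)

/-- In a chart in which the Killing field is constant, the components of the metric do not depend
on the corresponding variable. -/
theorem IsSmoothChart.fderiv_paramMetric_killing [CompleteSpace E] [CompleteSpace W]
    (he : IsSmoothChart E e) (hK : g.IsKilling K)
    {k : W} (hk : ∀ q ∈ e.target, paramD E e.symm q k = K (e.symm q)) {q : W} (hq : q ∈ e.target)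
    (v w : W) : fderiv ℝ (fun q => g.paramMetric e.symm q v w) q k = 0 := by
  have hx := e.map_target hq
  have heq : e (e.symm q) = q := e.right_inv hq
  set x := e.symm q with hxdef
  have hd : ∀ v : W, DifferentiableAt ℝ (fun _ : W => v) (e x) := fun v => differentiableAt_const v
  -- Constant coordinate fields commute with `K`, so only the derivative of the component survives
  -- in the Killing identity.
  have hbr : ∀ v : W, VectorField.mlieBracket 𝓘(ℝ, E) K (pullField E e (fun _ : W => v)) x = 0 := by
    intro v
    refine ((he.eventuallyEq_pullField hk hx).mlieBracket_vectorField_eq EventuallyEq.rfl).trans ?_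
    refine (he.mlieBracket_pullField hx (hd k) (hd v)).trans ?_
    have : VectorField.lieBracket ℝ (fun _ : W => k) (fun _ : W => v) (e x) = 0 := by
      simp [VectorField.lieBracket]
    rw [this, map_zero]
    rfl
  have h1 := hK x (pullField E e (fun _ : W => v)) (pullField E e (fun _ : W => w))
    (he.mdifferentiableAt_pullField hx (hd v)) (he.mdifferentiableAt_pullField hx (hd w))
  rw [hbr v, hbr w] at h1
  have h2 : (fun y : M => g.val y (pullField E e (fun _ : W => v) y)
      (pullField E e (fun _ : W => w) y)) =ᶠ[𝓝 x]
      (fun q => g.paramMetric e.symm q v w) ∘ e := by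
    filter_upwards [e.open_source.mem_nhds hx] with y hy
    have h3 := he.mpullback_apply hy (fun _ => v)
    have h4 := he.mpullback_apply hy (fun _ => w)
    rw [Function.comp_apply, paramMetric_apply, e.left_inv hy]
    exact congrArg₂ (fun a b => g.form y a b) h3 h4
  have h5 : DifferentiableAt ℝ (fun q => g.paramMetric e.symm q v w) (e x) := by
    rw [heq]; exact he.differentiableAt_paramMetric_apply hq v w
  have h6 := mfderiv_comp x h5.mdifferentiableAt (he.mdifferentiableAt hx)
  have h7 : chartD E e x (K x) = k := by
    have := he.chartD_paramD hx k
    rwa [heq, hk q hq] at this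
  rw [← h2.mfderiv_eq, mfderiv_eq_fderiv, heq] at h6
  have h8 : fderiv ℝ (fun q => g.paramMetric e.symm q v w) q (chartD E e x (K x)) = 0 := by
    have h9 := DFunLike.congr_fun h6 (K x)
    refine h9.symm.trans (h1.trans ?_)
    simp
  rwa [h7] at h8

/-- The one-form dual to the constant field `k`, in a chart. -/
def dualForm (g : PseudoRiemannianMetric E M) (h : W → M) (k q : W) : W →L[ℝ] ℝ :=
  (g.paramMetric h q k k)⁻¹ • g.paramMetric h q k

theorem paramMetric_field_neg (hneg : ∀ x, g.val x (K x) (K x) < 0) {k q : W}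
    (hk : paramD E e.symm q k = K (e.symm q)) : g.paramMetric e.symm q k k < 0 := by
  rw [paramMetric_apply, hk]
  exact hneg _

theorem IsSmoothChart.contDiffOn_dualForm [FiniteDimensional ℝ W] (he : IsSmoothChart E e)
    (hneg : ∀ x, g.val x (K x) (K x) < 0) {k : W}
    (hk : ∀ q ∈ e.target, paramD E e.symm q k = K (e.symm q)) :
    ContDiffOn ℝ ∞ (dualForm g e.symm k) e.target := by
  have h1 := g.contDiffOn_paramMetric e.open_target he.contMDiffOn_symm
  have h2 : ContDiffOn ℝ ∞ (fun q => g.paramMetric e.symm q k) e.target :=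
    contDiffOn_clm_apply.1 h1 k
  exact ((g.contDiffOn_paramMetric_apply e.open_target he.contMDiffOn_symm k k).inv
    fun q hq => (paramMetric_field_neg hneg (hk q hq)).ne).smul h2

/-- This is `dθ = 0`. The coordinate vectors `v`, `w`, projected to the orthogonal complement of `k`
along `k`, have a bracket with `θ`-component `-dθ(v, w)`, up to derivatives of `θ` along `k`; those
vanish by the Killing equation, and the component vanishes by irrotationality. -/
theorem IsSmoothChart.fderiv_dualForm_symm [CompleteSpace E] [FiniteDimensional ℝ W]
    (he : IsSmoothChart E e) (hneg : ∀ x, g.val x (K x) (K x) < 0) (hK : g.IsKilling K)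
    (hirr : g.IsIrrotational K)
    {k : W} (hk : ∀ q ∈ e.target, paramD E e.symm q k = K (e.symm q)) {q : W} (hq : q ∈ e.target)
    (v w : W) : fderiv ℝ (dualForm g e.symm k) q v w = fderiv ℝ (dualForm g e.symm k) q w v := by
  classical
  have : CompleteSpace W := FiniteDimensional.complete ℝ W
  set θ := dualForm g e.symm k with hθ
  have hθd : DifferentiableAt ℝ θ q := ((he.contDiffOn_dualForm hneg hk).contDiffAt
      (e.open_target.mem_nhds hq)).differentiableAt (by simp)
  have hθk : ∀ q' ∈ e.target, θ q' k = 1 := fun q' hq' => by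
    have := (paramMetric_field_neg hneg (hk q' hq')).ne
    simp [hθ, dualForm, this]
  have hGθ : ∀ q' ∈ e.target, ∀ w, g.paramMetric e.symm q' k w =
      g.paramMetric e.symm q' k k * θ q' w := fun q' hq' w => by
    have := (paramMetric_field_neg hneg (hk q' hq')).ne
    simp [hθ, dualForm, this]
  have hθw : ∀ w, fderiv ℝ (fun q => θ q w) q = (fderiv ℝ θ q).flip w := fun w => by
    have := (hθd.hasFDerivAt.clm_apply (hasFDerivAt_const w q)).fderiv
    rw [this]; ext; simp
  have hDk : ∀ w, fderiv ℝ θ q k w = 0 := by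
    intro w
    have h1 : fderiv ℝ θ q k w = fderiv ℝ (fun q => θ q w) q k := by
      rw [hθw]; rfl
    have h2 := (paramMetric_field_neg hneg (hk q hq)).ne
    have h3 : (fun q => θ q w) =
        fun q => (g.paramMetric e.symm q k k)⁻¹ * g.paramMetric e.symm q k w := by
      ext q; simp [hθ, dualForm]
    have h4 := (he.differentiableAt_paramMetric_apply (g := g) hq k k).hasFDerivAt
    have h5 := (he.differentiableAt_paramMetric_apply (g := g) hq k w).hasFDerivAt
    have h6 := (((hasDerivAt_inv h2).comp_hasFDerivAt q h4).mul h5).fderiv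
    rw [h1, h3]
    refine (DFunLike.congr_fun h6 k).trans ?_
    simp [he.fderiv_paramMetric_killing hK hk hq]
  let V : W → W → W := fun v q => v - θ q v • k
  have hV : ∀ v, HasFDerivAt (V v) (-((fderiv ℝ θ q).flip v).smulRight k) q := fun v => by
    have h1 := ((hθd.hasFDerivAt.clm_apply (hasFDerivAt_const v q)).smul_const k).const_sub v
    refine h1.congr_fderiv ?_
    ext; simp
  have hx := e.map_target hq
  have heq : e (e.symm q) = q := e.right_inv hq
  set x := e.symm q with hxdef
  -- Irrotationality asks for fields orthogonal to `K` everywhere, but differentiable only at the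
  -- point. Extension by zero outside the chart therefore suffices.
  let X : W → (y : M) → TangentSpace 𝓘(ℝ, E) y := fun v y =>
    if y ∈ e.source then pullField E e (V v) y else 0
  have hXe : ∀ v, X v =ᶠ[𝓝 x] pullField E e (V v) := fun v => by
    filter_upwards [e.open_source.mem_nhds hx] with y hy
    exact if_pos hy
  have hX0 : ∀ v y, g.val y (K y) (X v y) = 0 := by
    intro v y
    by_cases hy : y ∈ e.source
    · have h1 : X v y = pullField E e (V v) y := if_pos hy
      have h2 := he.mpullback_apply hy (V v)
      have hy' := e.map_source hy
      have h3 : K y = paramD E e.symm (e y) k := by rw [hk _ hy', e.left_inv hy]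
      have h4 : g.paramMetric e.symm (e y) k (V v (e y)) = 0 := by
        rw [hGθ _ hy', map_sub, map_smul, hθk _ hy']; simp
      rw [paramMetric_apply, e.left_inv hy] at h4
      refine Eq.trans ?_ h4
      rw [h1]
      exact congrArg₂ (fun a b => g.form y a b) h3 h2
    · have h1 : X v y = 0 := if_neg hy
      rw [h1, map_zero]
  have hXd : ∀ v, MDifferentiableAt 𝓘(ℝ, E) 𝓘(ℝ, E).tangent
      (fun y ↦ (⟨y, X v y⟩ : TangentBundle 𝓘(ℝ, E) M)) x := fun v => by
    refine (he.mdifferentiableAt_pullField hx (V := V v)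
      (by rw [heq]; exact (hV v).differentiableAt)).congr_of_eventuallyEq ?_
    filter_upwards [hXe v] with y hy
    rw [hy]
  have h1 := hirr x (X v) (X w) (hXd v) (hXd w) (hX0 v) (hX0 w)
  have h2 := ((hXe v).mlieBracket_vectorField_eq (hXe w)).trans
    (he.mlieBracket_pullField hx (V := V v) (V' := V w)
      (by rw [heq]; exact (hV v).differentiableAt) (by rw [heq]; exact (hV w).differentiableAt))
  rw [h2, heq] at h1
  have h3 : g.paramMetric e.symm q k (VectorField.lieBracket ℝ (V v) (V w) q) = 0 := by
    rw [paramMetric_apply, hk q hq]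
    exact h1
  rw [hGθ q hq, mul_eq_zero, or_iff_right (paramMetric_field_neg hneg (hk q hq)).ne] at h3
  rw [VectorField.lieBracket, (hV v).fderiv, (hV w).fderiv] at h3
  simp only [V, neg_apply, ContinuousLinearMap.smulRight_apply,
    ContinuousLinearMap.flip_apply, map_sub, map_smul, map_neg, hDk, hθk q hq] at h3
  simp only [smul_eq_mul] at h3
  linarith

end StaticInChart

/-! ### Straightening a nonvanishing vector field -/

section FlowBox

variable {E : Type u} [NormedAddCommGroup E] [NormedSpace ℝ E] [FiniteDimensional ℝ E]
  {F : Type u} [NormedAddCommGroup F] [NormedSpace ℝ F] [FiniteDimensional ℝ F]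

/-- Multiplication by a bump function supported in `U`. It supplies the globally smooth field which
the flow theorem requires. -/
theorem exists_contDiff_eventuallyEq {f : E → E} {U : Set E} (hU : IsOpen U)
    (hf : ContDiffOn ℝ ∞ f U) {p : E} (hp : p ∈ U) :
    ∃ f' : E → E, ContDiff ℝ ∞ f' ∧ f' =ᶠ[𝓝 p] f := by
  obtain ⟨r, hr, hrU⟩ := Metric.isOpen_iff.1 hU p hp
  let χ : ContDiffBump p := ⟨r / 4, r / 2, by positivity, by linarith⟩
  refine ⟨fun x => χ x • f x, ?_, ?_⟩
  · rw [contDiff_iff_contDiffAt]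
    intro x
    by_cases hx : x ∈ U
    · exact χ.contDiff.contDiffAt.smul (hf.contDiffAt (hU.mem_nhds hx))
    · have hx' : x ∉ tsupport χ := by
        rw [χ.tsupport_eq]
        intro h
        refine hx (hrU (Metric.closedBall_subset_ball ?_ h))
        change r / 2 < r
        linarith
      have h1 : (fun x => χ x • f x) =ᶠ[𝓝 x] fun _ => 0 := by
        filter_upwards [(isClosed_tsupport χ).isOpen_compl.mem_nhds hx'] with y hy
        rw [image_eq_zero_of_notMem_tsupport hy, zero_smul]
      exact contDiffAt_const.congr_of_eventuallyEq h1
  · filter_upwards [χ.eventuallyEq_one] with y hy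
    simp [hy]

/-- Straightening of a vector field near a point where it does not vanish. -/
theorem exists_flowBox (hd : Module.finrank ℝ E = Module.finrank ℝ F + 1) {f : E → E} {U : Set E}
    (hU : IsOpen U) (hf : ContDiffOn ℝ ∞ f U) {p : E} (hp : p ∈ U) (hfp : f p ≠ 0) :
    ∃ R : OpenPartialHomeomorph (ℝ × F) E, 0 ∈ R.source ∧ R 0 = p ∧ R.target ⊆ U ∧
      ContDiffOn ℝ ∞ R R.source ∧ ContDiffOn ℝ ∞ R.symm R.target ∧
      ∀ q ∈ R.source, fderiv ℝ R q (1, 0) = f (R q) := by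
  have : CompleteSpace E := FiniteDimensional.complete ℝ E
  obtain ⟨f', hf', hff'⟩ := exists_contDiff_eventuallyEq hU hf hp
  obtain ⟨s, hs, hsf⟩ := Metric.eventually_nhds_iff_ball.1 (hff'.and (hU.mem_nhds hp))
  obtain ⟨δ, hδ, φ, hφ, hφ'⟩ := exists_contDiffOn_flow hf' p
  obtain ⟨L, hL⟩ : ∃ L : (ℝ × F) ≃L[ℝ] E, L (1, 0) = f p := by
    let L₀ : (ℝ × F) ≃L[ℝ] E := ContinuousLinearEquiv.ofFinrankEq (by
      rw [Module.finrank_prod, Module.finrank_self, hd, add_comm])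
    have h0 : L₀ (1, 0) ≠ 0 := by simp
    obtain ⟨A, hA⟩ := SeparatingDual.exists_continuousLinearEquiv_apply_eq (R := ℝ) h0 hfp
    exact ⟨L₀.trans A, hA⟩
  -- Initial points run over the affine hyperplane `p + L (0, ·)`, which is transversal to `f p = L
  -- (1, 0)`.
  let j : ℝ × F → ℝ × E := fun q => (q.1, p + L (0, q.2))
  have hj : ContDiff ℝ ∞ j := by
    refine contDiff_fst.prodMk (contDiff_const.add (L.contDiff.comp ?_))
    exact contDiff_const.prodMk contDiff_snd
  have hj0 : j 0 = (0, p) := by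
    have : L (0, 0) = 0 := L.map_zero
    simp [j, this]
  let U₁ : Set (ℝ × F) := j ⁻¹' Metric.ball (0, p) δ
  have hU₁ : IsOpen U₁ := Metric.isOpen_ball.preimage hj.continuous
  have h0U₁ : (0 : ℝ × F) ∈ U₁ := by
    change j 0 ∈ Metric.ball (0, p) δ
    rw [hj0]; exact Metric.mem_ball_self hδ
  let ψ : ℝ × F → E := fun q => φ (j q)
  have hψ : ContDiffOn ℝ ∞ ψ U₁ := hφ.comp hj.contDiffOn fun q hq => hq
  let U₂ := U₁ ∩ ψ ⁻¹' Metric.ball p s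
  have hU₂ : IsOpen U₂ := hψ.continuousOn.isOpen_inter_preimage hU₁ Metric.isOpen_ball
  have hψ0 : ψ 0 = p := by
    change φ (j 0) = p
    rw [hj0]; exact (hφ' _ (Metric.mem_ball_self hδ)).1
  have h0U₂ : (0 : ℝ × F) ∈ U₂ := by
    refine ⟨h0U₁, ?_⟩
    change ψ 0 ∈ Metric.ball p s
    rw [hψ0]; exact Metric.mem_ball_self hs
  have hdt : ∀ q ∈ U₂, fderiv ℝ ψ q (1, 0) = f (ψ q) := by
    intro q hq
    have h1 := (hφ' (j q) hq.1).2
    have h2 : HasDerivAt (fun t : ℝ => (t, q.2)) ((1, 0) : ℝ × F) q.1 :=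
      (hasDerivAt_id q.1).prodMk (hasDerivAt_const q.1 q.2)
    have h3 : HasFDerivAt ψ (fderiv ℝ ψ q) (q.1, q.2) :=
      ((hψ.contDiffAt (hU₁.mem_nhds hq.1)).differentiableAt (by simp)).hasFDerivAt
    have h5 := h3.comp_hasDerivAt q.1 h2
    have h4 : fderiv ℝ ψ q (1, 0) = f' (ψ q) := h5.unique h1
    rw [h4]
    exact (hsf _ hq.2).1
  -- At time zero the flow is the identity, so the space derivative is that of the parametrized
  -- hyperplane. With `f p = L (1, 0)` the full derivative at the origin is `L`.
  have hdx : ∀ z, fderiv ℝ ψ 0 (0, z) = L (0, z) := by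
    intro z
    have h3 : HasFDerivAt ψ (fderiv ℝ ψ 0) 0 :=
      ((hψ.contDiffAt (hU₁.mem_nhds h0U₁)).differentiableAt (by simp)).hasFDerivAt
    have h2 : HasDerivAt (fun t : ℝ => ((0 : ℝ), t • z)) ((0, z) : ℝ × F) 0 := by
      refine (hasDerivAt_const (0:ℝ) (0:ℝ)).prodMk ?_
      simpa using (hasDerivAt_id (0:ℝ)).smul_const z
    have h3' : HasFDerivAt ψ (fderiv ℝ ψ 0) ((0 : ℝ), (0:ℝ) • z) := by rw [zero_smul]; exact h3
    have h4 := h3'.comp_hasDerivAt (0:ℝ) h2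
    have h5 : HasDerivAt (fun t : ℝ => p + t • L (0, z)) (L (0, z)) 0 := by
      simpa using ((hasDerivAt_id (0:ℝ)).smul_const (L (0, z))).const_add p
    refine h4.unique (h5.congr_of_eventuallyEq ?_)
    have hc : Continuous fun t : ℝ => ((0 : ℝ), t • z) := by fun_prop
    have hmem : ∀ᶠ t : ℝ in 𝓝 0, ((0 : ℝ), t • z) ∈ U₁ := by
      refine hc.continuousAt.eventually_mem (hU₁.mem_nhds ?_)
      rw [zero_smul]; exact h0U₁
    filter_upwards [hmem] with t ht
    have h6 := (hφ' _ ht).1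
    change φ (0, p + L (0, t • z)) = _
    refine h6.trans ?_
    change p + L (0, t • z) = p + t • L (0, z)
    rw [← map_smul]; simp
  have hA : HasFDerivAt ψ (L : (ℝ × F) →L[ℝ] E) 0 := by
    refine ((hψ.contDiffAt (hU₁.mem_nhds h0U₁)).differentiableAt (by simp)).hasFDerivAt.congr_fderiv
      ?_
    ext v
    · simpa [hψ0, hL] using hdt 0 h0U₂
    · simpa using hdx v
  obtain ⟨R, hR0, hRψ, hRs, -, hRsymm⟩ :=
    exists_openPartialHomeomorph_contDiff hU₂ (hψ.mono inter_subset_left) h0U₂ hA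
  refine ⟨R, hR0, by rw [hRψ, hψ0], ?_, ?_, hRsymm, ?_⟩
  · intro y hy
    have h1 := (hRs (R.map_target hy)).2
    rw [← hRψ] at h1
    have h2 : R (R.symm y) ∈ Metric.ball p s := h1
    rw [R.right_inv hy] at h2
    exact (hsf _ h2).2
  · rw [hRψ]
    exact hψ.mono (hRs.trans inter_subset_left)
  · intro q hq
    rw [hRψ]
    exact hdt q (hRs hq)

end FlowBox

/-! ### Static parametrizations and static charts of the base manifold -/

open PseudoRiemannianMetric

/-- `h : ℝ × F → M` parametrizes a part of `M` as a standard static manifold over the set `U`: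
the field `K` corresponds to `∂_t`, and the metric has no mixed terms and does not depend
on the time. -/
structure IsStaticParam {E : Type*} [NormedAddCommGroup E] [NormedSpace ℝ E]
    {M : Type*} [TopologicalSpace M] [ChartedSpace E M] [IsManifold 𝓘(ℝ, E) ∞ M]
    {F : Type*} [NormedAddCommGroup F] [NormedSpace ℝ F]
    (g : PseudoRiemannianMetric E M) (K : (x : M) → TangentSpace 𝓘(ℝ, E) x)
    (h : ℝ × F → M) (U : Set (ℝ × F)) : Prop where
  contMDiffOn : ContMDiffOn 𝓘(ℝ, ℝ × F) 𝓘(ℝ, E) ∞ h U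
  field : ∀ q ∈ U, paramD E h q (1, 0) = K (h q)
  cross : ∀ q ∈ U, ∀ z, g.paramMetric h q (1, 0) (0, z) = 0
  indep : ∀ q ∈ U, ∀ q' ∈ U, q.2 = q'.2 → g.paramMetric h q = g.paramMetric h q'

theorem IsStaticParam.mono {E : Type*} [NormedAddCommGroup E] [NormedSpace ℝ E]
    {M : Type*} [TopologicalSpace M] [ChartedSpace E M] [IsManifold 𝓘(ℝ, E) ∞ M]
    {F : Type*} [NormedAddCommGroup F] [NormedSpace ℝ F]
    {g : PseudoRiemannianMetric E M} {K : (x : M) → TangentSpace 𝓘(ℝ, E) x}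
    {h : ℝ × F → M} {U V : Set (ℝ × F)} (hh : IsStaticParam g K h U) (hV : V ⊆ U) :
    IsStaticParam g K h V :=
  ⟨hh.contMDiffOn.mono hV, fun q hq => hh.field q (hV hq), fun q hq => hh.cross q (hV hq),
    fun q hq q' hq' => hh.indep q (hV hq) q' (hV hq')⟩

section FlowBoxChart

variable {E : Type u} [NormedAddCommGroup E] [NormedSpace ℝ E] [FiniteDimensional ℝ E]
  {F : Type u} [NormedAddCommGroup F] [NormedSpace ℝ F] [FiniteDimensional ℝ F]
  {M : Type*} [TopologicalSpace M] [ChartedSpace E M] [IsManifold 𝓘(ℝ, E) ∞ M]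
  {g : PseudoRiemannianMetric E M} {K : (x : M) → TangentSpace 𝓘(ℝ, E) x}

theorem exists_flowBox_chart (hd : Module.finrank ℝ E = Module.finrank ℝ F + 1)
    (hK : ContMDiff 𝓘(ℝ, E) 𝓘(ℝ, E).tangent ∞ (fun x ↦ (⟨x, K x⟩ : TangentBundle 𝓘(ℝ, E) M)))
    {p : M} (hp : K p ≠ 0) :
    ∃ e : OpenPartialHomeomorph M (ℝ × F), IsSmoothChart E e ∧ p ∈ e.source ∧
      ∀ q ∈ e.target, paramD E e.symm q (1, 0) = K (e.symm q) := by
  have : CompleteSpace E := FiniteDimensional.complete ℝ E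
  have hc := isSmoothChart_chartAt (E := E) p
  set c := chartAt E p
  have hpc : p ∈ c.source := mem_chart_source E p
  have hfp : chartD E c (c.symm (c p)) (K (c.symm (c p))) ≠ 0 := by
    rw [c.left_inv hpc]
    intro h
    apply hp
    have := hc.paramD_chartD hpc (K p)
    rw [h, map_zero] at this
    exact this.symm
  obtain ⟨R, hR0, hRp, hRt, hR, hRs, hRd⟩ := exists_flowBox (F := F) hd c.open_target
    (hc.contDiffOn_field hK) (c.map_source hpc) hfp
  refine ⟨c.trans R.symm, hc.trans hRs hR, ⟨hpc, ?_⟩, ?_⟩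
  · change c p ∈ R.target
    rw [← hRp]; exact R.map_source hR0
  · rintro q ⟨hq, -⟩
    have hq' : q ∈ R.source := hq
    have hRq : R q ∈ c.target := hRt (R.map_source hq')
    have h1 := paramD_comp (E := E) (hc.mdifferentiableAt_symm hRq)
      ((hR.contDiffAt (R.open_source.mem_nhds hq')).differentiableAt (by simp))
    have h2 := DFunLike.congr_fun h1 (1, 0)
    refine h2.trans ?_
    rw [ContinuousLinearMap.comp_apply, hRd q hq']
    have h3 := hc.paramD_chartD (c.map_target hRq) (K (c.symm (R q)))
    rw [c.right_inv hRq] at h3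
    exact h3

-- Balls are convex. This serves the Poincaré lemma, the constancy of components along time lines,
-- and the fact that a time line meets the target in an interval.
omit [FiniteDimensional ℝ E] [IsManifold 𝓘(ℝ, E) ∞ M] in
theorem IsSmoothChart.exists_restr_ball {W : Type*} [NormedAddCommGroup W] [NormedSpace ℝ W]
    {e : OpenPartialHomeomorph M W} (he : IsSmoothChart E e) {p : M} (hp : p ∈ e.source) :
    ∃ (e' : OpenPartialHomeomorph M W) (r : ℝ), 0 < r ∧ IsSmoothChart E e' ∧ p ∈ e'.source ∧
      e'.target = Metric.ball (e' p) r ∧ ⇑e' = e ∧ ⇑e'.symm = e.symm ∧ e'.target ⊆ e.target ∧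
      e'.source ⊆ e.source := by
  obtain ⟨r, hr, hrs⟩ := Metric.isOpen_iff.1 e.open_target _ (e.map_source hp)
  let R := OpenPartialHomeomorph.ofSet (Metric.ball (e p) r) Metric.isOpen_ball
  refine ⟨e.trans R, r, hr, he.trans contDiffOn_id contDiffOn_id,
    ⟨hp, Metric.mem_ball_self hr⟩, ?_, rfl, rfl, ?_, ?_⟩
  · exact Subset.antisymm (fun x hx => hx.1) fun x hx => ⟨hx, hrs hx⟩
  · exact fun x hx => hx.2
  · exact fun x hx => hx.1

/-- In a flow box, replace the time coordinate by a primitive `τ` of the closed form `θ` and keep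
the space coordinates. Then `θ` becomes `dt`; since `θ` is a multiple of `g(K, ·)`, mixed terms
vanish. The field is still `∂_t`, because `θ(K) = 1` and `K` does not move the space coordinates. -/
theorem exists_staticChart (hd : Module.finrank ℝ E = Module.finrank ℝ F + 1)
    (hK : g.IsStaticField K) (p : M) :
    ∃ (e : OpenPartialHomeomorph M (ℝ × F)) (r : ℝ), 0 < r ∧ IsSmoothChart E e ∧ p ∈ e.source ∧
      e.target = Metric.ball (e p) r ∧ IsStaticParam g K e.symm e.target := by
  have : CompleteSpace E := FiniteDimensional.complete ℝ E
  have hKp : K p ≠ 0 := by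
    intro h
    have := hK.timelike p
    rw [h, map_zero, lt_self_iff_false] at this
    exact this
  obtain ⟨e₀, he₀, hp₀, hk₀⟩ := exists_flowBox_chart (F := F) hd hK.contMDiff hKp
  obtain ⟨e₁, r₁, hr₁, he₁, hp₁, ht₁, -, hs₁, hsub₁, -⟩ := he₀.exists_restr_ball hp₀
  set k : ℝ × F := (1, 0) with hkdef
  have hk₁ : ∀ q ∈ e₁.target, paramD E e₁.symm q k = K (e₁.symm q) := fun q hq => by
    rw [hs₁]; exact hk₀ q (hsub₁ hq)
  set θ := dualForm g e₁.symm k with hθ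
  have hθs : ContDiffOn ℝ ∞ θ e₁.target := he₁.contDiffOn_dualForm hK.timelike hk₁
  have hθk : ∀ q ∈ e₁.target, θ q k = 1 := fun q' hq' => by
    have := (paramMetric_field_neg hK.timelike (hk₁ q' hq')).ne
    simp [hθ, dualForm, this]
  obtain ⟨τ, hτ⟩ := Convex.exists_forall_hasFDerivAt_of_fderiv_symmetric
    (s := e₁.target) (by rw [ht₁]; exact convex_ball _ _) e₁.open_target
    (hθs.differentiableOn (by simp))
    (fun q hq v w => he₁.fderiv_dualForm_symm hK.timelike hK.killing hK.irrotational hk₁ hq v w)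
  have hτs : ContDiffOn ℝ ∞ τ e₁.target := by
    rw [contDiffOn_infty_iff_fderiv_of_isOpen e₁.open_target]
    exact ⟨fun q hq => (hτ q hq).differentiableAt.differentiableWithinAt,
      hθs.congr fun q hq => (hτ q hq).fderiv⟩
  let κ : ℝ × F → ℝ × F := fun q => (τ q, q.2)
  have hκs : ContDiffOn ℝ ∞ κ e₁.target := hτs.prodMk contDiff_snd.contDiffOn
  have hκ : ∀ q ∈ e₁.target, HasFDerivAt κ ((θ q).prod (ContinuousLinearMap.snd ℝ ℝ F)) q :=
    fun q hq => (hτ q hq).prodMk hasFDerivAt_snd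
  have hsplit : ∀ q ∈ e₁.target, ∀ v : ℝ × F, θ q v = v.1 + θ q (0, v.2) := fun q hq v => by
    conv_lhs => rw [show v = v.1 • k + (0, v.2) by ext <;> simp [k]]
    rw [map_add, map_smul, hθk q hq]
    simp
  have hqp := e₁.map_source hp₁
  -- As `θ(k) = 1`, the derivative of `κ` is the shear `(t, z) ↦ (t + θ(0, z), z)`; its inverse
  -- subtracts `θ(0, z)`.
  let A : (ℝ × F) ≃L[ℝ] (ℝ × F) := ContinuousLinearEquiv.equivOfInverse
    ((θ (e₁ p)).prod (ContinuousLinearMap.snd ℝ ℝ F))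
    ((ContinuousLinearMap.fst ℝ ℝ F - (θ (e₁ p)).comp
      ((ContinuousLinearMap.inr ℝ ℝ F).comp (ContinuousLinearMap.snd ℝ ℝ F))).prod
        (ContinuousLinearMap.snd ℝ ℝ F))
    (fun v => by
      ext
      · have := hsplit _ hqp v
        simp only [ContinuousLinearMap.prod_apply, sub_apply,
          ContinuousLinearMap.comp_apply, ContinuousLinearMap.coe_fst',
          ContinuousLinearMap.coe_snd', ContinuousLinearMap.inr_apply]
        linarith
      · rfl)
    (fun v => by
      ext
      · have := hsplit _ hqp (v.1 - θ (e₁ p) (0, v.2), v.2)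
        simp only [ContinuousLinearMap.prod_apply, sub_apply,
          ContinuousLinearMap.comp_apply, ContinuousLinearMap.coe_fst',
          ContinuousLinearMap.coe_snd', ContinuousLinearMap.inr_apply]
        linarith
      · rfl)
  obtain ⟨R, hR0, hRκ, hRs, -, hRsymm⟩ := exists_openPartialHomeomorph_contDiff e₁.open_target
    hκs hqp (A := A) (hκ _ hqp)
  have he₂ : IsSmoothChart E (e₁.trans R) := he₁.trans (by rw [hRκ]; exact hκs.mono hRs) hRsymm
  obtain ⟨e, r, hr, he, hpe, het, -, hes, hsub, -⟩ := he₂.exists_restr_ball (p := p) ⟨hp₁, hR0⟩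
  have hmem : ∀ q ∈ e.target, R.symm q ∈ R.source ∧ R.symm q ∈ e₁.target ∧ q ∈ R.target :=
    fun q hq => ⟨R.map_target (hsub hq).1, (hsub hq).2, (hsub hq).1⟩
  have hsymm : ⇑e.symm = fun q => e₁.symm (R.symm q) := hes
  have hRd : ∀ q ∈ e.target, DifferentiableAt ℝ R.symm q := fun q hq =>
    (hRsymm.contDiffAt (R.open_target.mem_nhds (hmem q hq).2.2)).differentiableAt (by simp)
  -- Differentiating `κ ∘ R.symm = id`: in the new coordinates `θ` is `dt`.
  have hRR : ∀ q ∈ e.target, ∀ v, θ (R.symm q) (fderiv ℝ R.symm q v) = v.1 := by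
    intro q hq v
    have h1 := (hκ _ (hmem q hq).2.1).comp q (hRd q hq).hasFDerivAt
    have h2 : κ ∘ R.symm =ᶠ[𝓝 q] id := by
      filter_upwards [R.open_target.mem_nhds (hmem q hq).2.2] with y hy
      rw [← hRκ]; exact R.right_inv hy
    have h3 := (h1.congr_of_eventuallyEq h2.symm).unique (hasFDerivAt_id q)
    exact congrArg Prod.fst (DFunLike.congr_fun h3 v)
  -- Differentiating `R.symm ∘ κ = id` in the direction `k`, which the derivative of `κ` fixes.
  have hRk : ∀ q ∈ e.target, fderiv ℝ R.symm q k = k := by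
    intro q hq
    have h0 : DifferentiableAt ℝ R.symm (κ (R.symm q)) := by
      rw [← hRκ, R.right_inv (hmem q hq).2.2]; exact hRd q hq
    have h1 := h0.hasFDerivAt.comp _ (hκ _ (hmem q hq).2.1)
    have h2 : R.symm ∘ κ =ᶠ[𝓝 (R.symm q)] id := by
      filter_upwards [R.open_source.mem_nhds (hmem q hq).1] with y hy
      rw [← hRκ]; exact R.left_inv hy
    have h3 := (h1.congr_of_eventuallyEq h2.symm).unique (hasFDerivAt_id _)
    have h4 := DFunLike.congr_fun h3 k
    rw [← hRκ, R.right_inv (hmem q hq).2.2] at h4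
    simp only [ContinuousLinearMap.comp_apply, ContinuousLinearMap.prod_apply,
      hθk _ (hmem q hq).2.1] at h4
    exact h4
  have hmd : ∀ q ∈ e.target, MDifferentiableAt 𝓘(ℝ, ℝ × F) 𝓘(ℝ, E) e₁.symm (R.symm q) :=
    fun q hq => he₁.mdifferentiableAt_symm (hmem q hq).2.1
  have hfield : ∀ q ∈ e.target, paramD E e.symm q k = K (e.symm q) := by
    intro q hq
    have h1 := DFunLike.congr_fun (paramD_comp (E := E) (hmd q hq) (hRd q hq)) k
    rw [ContinuousLinearMap.comp_apply, hRk q hq, hk₁ _ (hmem q hq).2.1] at h1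
    rw [hsymm]
    exact h1
  refine ⟨e, r, hr, he, hpe, het, he.contMDiffOn_symm, hfield, ?_, ?_⟩
  · intro q hq z
    have h1 := g.paramMetric_comp (hmd q hq) (hRd q hq)
    have h2 := (paramMetric_field_neg hK.timelike (hk₁ _ (hmem q hq).2.1)).ne
    rw [hsymm, h1, ContinuousLinearMap.bilinearComp_apply, hRk q hq]
    have h3 := hRR q hq (0, z)
    rw [hθ, dualForm, smul_apply, smul_eq_mul, mul_eq_zero,
      or_iff_right (inv_ne_zero h2)] at h3
    exact h3
  · intro q hq q' hq' hqq
    refine ContinuousLinearMap.ext fun v => ContinuousLinearMap.ext fun w => ?_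
    rw [het] at hq hq'
    -- Points of the ball with equal space coordinates are joined inside the ball by a segment
    -- parallel to `k`. Along it the components are constant by the Killing equation.
    let l : ℝ →ᵃ[ℝ] ℝ × F := AffineMap.lineMap q q'
    let S : Set ℝ := l ⁻¹' Metric.ball (e p) r
    have hlc : Continuous l := AffineMap.lineMap_continuous
    have hl : ∀ s, HasDerivAt l ((q'.1 - q.1) • k) s := fun s => by
      have : (q'.1 - q.1) • k = q' - q := by
        ext <;> simp [k, hqq]
      rw [this]
      exact AffineMap.hasDerivAt_lineMap
    have hder : ∀ s ∈ S, HasDerivAt (fun s => g.paramMetric e.symm (l s) v w) 0 s := by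
      intro s hs
      have hs' : l s ∈ e.target := by rw [het]; exact hs
      have h1 := (he.differentiableAt_paramMetric_apply (g := g) hs' v w).hasFDerivAt.comp_hasDerivAt
        s (hl s)
      rw [map_smul, he.fderiv_paramMetric_killing hK.killing hfield hs', smul_zero] at h1
      exact h1
    have h1 := (Metric.isOpen_ball.preimage hlc).is_const_of_deriv_eq_zero
      (((convex_ball (e p) r).affine_preimage l).isPreconnected)
      (fun s hs => (hder s hs).differentiableAt.differentiableWithinAt)
      (fun s hs => (hder s hs).deriv)
      (x := 0) (y := 1) (by simpa [l] using hq) (by simpa [l] using hq')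
    simpa [l] using h1

end FlowBoxChart

/-! ### Static charts upstairs and the lifted field -/

/-- A chart of `N` which presents `N` with the lift of `g` as a standard static manifold. -/
structure IsStaticChart {E : Type*} [NormedAddCommGroup E] [NormedSpace ℝ E]
    {M : Type*} [TopologicalSpace M] [ChartedSpace E M] [IsManifold 𝓘(ℝ, E) ∞ M]
    {N : Type*} [TopologicalSpace N] [ChartedSpace E N]
    {F : Type*} [NormedAddCommGroup F] [NormedSpace ℝ F]
    (g : PseudoRiemannianMetric E M) (K : (x : M) → TangentSpace 𝓘(ℝ, E) x) (proj : N → M)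
    (e : OpenPartialHomeomorph N (ℝ × F)) : Prop where
  smooth : IsSmoothChart E e
  param : IsStaticParam g K (fun q => proj (e.symm q)) e.target
  target_ball : ∃ q₀ r, e.target = Metric.ball q₀ r

/-- The lift of a vector field by a local diffeomorphism. -/
def liftField {E : Type*} [NormedAddCommGroup E] [NormedSpace ℝ E]
    {M : Type*} [TopologicalSpace M] [ChartedSpace E M]
    {N : Type*} [TopologicalSpace N] [ChartedSpace E N]
    (K : (x : M) → TangentSpace 𝓘(ℝ, E) x) (proj : N → M) (p : N) : TangentSpace 𝓘(ℝ, E) p :=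
  VectorField.mpullback 𝓘(ℝ, E) 𝓘(ℝ, E) proj K p

section Lift

variable {E : Type*} [NormedAddCommGroup E] [NormedSpace ℝ E]
  {F : Type*} [NormedAddCommGroup F] [NormedSpace ℝ F]
  {M : Type*} [TopologicalSpace M] [ChartedSpace E M]
  {N : Type*} [TopologicalSpace N] [ChartedSpace E N]
  {K : (x : M) → TangentSpace 𝓘(ℝ, E) x} {proj : N → M}

/-- The differential of a map between manifolds, as a map between the model spaces. -/
def mapD (E : Type*) [NormedAddCommGroup E] [NormedSpace ℝ E]
    {M : Type*} [TopologicalSpace M] [ChartedSpace E M]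
    {N : Type*} [TopologicalSpace N] [ChartedSpace E N] (proj : N → M) (p : N) : E →L[ℝ] E :=
  mfderiv 𝓘(ℝ, E) 𝓘(ℝ, E) proj p

theorem IsLocalDiffeomorph.mfderiv_isInvertible
    (hproj : IsLocalDiffeomorph 𝓘(ℝ, E) 𝓘(ℝ, E) ∞ proj) (p : N) :
    (mfderiv 𝓘(ℝ, E) 𝓘(ℝ, E) proj p).IsInvertible :=
  ⟨hproj.mfderivToContinuousLinearEquiv (by simp) p,
    hproj.mfderivToContinuousLinearEquiv_coe (by simp) p⟩

theorem mapD_liftField (hproj : IsLocalDiffeomorph 𝓘(ℝ, E) 𝓘(ℝ, E) ∞ proj) (p : N) :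
    mapD E proj p (liftField K proj p) = K (proj p) := by
  obtain ⟨A, hA⟩ : ∃ A : E ≃L[ℝ] E, (A : E →L[ℝ] E) = mapD E proj p :=
    hproj.mfderiv_isInvertible p
  have h1 : liftField K proj p = A.symm (K (proj p)) := by
    change (mapD E proj p).inverse (K (proj p)) = _
    rw [← hA, ContinuousLinearMap.inverse_equiv]
    rfl
  rw [h1, ← hA]
  exact A.apply_symm_apply _

theorem mapD_injective (hproj : IsLocalDiffeomorph 𝓘(ℝ, E) 𝓘(ℝ, E) ∞ proj) (p : N) :
    Function.Injective (mapD E proj p) := by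
  obtain ⟨A, hA⟩ : ∃ A : E ≃L[ℝ] E, (A : E →L[ℝ] E) = mapD E proj p :=
    hproj.mfderiv_isInvertible p
  rw [← hA]
  exact A.injective

theorem contMDiff_liftField [CompleteSpace E] [IsManifold 𝓘(ℝ, E) ∞ M] [IsManifold 𝓘(ℝ, E) ∞ N]
    (hproj : IsLocalDiffeomorph 𝓘(ℝ, E) 𝓘(ℝ, E) ∞ proj)
    (hK : ContMDiff 𝓘(ℝ, E) 𝓘(ℝ, E).tangent ∞ (fun x ↦ (⟨x, K x⟩ : TangentBundle 𝓘(ℝ, E) M))) :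
    ContMDiff 𝓘(ℝ, E) 𝓘(ℝ, E).tangent ∞
      (fun p ↦ (⟨p, liftField K proj p⟩ : TangentBundle 𝓘(ℝ, E) N)) :=
  hK.mpullback_vectorField hproj.contMDiff hproj.mfderiv_isInvertible (by simp)

theorem paramD_proj_comp {W : Type*} [NormedAddCommGroup W] [NormedSpace ℝ W]
    (hproj : IsLocalDiffeomorph 𝓘(ℝ, E) 𝓘(ℝ, E) ∞ proj)
    {h : W → N} {q : W} (hh : MDifferentiableAt 𝓘(ℝ, W) 𝓘(ℝ, E) h q) :
    paramD E (fun q => proj (h q)) q = (mapD E proj (h q)).comp (paramD E h q) :=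
  mfderiv_comp q ((hproj.contMDiff _).mdifferentiableAt (by simp)) hh

theorem IsStaticChart.paramD_eq [IsManifold 𝓘(ℝ, E) ∞ M] {g : PseudoRiemannianMetric E M}
    (hproj : IsLocalDiffeomorph 𝓘(ℝ, E) 𝓘(ℝ, E) ∞ proj)
    {e : OpenPartialHomeomorph N (ℝ × F)} (he : IsStaticChart g K proj e) {q : ℝ × F}
    (hq : q ∈ e.target) : paramD E e.symm q (1, 0) = liftField K proj (e.symm q) := by
  apply mapD_injective hproj
  refine Eq.trans ?_ (mapD_liftField hproj (K := K) (e.symm q)).symm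
  rw [← he.param.field q hq, paramD_proj_comp hproj (he.smooth.mdifferentiableAt_symm hq)]
  rfl

end Lift

section

variable {E : Type u} [NormedAddCommGroup E] [NormedSpace ℝ E] [FiniteDimensional ℝ E]
  {F : Type u} [NormedAddCommGroup F] [NormedSpace ℝ F] [FiniteDimensional ℝ F]
  {M : Type*} [TopologicalSpace M] [ChartedSpace E M] [IsManifold 𝓘(ℝ, E) ∞ M]
  {N : Type*} [TopologicalSpace N] [ChartedSpace E N]
  {g : PseudoRiemannianMetric E M} {K : (x : M) → TangentSpace 𝓘(ℝ, E) x} {proj : N → M}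

/-- Near `p` the map `proj` is a diffeomorphism, so a static chart of `M` at `proj p` can be
composed with it. On a small ball `proj ∘ e.symm` is then the inverse of the chart of `M`, and the
static properties carry over. -/
theorem exists_isStaticChart (hd : Module.finrank ℝ E = Module.finrank ℝ F + 1)
    (hK : g.IsStaticField K) (hproj : IsLocalDiffeomorph 𝓘(ℝ, E) 𝓘(ℝ, E) ∞ proj) (p : N) :
    ∃ e : OpenPartialHomeomorph N (ℝ × F), IsStaticChart g K proj e ∧ p ∈ e.source := by
  obtain ⟨e₀, r₀, -, he₀, hp₀, -, hs₀⟩ := exists_staticChart (F := F) hd hK (proj p)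
  obtain ⟨Ψ, hpΨ, hΨ⟩ := hproj p
  let e₁ := Ψ.toOpenPartialHomeomorph.trans e₀
  have he₁ : IsSmoothChart E e₁ := by
    constructor
    · exact he₀.contMDiffOn.comp (Ψ.contMDiffOn.mono inter_subset_left) fun x hx => hx.2
    · exact Ψ.contMDiffOn_invFun.comp (he₀.contMDiffOn_symm.mono inter_subset_left) fun x hx => hx.2
  have hp₁ : p ∈ e₁.source := ⟨hpΨ, by
    change Ψ p ∈ e₀.source
    rw [← hΨ hpΨ]; exact hp₀⟩
  obtain ⟨e, r, hr, he, hpe, het, -, hes, hsub, -⟩ := IsSmoothChart.exists_restr_ball he₁ hp₁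
  refine ⟨e, ⟨he, ?_, _, _, het⟩, hpe⟩
  have hU : e.target ⊆ e₀.target := fun q hq => (hsub hq).1
  have heq : EqOn (fun q => proj (e.symm q)) e₀.symm e.target := by
    intro q hq
    have h1 : e₀.symm q ∈ Ψ.target := (hsub hq).2
    change proj (e.symm q) = _
    rw [hes]
    change proj (Ψ.invFun (e₀.symm q)) = _
    rw [hΨ (Ψ.map_target' h1)]
    exact Ψ.right_inv' h1
  have heq' : ∀ q ∈ e.target, (fun q => proj (e.symm q)) =ᶠ[𝓝 q] e₀.symm := fun q hq =>
    heq.eventuallyEq_of_mem (e.open_target.mem_nhds hq)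
  have h0 := hs₀.mono hU
  refine ⟨h0.contMDiffOn.congr heq, fun q hq => ?_, fun q hq z => ?_, fun q hq q' hq' hqq => ?_⟩
  · rw [paramD_congr (heq' q hq), h0.field q hq, (heq' q hq).eq_of_nhds]
  · rw [g.paramMetric_congr (heq' q hq), h0.cross q hq]
  · rw [g.paramMetric_congr (heq' q hq), g.paramMetric_congr (heq' q' hq'), h0.indep q hq q' hq' hqq]

end

/-! ### The metric and the static form in static charts -/

section StaticChart

variable {E : Type*} [NormedAddCommGroup E] [NormedSpace ℝ E]
  {F : Type*} [NormedAddCommGroup F] [NormedSpace ℝ F]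
  {M : Type*} [TopologicalSpace M] [ChartedSpace E M] [IsManifold 𝓘(ℝ, E) ∞ M]
  {N : Type*} [TopologicalSpace N] [ChartedSpace E N]
  {g : PseudoRiemannianMetric E M} {K : (x : M) → TangentSpace 𝓘(ℝ, E) x} {proj : N → M}
  {e : OpenPartialHomeomorph N (ℝ × F)}

theorem IsStaticParam.apply_one {h : ℝ × F → M} {U : Set (ℝ × F)}
    (hh : IsStaticParam g K h U) {q : ℝ × F} (hq : q ∈ U) (w : ℝ × F) :
    g.paramMetric h q (1, 0) w = w.1 * g.paramMetric h q (1, 0) (1, 0) := by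
  conv_lhs => rw [show w = w.1 • ((1 : ℝ), (0 : F)) + (0, w.2) by ext <;> simp]
  rw [map_add, map_smul, hh.cross q hq, add_zero, smul_eq_mul]

theorem IsStaticParam.apply_apply {h : ℝ × F → M} {U : Set (ℝ × F)}
    (hh : IsStaticParam g K h U) {q : ℝ × F} (hq : q ∈ U) (v w : ℝ × F) :
    g.paramMetric h q v w = v.1 * w.1 * g.paramMetric h q (1, 0) (1, 0) +
      g.paramMetric h q (0, v.2) (0, w.2) := by
  have h1 : ∀ v : ℝ × F, v = v.1 • ((1 : ℝ), (0 : F)) + (0, v.2) := fun v => by ext <;> simp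
  conv_lhs => rw [h1 v, h1 w]
  simp only [map_add, map_smul, add_apply, smul_apply, smul_eq_mul, hh.cross q hq,
    g.paramMetric_symm h q (0, v.2) (1, 0)]
  ring

theorem IsStaticParam.paramMetric_one_one {h : ℝ × F → M} {U : Set (ℝ × F)}
    (hh : IsStaticParam g K h U) {q : ℝ × F} (hq : q ∈ U) :
    g.paramMetric h q (1, 0) (1, 0) = g.val (h q) (K (h q)) (K (h q)) := by
  rw [paramMetric_apply, hh.field q hq]
  rfl

theorem IsStaticChart.mapD_eq (hproj : IsLocalDiffeomorph 𝓘(ℝ, E) 𝓘(ℝ, E) ∞ proj)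
    (he : IsStaticChart g K proj e) {p : N} (hp : p ∈ e.source) (v : E) :
    mapD E proj p v = paramD E (fun q => proj (e.symm q)) (e p) (chartD E e p v) := by
  have h := DFunLike.congr_fun (paramD_proj_comp hproj
    (he.smooth.mdifferentiableAt_symm (e.map_source hp))) (chartD E e p v)
  rw [ContinuousLinearMap.comp_apply, he.smooth.paramD_chartD hp, e.left_inv hp] at h
  exact h.symm

theorem IsStaticChart.form_mapD (hproj : IsLocalDiffeomorph 𝓘(ℝ, E) 𝓘(ℝ, E) ∞ proj)
    (he : IsStaticChart g K proj e) {p : N} (hp : p ∈ e.source) (v w : E) :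
    g.form (proj p) (mapD E proj p v) (mapD E proj p w) =
      g.paramMetric (fun q => proj (e.symm q)) (e p) (chartD E e p v) (chartD E e p w) := by
  rw [paramMetric_apply, ← he.mapD_eq hproj hp, ← he.mapD_eq hproj hp, e.left_inv hp]

/-- The time coordinate of a static chart is a primitive of the static form. -/
theorem IsStaticChart.staticForm_eq (hproj : IsLocalDiffeomorph 𝓘(ℝ, E) 𝓘(ℝ, E) ∞ proj)
    (hneg : ∀ x, g.val x (K x) (K x) < 0)
    (he : IsStaticChart g K proj e) {p : N} (hp : p ∈ e.source) (v : E) :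
    g.staticForm K (proj p) (mapD E proj p v) = (chartD E e p v).1 := by
  have hq := e.map_source hp
  have h1 := he.param.apply_one hq (chartD E e p v)
  rw [he.param.paramMetric_one_one hq, e.left_inv hp, paramMetric_apply, he.param.field _ hq,
    ← he.mapD_eq hproj hp, e.left_inv hp] at h1
  have h2 : g.val (proj p) (K (proj p)) (mapD E proj p v) = _ := h1
  have h3 := (hneg (proj p)).ne
  change -(-(1 / g.val (proj p) (K (proj p)) (K (proj p))) *
    g.val (proj p) (K (proj p)) (mapD E proj p v)) = _
  rw [h2]
  field_simp

/-- A static chart with translated time coordinate. -/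
theorem IsStaticChart.translate (he : IsStaticChart g K proj e) (c : ℝ) :
    ∃ e' : OpenPartialHomeomorph N (ℝ × F), IsStaticChart g K proj e' ∧ e'.source = e.source ∧
      ∀ p, e' p = e p + (c, 0) := by
  let T : OpenPartialHomeomorph (ℝ × F) (ℝ × F) :=
    (Homeomorph.addRight ((c, 0) : ℝ × F)).toOpenPartialHomeomorph
  let e' := e.trans T
  have hT : ∀ q, T.symm q = q + -((c, 0) : ℝ × F) := fun _ => rfl
  have hTd : ∀ q, HasFDerivAt T.symm (ContinuousLinearMap.id ℝ (ℝ × F)) q := fun q =>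
    (hasFDerivAt_id q).add_const _
  have hmem : ∀ q ∈ e'.target, T.symm q ∈ e.target := fun q hq => hq.2
  have hmd : ∀ q ∈ e'.target, MDifferentiableAt 𝓘(ℝ, ℝ × F) 𝓘(ℝ, E)
      (fun q => proj (e.symm q)) (T.symm q) := fun q hq =>
    (he.param.contMDiffOn.contMDiffAt
      (e.open_target.mem_nhds (hmem q hq))).mdifferentiableAt (by simp)
  have hpm : ∀ q ∈ e'.target, g.paramMetric (fun q => proj (e'.symm q)) q =
      g.paramMetric (fun q => proj (e.symm q)) (T.symm q) := fun q hq => by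
    have h1 := g.paramMetric_comp (hmd q hq) (hTd q).differentiableAt
    rw [(hTd q).fderiv] at h1
    exact h1
  have hs1 : ContDiff ℝ ∞ T := contDiff_id.add contDiff_const
  have hs2 : ContDiff ℝ ∞ T.symm := contDiff_id.add contDiff_const
  refine ⟨e', ⟨he.smooth.trans hs1.contDiffOn hs2.contDiffOn, ⟨?_, ?_, ?_, ?_⟩, ?_⟩, ?_,
    fun p => rfl⟩
  · exact he.param.contMDiffOn.comp hs2.contDiffOn.contMDiffOn hmem
  · intro q hq
    have h1 := DFunLike.congr_fun (paramD_comp (E := E) (hmd q hq) (hTd q).differentiableAt) (1, 0)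
    rw [(hTd q).fderiv] at h1
    exact h1.trans (he.param.field _ (hmem q hq))
  · intro q hq z
    rw [hpm q hq]
    exact he.param.cross _ (hmem q hq) z
  · intro q hq q' hq' hqq
    rw [hpm q hq, hpm q' hq']
    refine he.param.indep _ (hmem q hq) _ (hmem q' hq') ?_
    rw [hT, hT]
    simp [hqq]
  · obtain ⟨q₀, r, hr⟩ := he.target_ball
    refine ⟨q₀ + (c, 0), r, ?_⟩
    ext q
    change q ∈ univ ∩ T.symm ⁻¹' e.target ↔ _
    rw [hr, univ_inter, mem_preimage, hT, Metric.mem_ball, Metric.mem_ball, dist_eq_norm,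
      dist_eq_norm, add_sub_right_comm, ← sub_eq_add_neg]
    congr! 2
    abel
  · change e.source ∩ e ⁻¹' univ = _
    simp

end StaticChart

/-- The truth value of `P` is a locally constant function on `s`. The open-and-closed arguments
along flow lines and geodesics go through this form. -/
theorem IsPreconnected.forall_of_eventually_iff {X : Type*} [TopologicalSpace X] {s : Set X}
    (hs : IsPreconnected s) {x : X} (hx : x ∈ s) {P : X → Prop} (hP : P x)
    (h : ∀ y ∈ s, ∀ᶠ z in 𝓝[s] y, (P z ↔ P y)) : ∀ y ∈ s, P y := by
  classical
  intro y hy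
  have h1 : ContinuousOn (fun y => decide (P y)) s := by
    intro z hz
    refine (continuousWithinAt_const (b := decide (P z))).congr_of_eventuallyEq ?_ rfl
    filter_upwards [h z hz] with z' hz'
    simp [hz']
  have h2 := hs.constant h1 hx hy
  simpa [hP] using h2

/-! ### Gluing local primitives on a simply connected space -/

section Primitive

variable {X : Type*} [TopologicalSpace X] {A : Type*} [AddCommGroup A]
  [TopologicalSpace A] [DiscreteTopology A] {ι : Type*}

/-- The covering of `X` whose sections are the functions which locally differ by constants from the
given local functions `f i : U i → A`. -/
def primitiveCore (U : ι → Set X) (hU : ∀ i, IsOpen (U i)) (ix : X → ι) (hix : ∀ x, x ∈ U (ix x))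
    (f : ι → X → A) (hf : ∀ i j, ∀ x ∈ U i ∩ U j, ∀ᶠ y in 𝓝 x, f j y - f i y = f j x - f i x) :
    FiberBundleCore ι X A where
  baseSet := U
  isOpen_baseSet := hU
  indexAt := ix
  mem_baseSet_at := hix
  coordChange i j x a := a - (f j x - f i x)
  coordChange_self i x _ a := by simp
  continuousOn_coordChange i j := by
    rintro ⟨x, a⟩ ⟨hx, -⟩
    refine ContinuousAt.continuousWithinAt ?_
    have h1 : Tendsto (fun q : X × A => q.2) (𝓝 (x, a)) (𝓝 a) := continuous_snd.tendsto _
    rw [nhds_discrete A, tendsto_pure] at h1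
    have h2 := (continuous_fst.tendsto (x, a)).eventually (hf i j x hx)
    refine (continuousAt_const (y := a - (f j x - f i x))).congr ?_
    filter_upwards [h1, h2] with q hq1 hq2
    rw [hq1, hq2]
  coordChange_comp i j k x _ a := by abel

/-- The possible values of a primitive form a covering space of `X` with discrete fibre `A`. As `X`
is simply connected, the identity of `X` lifts to this covering, and the lift is a global primitive.
-/
theorem exists_primitive [SimplyConnectedSpace X] [LocallyPathConnectedSpace X]
    (U : ι → Set X) (hU : ∀ i, IsOpen (U i)) (ix : X → ι) (hix : ∀ x, x ∈ U (ix x))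
    (f : ι → X → A) (hf : ∀ i j, ∀ x ∈ U i ∩ U j, ∀ᶠ y in 𝓝 x, f j y - f i y = f j x - f i x) :
    ∃ t : X → A, ∀ i, ∀ x ∈ U i, ∀ᶠ y in 𝓝 x, t y - f i y = t x - f i x := by
  let Z := primitiveCore U hU ix hix f hf
  have hcov : IsCoveringMap (Bundle.TotalSpace.proj : Bundle.TotalSpace A Z.Fiber → X) :=
    FiberBundle.isCoveringMap (F := A)
  obtain ⟨x₀⟩ : Nonempty X := inferInstance
  obtain ⟨s, ⟨-, hs⟩, -⟩ := hcov.existsUnique_continuousMap_lifts (ContinuousMap.id X) x₀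
    (⟨x₀, (0 : A)⟩ : Bundle.TotalSpace A Z.Fiber) rfl
  have hs' : ∀ x, (s x).proj = x := fun x => congrFun hs x
  -- Over `U i` the fibre coordinate of the section is the global primitive minus `f i`. It is
  -- continuous into a discrete space, hence locally constant.
  refine ⟨fun x => (Z.localTriv (ix x) (s x)).2 + f (ix x) x, fun i x hx => ?_⟩
  have key : ∀ y ∈ U i, (Z.localTriv (ix y) (s y)).2 + f (ix y) y - f i y =
      (Z.localTriv i (s y)).2 := by
    intro y hy
    have h1 : ∀ p : Bundle.TotalSpace A Z.Fiber,
        (Z.localTriv (ix p.proj) p).2 + f (ix p.proj) p.proj - f i p.proj =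
          (Z.localTriv i p).2 := by
      intro p
      let a : A := p.2
      change a - (f (ix p.proj) p.proj - f (ix p.proj) p.proj) + f (ix p.proj) p.proj -
        f i p.proj = a - (f i p.proj - f (ix p.proj) p.proj)
      abel
    have h2 := h1 (s y)
    rwa [hs' y] at h2
  have hcont : ContinuousAt (fun y => (Z.localTriv i (s y)).2) x := by
    have h1 : ContinuousAt (Z.localTriv i) (s x) := by
      refine (Z.localTriv i).continuousAt ?_
      rw [Bundle.Trivialization.mem_source]
      change (s x).proj ∈ U i
      rw [hs']
      exact hx
    exact continuousAt_snd.comp (h1.comp s.continuous.continuousAt)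
  have h1 : Tendsto (fun y => (Z.localTriv i (s y)).2) (𝓝 x) (𝓝 (Z.localTriv i (s x)).2) := hcont
  rw [nhds_discrete A, tendsto_pure] at h1
  filter_upwards [h1, (hU i).mem_nhds hx] with y hy hyU
  rw [key y hyU, key x hx, hy]

end Primitive

/-! ### The global time function -/

section Time

variable {E : Type*} [NormedAddCommGroup E] [NormedSpace ℝ E]
  {F : Type*} [NormedAddCommGroup F] [NormedSpace ℝ F]
  {M : Type*} [TopologicalSpace M] [ChartedSpace E M] [IsManifold 𝓘(ℝ, E) ∞ M]
  {N : Type*} [TopologicalSpace N] [ChartedSpace E N]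
  {g : PseudoRiemannianMetric E M} {K : (x : M) → TangentSpace 𝓘(ℝ, E) x} {proj : N → M}
  {e e' : OpenPartialHomeomorph N (ℝ × F)}

theorem IsSmoothChart.contDiffOn_transition {W W' : Type*} [NormedAddCommGroup W] [NormedSpace ℝ W]
    [NormedAddCommGroup W'] [NormedSpace ℝ W'] {e : OpenPartialHomeomorph N W}
    {e' : OpenPartialHomeomorph N W'} (he : IsSmoothChart E e) (he' : IsSmoothChart E e') :
    ContDiffOn ℝ ∞ (fun q => e' (e.symm q)) (e.target ∩ e.symm ⁻¹' e'.source) :=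
  contMDiffOn_iff_contDiffOn.1 (he'.contMDiffOn.comp (he.contMDiffOn_symm.mono inter_subset_left)
    fun _ hq => hq.2)

theorem IsSmoothChart.fderiv_transition {W W' : Type*} [NormedAddCommGroup W] [NormedSpace ℝ W]
    [NormedAddCommGroup W'] [NormedSpace ℝ W'] {e : OpenPartialHomeomorph N W}
    {e' : OpenPartialHomeomorph N W'} (he : IsSmoothChart E e) (he' : IsSmoothChart E e')
    {q : W} (hq : q ∈ e.target) (hq' : e.symm q ∈ e'.source) (v : W) :
    fderiv ℝ (fun q => e' (e.symm q)) q v = chartD E e' (e.symm q) (paramD E e.symm q v) := by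
  have h1 := mfderiv_comp q (he'.mdifferentiableAt hq') (he.mdifferentiableAt_symm hq)
  rw [mfderiv_eq_fderiv] at h1
  exact DFunLike.congr_fun h1 v

/-- The time coordinates of two static charts differ locally by a constant. -/
theorem IsStaticChart.eventually_sub (hproj : IsLocalDiffeomorph 𝓘(ℝ, E) 𝓘(ℝ, E) ∞ proj)
    (hneg : ∀ x, g.val x (K x) (K x) < 0) (he : IsStaticChart g K proj e)
    (he' : IsStaticChart g K proj e') {p : N} (hp : p ∈ e.source) (hp' : p ∈ e'.source) :
    ∀ᶠ y in 𝓝 p, (e' y).1 - (e y).1 = (e' p).1 - (e p).1 := by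
  let O := e.target ∩ e.symm ⁻¹' e'.source
  have hO : IsOpen O := e.symm.isOpen_inter_preimage e'.open_source
  have hpO : e p ∈ O := ⟨e.map_source hp, by rw [mem_preimage, e.left_inv hp]; exact hp'⟩
  have hder : ∀ q ∈ O, HasFDerivAt (fun q => (e' (e.symm q)).1 - q.1) (0 : ℝ × F →L[ℝ] ℝ) q := by
    intro q hq
    have h1 := (((he.smooth.contDiffOn_transition he'.smooth).contDiffAt
      (hO.mem_nhds hq)).differentiableAt (by simp)).hasFDerivAt
    refine (h1.fst.sub (hasFDerivAt_fst (𝕜 := ℝ) (p := q))).congr_fderiv ?_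
    refine ContinuousLinearMap.ext fun v => ?_
    have h2 := he.smooth.fderiv_transition he'.smooth hq.1 hq.2 v
    have h3 := he.staticForm_eq hproj hneg (e.map_target hq.1) (paramD E e.symm q v)
    have h4 := he'.staticForm_eq hproj hneg hq.2 (paramD E e.symm q v)
    have h5 := he.smooth.chartD_paramD (e.map_target hq.1) v
    rw [e.right_inv hq.1] at h5
    rw [h3, h5] at h4
    change (fderiv ℝ (fun q => e' (e.symm q)) q v).1 - v.1 = 0
    rw [h2, ← h4, sub_self]
  obtain ⟨r, hr, hrO⟩ := Metric.isOpen_iff.1 hO _ hpO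
  have hc := fun y hy => Metric.isOpen_ball.is_const_of_fderiv_eq_zero
    (convex_ball (e p) r).isPreconnected (𝕜 := ℝ) (f := fun q => (e' (e.symm q)).1 - q.1)
    (fun q hq => (hder q (hrO hq)).differentiableAt.differentiableWithinAt)
    (fun q hq => (hder q (hrO hq)).fderiv) (x := y) (y := e p) hy (Metric.mem_ball_self hr)
  have h1 : ∀ᶠ y in 𝓝 p, e y ∈ Metric.ball (e p) r :=
    (e.continuousAt hp).eventually_mem (Metric.ball_mem_nhds _ hr)
  filter_upwards [h1, e.open_source.mem_nhds hp] with y hy hys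
  have h2 := hc (e y) hy
  simpa only [e.left_inv hys, e.left_inv hp] using h2

theorem IsStaticChart.isPreconnected_source (he : IsStaticChart g K proj e) :
    IsPreconnected e.source := by
  obtain ⟨q₀, r, hr⟩ := he.target_ball
  rw [← e.symm_image_target_eq_source]
  refine IsPreconnected.image ?_ _ e.symm.continuousOn
  rw [hr]
  exact (convex_ball _ _).isPreconnected

end Time

section

variable {E : Type u} [NormedAddCommGroup E] [NormedSpace ℝ E] [FiniteDimensional ℝ E]
  {F : Type u} [NormedAddCommGroup F] [NormedSpace ℝ F] [FiniteDimensional ℝ F]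
  {M : Type*} [TopologicalSpace M] [ChartedSpace E M] [IsManifold 𝓘(ℝ, E) ∞ M]
  {N : Type*} [TopologicalSpace N] [ChartedSpace E N]
  {g : PseudoRiemannianMetric E M} {K : (x : M) → TangentSpace 𝓘(ℝ, E) x} {proj : N → M}

/-- On a simply connected manifold there is a global time function, which is the time coordinate
of a static chart near each point. -/
theorem exists_staticTime (hd : Module.finrank ℝ E = Module.finrank ℝ F + 1)
    (hK : g.IsStaticField K) (hproj : IsLocalDiffeomorph 𝓘(ℝ, E) 𝓘(ℝ, E) ∞ proj)
    [SimplyConnectedSpace N] :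
    ∃ t : N → ℝ, ∀ p, ∃ e : OpenPartialHomeomorph N (ℝ × F), IsStaticChart g K proj e ∧
      p ∈ e.source ∧ ∀ y ∈ e.source, (e y).1 = t y := by
  have : LocallyPathConnectedSpace N := ChartedSpace.locallyPathConnectedSpace E N
  choose e he hpe using exists_isStaticChart (F := F) hd hK hproj
  -- The fibre is `ℝ` with the discrete topology `⊥`, since the time coordinates are compared up to
  -- locally constant functions.
  obtain ⟨t, ht⟩ := @exists_primitive N _ ℝ _ ⊥ (@DiscreteTopology.mk _ ⊥ rfl) N _ _
    (fun p => (e p).source) (fun p => (e p).open_source) id hpe (fun p y => (e p y).1)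
    (fun p p' x hx => (he p).eventually_sub hproj hK.timelike (he p') hx.1 hx.2)
  refine ⟨t, fun p => ?_⟩
  -- The chart is shifted so that its time agrees with `t` at `p`. The two then agree on the whole
  -- source, which is connected.
  obtain ⟨e', he', hs, hee'⟩ := (he p).translate (t p - (e p p).1)
  refine ⟨e', he', by rw [hs]; exact hpe p, fun y hy => ?_⟩
  rw [hs] at hy
  have h1 : ∀ y ∈ (e p).source, t y - (e p y).1 = t p - (e p p).1 := by
    intro y hy
    refine (he p).isPreconnected_source.forall_of_eventually_iff (hpe p)
      (P := fun y => t y - (e p y).1 = t p - (e p p).1) rfl (fun z hz => ?_) y hy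
    filter_upwards [mem_nhdsWithin_of_mem_nhds (ht p z hz)] with z' hz'
    rw [hz']
  rw [hee', ← h1 y hy]
  simp

end

/-! ### The flow of the lifted field -/

section Flow

variable {E : Type*} [NormedAddCommGroup E] [NormedSpace ℝ E]
  {F : Type*} [NormedAddCommGroup F] [NormedSpace ℝ F]
  {M : Type*} [TopologicalSpace M] [ChartedSpace E M] [IsManifold 𝓘(ℝ, E) ∞ M]
  {N : Type*} [TopologicalSpace N] [ChartedSpace E N]
  {g : PseudoRiemannianMetric E M} {K : (x : M) → TangentSpace 𝓘(ℝ, E) x} {proj : N → M}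
  {e : OpenPartialHomeomorph N (ℝ × F)}

omit [IsManifold 𝓘(ℝ, E) ∞ M] in
/-- Lifts of integral curves are integral curves of the lifted field. -/
theorem isMIntegralCurve_liftField (hproj : IsLocalDiffeomorph 𝓘(ℝ, E) 𝓘(ℝ, E) ∞ proj)
    {c : ℝ → N} (hc : Continuous c) (hγ : IsMIntegralCurve (I := 𝓘(ℝ, E)) (proj ∘ c) K) :
    IsMIntegralCurve (I := 𝓘(ℝ, E)) c (liftField K proj) := by
  intro r
  obtain ⟨Ψ, hrΨ, hΨ⟩ := hproj (c r)
  have h1 : MDifferentiableAt 𝓘(ℝ, ℝ) 𝓘(ℝ, E) (proj ∘ c) r := (hγ r).mdifferentiableAt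
  have h2 : MDifferentiableAt 𝓘(ℝ, E) 𝓘(ℝ, E) Ψ.symm ((proj ∘ c) r) := by
    refine Ψ.symm.mdifferentiableAt (by simp) ?_
    change proj (c r) ∈ Ψ.target
    rw [hΨ hrΨ]
    exact Ψ.map_source' hrΨ
  have h3 : c =ᶠ[𝓝 r] Ψ.symm ∘ (proj ∘ c) := by
    filter_upwards [hc.continuousAt.eventually_mem (Ψ.open_source.mem_nhds hrΨ)] with s hs
    change c s = Ψ.symm (proj (c s))
    rw [hΨ hs]
    exact (Ψ.left_inv' hs).symm
  have h4 : MDifferentiableAt 𝓘(ℝ, ℝ) 𝓘(ℝ, E) c r :=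
    (h2.comp r h1).congr_of_eventuallyEq h3
  have h5 : mfderiv 𝓘(ℝ, ℝ) 𝓘(ℝ, E) c r =
      (1 : ℝ →L[ℝ] ℝ).smulRight (liftField K proj (c r)) := by
    have h6 := mfderiv_comp r ((hproj.contMDiff (c r)).mdifferentiableAt (by simp)) h4
    rw [(hγ r).mfderiv] at h6
    have h7 : (1 : ℝ) • K (proj (c r)) =
        mapD E proj (c r) (mfderiv 𝓘(ℝ, ℝ) 𝓘(ℝ, E) c r (1 : ℝ)) := DFunLike.congr_fun h6 (1 : ℝ)
    have h8 := mapD_injective hproj _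
      (((mapD_liftField hproj (K := K) (c r)).trans (one_smul ℝ (K (proj (c r)))).symm).trans h7)
    refine ContinuousLinearMap.ext_ring ?_
    refine h8.symm.trans (one_smul ℝ _).symm
  rw [← h5]
  exact h4.hasMFDerivAt

-- An integral curve of `K`, defined on `ℝ`, lifts as a path to the covering with the same domain.
omit [IsManifold 𝓘(ℝ, E) ∞ M] in
theorem isCompleteField_liftField (hproj : IsLocalDiffeomorph 𝓘(ℝ, E) 𝓘(ℝ, E) ∞ proj)
    (hcov : IsCoveringMap proj) (hK : IsCompleteField K) : IsCompleteField (liftField K proj) := by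
  intro p
  obtain ⟨γ, hγ0, hγ⟩ := hK (proj p)
  have hγc : Continuous γ := continuous_iff_continuousAt.2 fun r => (hγ r).continuousAt
  obtain ⟨c, ⟨hc0, hc⟩, -⟩ := hcov.existsUnique_continuousMap_lifts ⟨γ, hγc⟩ 0 p hγ0.symm
  refine ⟨c, hc0, isMIntegralCurve_liftField hproj c.continuous ?_⟩
  rw [hc]
  exact hγ

/-- The time lines of a static chart are integral curves. -/
theorem IsStaticChart.isMIntegralCurveOn (hproj : IsLocalDiffeomorph 𝓘(ℝ, E) 𝓘(ℝ, E) ∞ proj)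
    (he : IsStaticChart g K proj e) (q : ℝ × F) :
    IsMIntegralCurveOn (I := 𝓘(ℝ, E)) (fun s : ℝ => e.symm (q + (s, 0))) (liftField K proj)
      {s | q + (s, 0) ∈ e.target} := by
  intro s hs
  have h1 : HasDerivAt (fun s : ℝ => q + (s, (0 : F))) (1, 0) s :=
    ((hasDerivAt_id s).prodMk (hasDerivAt_const s (0 : F))).const_add q
  have h2 := (he.smooth.mdifferentiableAt_symm hs).hasMFDerivAt.comp s
    h1.hasFDerivAt.hasMFDerivAt
  have h3 : (mfderiv 𝓘(ℝ, ℝ × F) 𝓘(ℝ, E) e.symm (q + (s, 0))).comp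
      (ContinuousLinearMap.toSpanSingleton ℝ ((1, 0) : ℝ × F)) =
      (1 : ℝ →L[ℝ] ℝ).smulRight (liftField K proj (e.symm (q + (s, 0)))) := by
    refine ContinuousLinearMap.ext_ring ?_
    change paramD E e.symm (q + (s, 0)) ((1 : ℝ) • (1, 0)) =
      (1 : ℝ) • liftField K proj (e.symm (q + (s, 0)))
    rw [one_smul, one_smul]
    exact he.paramD_eq hproj hs
  rw [← h3]
  exact h2.hasMFDerivWithinAt

/-- The flow of the lifted field, characterized by its expression in static charts. -/
structure IsStaticFlow (g : PseudoRiemannianMetric E M) (K : (x : M) → TangentSpace 𝓘(ℝ, E) x)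
    (proj : N → M) (F : Type*) [NormedAddCommGroup F] [NormedSpace ℝ F] (fl : ℝ → N → N) :
    Prop where
  integral : ∀ p, IsMIntegralCurve (I := 𝓘(ℝ, E)) (fun r => fl r p) (liftField K proj)
  zero : ∀ p, fl 0 p = p
  add : ∀ r s p, fl (r + s) p = fl r (fl s p)
  chart : ∀ e : OpenPartialHomeomorph N (ℝ × F), IsStaticChart g K proj e → ∀ q ∈ e.target,
    ∀ s : ℝ, q + (s, 0) ∈ e.target → fl s (e.symm q) = e.symm (q + (s, 0))

/-- Completeness provides the curves. Uniqueness of integral curves gives both the group law and the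
agreement with the time lines of static charts; regularity in the initial point is later read off
from the latter. -/
theorem exists_isStaticFlow [T2Space N] [IsManifold 𝓘(ℝ, E) ∞ N] [CompleteSpace E]
    (hproj : IsLocalDiffeomorph 𝓘(ℝ, E) 𝓘(ℝ, E) ∞ proj)
    (hKs : ContMDiff 𝓘(ℝ, E) 𝓘(ℝ, E).tangent ∞ (fun x ↦ (⟨x, K x⟩ : TangentBundle 𝓘(ℝ, E) M)))
    (hcov : IsCoveringMap proj) (hK : IsCompleteField K) :
    ∃ fl : ℝ → N → N, IsStaticFlow g K proj F fl := by
  have hX := (contMDiff_liftField hproj hKs).of_le (m := 1) (by norm_cast)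
  have : IsManifold 𝓘(ℝ, E) 1 N := IsManifold.of_le (n := ∞) (by norm_cast)
  choose c hc0 hc using isCompleteField_liftField hproj hcov hK
  refine ⟨fun r p => c p r, hc, hc0, fun r s p => ?_, fun e he q hq s hs => ?_⟩
  · have h1 := isMIntegralCurve_Ioo_eq_of_contMDiff_boundaryless (t₀ := 0) hX
      ((hc p).comp_add s) (hc (c p s)) (by simp [hc0])
    exact congrFun h1 r
  · obtain ⟨q₀, R, hR⟩ := he.target_ball
    -- Balls of a product are products of balls, so the time line meets the target in an interval,
    -- as the uniqueness theorem requires.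
    have hmem : ∀ s : ℝ, q + (s, 0) ∈ e.target ↔ s ∈ Ioo (q₀.1 - R - q.1) (q₀.1 + R - q.1) := by
      intro s
      rw [hR, ← ball_prod_same, mem_prod] at hq ⊢
      rw [Prod.fst_add, Prod.snd_add, add_zero, and_iff_left hq.2, Real.ball_eq_Ioo, mem_Ioo,
        mem_Ioo]
      constructor <;> rintro ⟨h1, h2⟩ <;> constructor <;> linarith
    have hcurve := he.isMIntegralCurveOn hproj q
    have hset : {s : ℝ | q + (s, 0) ∈ e.target} = Ioo (q₀.1 - R - q.1) (q₀.1 + R - q.1) :=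
      Set.ext hmem
    rw [hset] at hcurve
    have hq0 : q + ((0 : ℝ), (0 : F)) = q := by
      change q + 0 = q
      exact add_zero q
    exact isMIntegralCurveOn_Ioo_eqOn_of_contMDiff_boundaryless (t₀ := 0)
      ((hmem 0).1 (by rw [hq0]; exact hq)) hX ((hc (e.symm q)).isMIntegralCurveOn _) hcurve
      (by rw [hc0, hq0]) ((hmem s).1 hs)

/-- The flow at time `s` preserves the static structure near `x`. -/
structure IsFlowStaticAt (g : PseudoRiemannianMetric E M) (K : (x : M) → TangentSpace 𝓘(ℝ, E) x)
    (proj : N → M) (t : N → ℝ) (f : N → N) (s : ℝ) (x : N) : Prop where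
  contMDiffAt : ContMDiffAt 𝓘(ℝ, E) 𝓘(ℝ, E) ∞ f x
  time : t (f x) = t x + s
  isometry : ∀ v w : E, g.form (proj (f x)) (mapD E proj (f x) (mapD E f x v))
    (mapD E proj (f x) (mapD E f x w)) = g.form (proj x) (mapD E proj x v) (mapD E proj x w)
  field : g.val (proj (f x)) (K (proj (f x))) (K (proj (f x))) =
    g.val (proj x) (K (proj x)) (K (proj x))

theorem IsFlowStaticAt.comp {t : N → ℝ} {f f' : N → N} {s s' : ℝ} {x : N}
    (hf' : IsFlowStaticAt g K proj t f' s' (f x)) (hf : IsFlowStaticAt g K proj t f s x) :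
    IsFlowStaticAt g K proj t (fun y => f' (f y)) (s + s') x where
  contMDiffAt := hf'.contMDiffAt.comp x hf.contMDiffAt
  time := by rw [hf'.time, hf.time, add_assoc]
  isometry v w := by
    have h1 : ∀ v, mapD E (fun y => f' (f y)) x v = mapD E f' (f x) (mapD E f x v) := fun v =>
      DFunLike.congr_fun (mfderiv_comp x (hf'.contMDiffAt.mdifferentiableAt (by simp))
        (hf.contMDiffAt.mdifferentiableAt (by simp))) v
    rw [h1, h1, hf'.isometry, hf.isometry]
  field := by rw [hf'.field, hf.field]

theorem IsFlowStaticAt.congr {t : N → ℝ} {f f' : N → N} {s : ℝ} {x : N}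
    (hf : IsFlowStaticAt g K proj t f s x) (h : f =ᶠ[𝓝 x] f') :
    IsFlowStaticAt g K proj t f' s x where
  contMDiffAt := hf.contMDiffAt.congr_of_eventuallyEq h.symm
  time := by rw [← h.eq_of_nhds, hf.time]
  isometry v w := by
    have h1 : mapD E f' x = mapD E f x := h.symm.mfderiv_eq
    rw [h1, ← h.eq_of_nhds, hf.isometry]
  field := by rw [← h.eq_of_nhds, hf.field]

/-- Continuity of the chart keeps the translated points in its target, jointly in time and position.
The smoothness of the flow rests on this local formula. -/
theorem IsStaticFlow.eventuallyEq {fl : ℝ → N → N} (hfl : IsStaticFlow g K proj F fl)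
    (he : IsStaticChart g K proj e) {x : N} (hx : x ∈ e.source) {s : ℝ}
    (hs : e x + (s, 0) ∈ e.target) :
    ∀ᶠ q : ℝ × N in 𝓝 (s, x), fl q.1 q.2 = e.symm (e q.2 + (q.1, 0)) := by
  have h1 : ContinuousAt (fun q : ℝ × N => e q.2 + (q.1, (0 : F))) (s, x) := by
    have h2 : ContinuousAt (fun q : ℝ × N => e q.2) (s, x) :=
      ContinuousAt.comp (f := Prod.snd) (e.continuousAt hx) continuousAt_snd
    exact h2.add (continuousAt_fst.prodMk continuousAt_const)
  filter_upwards [h1.eventually_mem (e.open_target.mem_nhds hs),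
    continuousAt_snd.eventually_mem (e.open_source.mem_nhds hx)] with q hq1 hq2
  have := hfl.chart e he (e q.2) (e.map_source hq2) q.1 hq1
  rwa [e.left_inv hq2] at this

/-- Translation of time has the identity as derivative, and the components of the metric do not
depend on time. -/
theorem IsStaticChart.isFlowStaticAt {t : N → ℝ}
    (hproj : IsLocalDiffeomorph 𝓘(ℝ, E) 𝓘(ℝ, E) ∞ proj)
    (he : IsStaticChart g K proj e) (ht : ∀ y ∈ e.source, (e y).1 = t y) {x : N}
    (hx : x ∈ e.source) {s : ℝ} (hs : e x + (s, 0) ∈ e.target) :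
    IsFlowStaticAt g K proj t (fun y => e.symm (e y + (s, 0))) s x := by
  have hse := e.map_target hs
  have hm1 : MDifferentiableAt 𝓘(ℝ, E) 𝓘(ℝ, ℝ × F) (fun y => e y + (s, 0)) x :=
    (he.smooth.mdifferentiableAt hx).add mdifferentiableAt_const
  have hD : ∀ v, mapD E (fun y => e.symm (e y + (s, 0))) x v =
      paramD E e.symm (e x + (s, 0)) (chartD E e x v) := by
    intro v
    have h1 := mfderiv_comp x (he.smooth.mdifferentiableAt_symm hs) hm1
    have h2 : mfderiv 𝓘(ℝ, E) 𝓘(ℝ, ℝ × F) (fun y => e y + (s, 0)) x = chartD E e x := by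
      refine HasMFDerivAt.mfderiv ?_
      have h3 := (he.smooth.mdifferentiableAt hx).hasMFDerivAt.add
        (hasMFDerivAt_const (I := 𝓘(ℝ, E)) (I' := 𝓘(ℝ, ℝ × F)) ((s, 0) : ℝ × F) x)
      refine h3.congr_mfderiv ?_
      exact add_zero (chartD E e x)
    rw [h2] at h1
    exact DFunLike.congr_fun h1 v
  have hind := he.param.indep _ hs _ (e.map_source hx) (by simp)
  refine ⟨?_, ?_, fun v w => ?_, ?_⟩
  · have h1 : ContMDiffAt 𝓘(ℝ, E) 𝓘(ℝ, ℝ × F) ∞ (fun y => e y + (s, 0)) x :=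
      (he.smooth.contMDiffAt hx).add contMDiffAt_const
    exact (he.smooth.contMDiffAt_symm hs).comp x h1
  · rw [← ht _ hse, ← ht _ hx, e.right_inv hs]; rfl
  · have h1 : ∀ v, chartD E e (e.symm (e x + (s, 0))) (paramD E e.symm (e x + (s, 0)) v) = v := by
      intro v
      have := he.smooth.chartD_paramD hse v
      rwa [e.right_inv hs] at this
    rw [hD, hD, he.form_mapD hproj hse, he.form_mapD hproj hx, h1, h1, e.right_inv hs, hind]
  · have h1 := he.param.paramMetric_one_one hs
    have h2 := he.param.paramMetric_one_one (e.map_source hx)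
    rw [hind, h2, e.left_inv hx] at h1
    exact h1.symm

/-- For short times the flow is a translation in one chart. Long times follow from connectedness of
`ℝ`: near `r₀`, the group law expresses each of `fl r` and `fl r₀` as the other followed by a short
flow, and the properties compose. -/
theorem IsStaticFlow.isFlowStaticAt {t : N → ℝ}
    (hproj : IsLocalDiffeomorph 𝓘(ℝ, E) 𝓘(ℝ, E) ∞ proj)
    (ht : ∀ p, ∃ e : OpenPartialHomeomorph N (ℝ × F), IsStaticChart g K proj e ∧
      p ∈ e.source ∧ ∀ y ∈ e.source, (e y).1 = t y) {fl : ℝ → N → N}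
    (hfl : IsStaticFlow g K proj F fl) (r : ℝ) (p : N) : IsFlowStaticAt g K proj t (fl r) r p := by
  have key : ∀ (e : OpenPartialHomeomorph N (ℝ × F)) (_ : IsStaticChart g K proj e)
      (_ : ∀ y ∈ e.source, (e y).1 = t y) (x : N) (_ : x ∈ e.source) (s : ℝ)
      (_ : e x + (s, 0) ∈ e.target), IsFlowStaticAt g K proj t (fl s) s x := by
    intro e he hte x hx s hs
    refine (he.isFlowStaticAt hproj hte hx hs).congr ?_
    have h1 : Tendsto (fun y : N => (s, y)) (𝓝 x) (𝓝 (s, x)) :=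
      (Continuous.prodMk_right s).tendsto x
    filter_upwards [h1.eventually (hfl.eventuallyEq he hx hs)] with y hy
    exact hy.symm
  refine isPreconnected_univ.forall_of_eventually_iff (x := (0 : ℝ))
    (P := fun r => IsFlowStaticAt g K proj t (fl r) r p) (mem_univ _) ?_ (fun r₀ _ => ?_) r
    (mem_univ _)
  · obtain ⟨e, he, hpe, hte⟩ := ht p
    refine key e he hte p hpe 0 ?_
    change e p + 0 ∈ _
    rw [add_zero]; exact e.map_source hpe
  · rw [nhdsWithin_univ]
    obtain ⟨e, he, hpe, hte⟩ := ht (fl r₀ p)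
    have hc : Continuous fun r : ℝ => e (fl r₀ p) + (r - r₀, (0 : F)) := by fun_prop
    have hev : ∀ᶠ r in 𝓝 r₀, e (fl r₀ p) + (r - r₀, (0 : F)) ∈ e.target := by
      refine hc.continuousAt.eventually_mem (e.open_target.mem_nhds ?_)
      rw [sub_self]
      change e (fl r₀ p) + 0 ∈ _
      rw [add_zero]; exact e.map_source hpe
    filter_upwards [hev] with r hr
    have h1 : fl r p = e.symm (e (fl r₀ p) + (r - r₀, 0)) := by
      rw [← hfl.chart e he _ (e.map_source hpe) _ hr, e.left_inv hpe, ← hfl.add, sub_add_cancel]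
    constructor
    · intro h
      have h2 : IsFlowStaticAt g K proj t (fl (r₀ - r)) (r₀ - r) (fl r p) := by
        refine key e he hte _ (by rw [h1]; exact e.map_target hr) _ ?_
        rw [h1, e.right_inv hr, add_assoc]
        have : ((r - r₀, 0) + (r₀ - r, 0) : ℝ × F) = 0 := by simp
        rw [this, add_zero]
        exact e.map_source hpe
      have h3 := h2.comp h
      rw [add_sub_cancel] at h3
      refine h3.congr (Eventually.of_forall fun y => ?_)
      change fl (r₀ - r) (fl r y) = fl r₀ y
      rw [← hfl.add, sub_add_cancel]
    · intro h
      have h3 := (key e he hte _ hpe _ hr).comp h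
      rw [add_sub_cancel] at h3
      refine h3.congr (Eventually.of_forall fun y => ?_)
      change fl (r - r₀) (fl r₀ y) = fl r y
      rw [← hfl.add, sub_add_cancel]

end Flow

/-- A field of bilinear forms on a manifold is smooth if its components in the charts are. -/
theorem contMDiff_bilinearSection {F : Type*} [NormedAddCommGroup F] [NormedSpace ℝ F]
    {S : Type*} [TopologicalSpace S] [ChartedSpace F S] [IsManifold 𝓘(ℝ, F) ∞ S]
    (B : (x : S) → TangentSpace 𝓘(ℝ, F) x →L[ℝ] TangentSpace 𝓘(ℝ, F) x →L[ℝ] ℝ)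
    (hB : ∀ x₀ : S, ∃ G : F → F →L[ℝ] F →L[ℝ] ℝ, ContDiffAt ℝ ∞ G (chartAt F x₀ x₀) ∧
      ∀ y ∈ (chartAt F x₀).source, ∀ v w : F,
        B y (paramD F (chartAt F x₀).symm (chartAt F x₀ y) v)
          (paramD F (chartAt F x₀).symm (chartAt F x₀ y) w) = G (chartAt F x₀ y) v w) :
    ContMDiff 𝓘(ℝ, F) (𝓘(ℝ, F).prod 𝓘(ℝ, F →L[ℝ] F →L[ℝ] ℝ)) ∞
    (fun x ↦ TotalSpace.mk' (F →L[ℝ] F →L[ℝ] ℝ)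
      (E := fun x : S ↦ TangentSpace 𝓘(ℝ, F) x →L[ℝ] TangentSpace 𝓘(ℝ, F) x →L[ℝ] ℝ) x (B x)) := by
  intro x₀
  obtain ⟨G, hG, hBG⟩ := hB x₀
  have h1 : ContMDiffAt 𝓘(ℝ, F) (𝓘(ℝ, F).prod 𝓘(ℝ, F →L[ℝ] F →L[ℝ] ℝ)) ∞
    (fun x ↦ TotalSpace.mk' (F →L[ℝ] F →L[ℝ] ℝ)
      (E := fun x : S ↦ TangentSpace 𝓘(ℝ, F) x →L[ℝ] TangentSpace 𝓘(ℝ, F) x →L[ℝ]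
        Bundle.Trivial S ℝ x) x (B x)) x₀ := by
    rw [contMDiffAt_hom_bundle]
    refine ⟨contMDiffAt_id, ?_⟩
    have h2 : ContMDiffAt 𝓘(ℝ, F) 𝓘(ℝ, F →L[ℝ] F →L[ℝ] ℝ) ∞ (fun y => G (chartAt F x₀ y)) x₀ :=
      hG.contMDiffAt.comp x₀ (contMDiffOn_chart.contMDiffAt
        ((chartAt F x₀).open_source.mem_nhds (mem_chart_source F x₀)))
    refine h2.congr_of_eventuallyEq ?_
    filter_upwards [(chartAt F x₀).open_source.mem_nhds (mem_chart_source F x₀)] with y hy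
    refine ContinuousLinearMap.ext fun v => ContinuousLinearMap.ext fun w => ?_
    rw [← hBG y hy v w]
    have hy' : y ∈ (trivializationAt F (TangentSpace 𝓘(ℝ, F)) x₀).baseSet := by simpa using hy
    have h3 : ∀ v : F, (trivializationAt F (TangentSpace 𝓘(ℝ, F)) x₀).symm y v =
        paramD F (chartAt F x₀).symm (chartAt F x₀ y) v := by
      intro v
      have h4 := DFunLike.congr_fun (TangentBundle.symmL_trivializationAt (I := 𝓘(ℝ, F)) hy) v
      simp only [modelWithCornersSelf_coe, range_id, mfderivWithin_univ] at h4
      exact (Bundle.Trivialization.symmL_apply (R := ℝ) _ hy' v).symm.trans (h4.trans rfl)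
    refine (inCoordinates_apply_eq₂ (F₁ := F) (F₂ := F) (F₃ := ℝ)
      (E₁ := fun x : S ↦ TangentSpace 𝓘(ℝ, F) x) (E₂ := fun x : S ↦ TangentSpace 𝓘(ℝ, F) x)
      (E₃ := Bundle.Trivial S ℝ) hy' hy' (mem_univ _)).trans ?_
    rw [h3, h3]
    exact DFunLike.congr_fun (Trivial.linearMapAt_trivialization ℝ S ℝ y) _
  exact h1

/-! ### The slice of zero time as a manifold -/

section Slice

variable {E : Type*} [NormedAddCommGroup E] [NormedSpace ℝ E]
  {F : Type*} [NormedAddCommGroup F] [NormedSpace ℝ F]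
  {M : Type*} [TopologicalSpace M] [ChartedSpace E M] [IsManifold 𝓘(ℝ, E) ∞ M]
  {N : Type v} [TopologicalSpace N] [ChartedSpace E N]
  {g : PseudoRiemannianMetric E M} {K : (x : M) → TangentSpace 𝓘(ℝ, E) x} {proj : N → M}

/-- A time function, together with static charts in which it is the time coordinate. -/
structure StaticAtlas (g : PseudoRiemannianMetric E M) (K : (x : M) → TangentSpace 𝓘(ℝ, E) x)
    (proj : N → M) (F : Type*) [NormedAddCommGroup F] [NormedSpace ℝ F] where
  time : N → ℝ
  chart : N → OpenPartialHomeomorph N (ℝ × F)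
  static (p : N) : IsStaticChart g K proj (chart p)
  mem_source (p : N) : p ∈ (chart p).source
  chart_fst (p : N) : ∀ y ∈ (chart p).source, (chart p y).1 = time y

namespace StaticAtlas

variable (A : StaticAtlas g K proj F)

/-- The hypersurface where the time vanishes. -/
structure Slice : Type v where
  incl : N
  time_incl : A.time incl = 0

/-- The inclusion of the slice. -/
def incl (x : A.Slice) : N := x.incl

instance : TopologicalSpace A.Slice := TopologicalSpace.induced A.incl inferInstance

variable {A}

theorem time_incl (x : A.Slice) : A.time (A.incl x) = 0 := x.time_incl

theorem incl_injective : Function.Injective A.incl := by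
  rintro ⟨x, hx⟩ ⟨y, hy⟩ h
  change x = y at h
  subst h
  rfl

theorem isEmbedding_incl : IsEmbedding A.incl := ⟨⟨rfl⟩, incl_injective⟩

instance [T2Space N] : T2Space A.Slice := isEmbedding_incl.t2Space

instance [SecondCountableTopology N] : SecondCountableTopology A.Slice :=
  isEmbedding_incl.secondCountableTopology

theorem chart_incl {p : N} {x : A.Slice} (hx : A.incl x ∈ (A.chart p).source) :
    A.chart p (A.incl x) = (0, (A.chart p (A.incl x)).2) :=
  Prod.ext ((A.chart_fst p _ hx).trans (time_incl x)) rfl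

theorem time_symm {p : N} {z : F} (hz : ((0 : ℝ), z) ∈ (A.chart p).target) :
    A.time ((A.chart p).symm (0, z)) = 0 := by
  rw [← A.chart_fst p _ ((A.chart p).map_target hz), (A.chart p).right_inv hz]

variable (A)

open Classical in
/-- The point of the slice with a given image in a static chart. -/
def sliceInv (x : A.Slice) (z : F) : A.Slice :=
  if hz : ((0 : ℝ), z) ∈ (A.chart (A.incl x)).target then
    ⟨(A.chart (A.incl x)).symm (0, z), time_symm hz⟩ else x

variable {A}

theorem incl_sliceInv {x : A.Slice} {z : F} (hz : ((0 : ℝ), z) ∈ (A.chart (A.incl x)).target) :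
    A.incl (A.sliceInv x z) = (A.chart (A.incl x)).symm (0, z) := by
  rw [sliceInv, dif_pos hz]
  rfl

variable (A)

/-- The restriction of a static chart to the slice. -/
def sliceChart (x : A.Slice) : OpenPartialHomeomorph A.Slice F where
  toFun y := (A.chart (A.incl x) (A.incl y)).2
  invFun := A.sliceInv x
  source := A.incl ⁻¹' (A.chart (A.incl x)).source
  target := {z | ((0 : ℝ), z) ∈ (A.chart (A.incl x)).target}
  map_source' y hy := by
    change ((0 : ℝ), _) ∈ (A.chart (A.incl x)).target
    rw [← chart_incl hy]
    exact (A.chart (A.incl x)).map_source hy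
  map_target' z hz := by
    rw [mem_preimage, incl_sliceInv hz]
    exact (A.chart (A.incl x)).map_target hz
  left_inv' y hy := by
    have hy' : ((0 : ℝ), (A.chart (A.incl x) (A.incl y)).2) ∈ (A.chart (A.incl x)).target := by
      rw [← chart_incl hy]; exact (A.chart (A.incl x)).map_source hy
    apply incl_injective
    rw [incl_sliceInv hy', ← chart_incl hy, (A.chart (A.incl x)).left_inv hy]
  right_inv' z hz := by
    rw [incl_sliceInv hz, (A.chart (A.incl x)).right_inv hz]
  open_source := (A.chart (A.incl x)).open_source.preimage isEmbedding_incl.continuous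
  open_target := (A.chart (A.incl x)).open_target.preimage (Continuous.prodMk_right (0 : ℝ))
  continuousOn_toFun := continuous_snd.comp_continuousOn
    ((A.chart (A.incl x)).continuousOn.comp isEmbedding_incl.continuous.continuousOn fun _ h => h)
  continuousOn_invFun := by
    rw [isEmbedding_incl.isInducing.continuousOn_iff]
    refine ((A.chart (A.incl x)).symm.continuousOn.comp
      (Continuous.prodMk_right (0 : ℝ)).continuousOn (t := {q | q ∈ (A.chart (A.incl x)).target})
      (fun z hz => hz)).congr fun z hz => incl_sliceInv hz

variable {A}

theorem incl_sliceChart_symm {x : A.Slice} {z : F} (hz : z ∈ (A.sliceChart x).target) :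
    A.incl ((A.sliceChart x).symm z) = (A.chart (A.incl x)).symm (0, z) := incl_sliceInv hz

instance : ChartedSpace F A.Slice where
  atlas := range A.sliceChart
  chartAt := A.sliceChart
  mem_chart_source x := A.mem_source (A.incl x)
  chart_mem_atlas x := mem_range_self x

theorem chartAt_slice (x : A.Slice) : chartAt F x = A.sliceChart x := rfl

/-- Transition maps of the slice are the space components of transition maps of static charts,
restricted to `t = 0`. -/
instance : IsManifold 𝓘(ℝ, F) ∞ A.Slice := by
  apply isManifold_of_contDiffOn
  rintro _ _ ⟨x, rfl⟩ ⟨x', rfl⟩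
  have h1 := (A.static (A.incl x)).smooth.contDiffOn_transition (A.static (A.incl x')).smooth
  have h2 : ContDiff ℝ ∞ (fun z : F => ((0 : ℝ), z)) := contDiff_const.prodMk contDiff_id
  simp only [modelWithCornersSelf_coe, modelWithCornersSelf_coe_symm, preimage_id, range_id,
    inter_univ, Function.id_comp, Function.comp_id]
  have hs : ∀ z ∈ ((A.sliceChart x).symm.trans (A.sliceChart x')).source,
      z ∈ (A.sliceChart x).target ∧
        (A.chart (A.incl x)).symm (0, z) ∈ (A.chart (A.incl x')).source := by
    rintro z ⟨hz, hz'⟩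
    refine ⟨hz, ?_⟩
    rw [← incl_sliceChart_symm hz]
    exact hz'
  refine ((contDiff_snd.comp_contDiffOn h1).comp h2.contDiffOn
    (fun z hz => ⟨(hs z hz).1, (hs z hz).2⟩)).congr fun z hz => ?_
  change (A.chart (A.incl x') (A.incl ((A.sliceChart x).symm z))).2 = _
  rw [incl_sliceChart_symm (hs z hz).1]
  rfl

theorem contMDiff_incl : ContMDiff 𝓘(ℝ, F) 𝓘(ℝ, E) ∞ A.incl := by
  intro x
  have hx := mem_chart_source F x
  have h1 : ContMDiffAt 𝓘(ℝ, F) 𝓘(ℝ, F) ∞ (chartAt F x) x :=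
    contMDiffOn_chart.contMDiffAt ((chartAt F x).open_source.mem_nhds hx)
  have h2 : ContDiff ℝ ∞ (fun z : F => ((0 : ℝ), z)) := contDiff_const.prodMk contDiff_id
  have h3 := ((A.static (A.incl x)).smooth.contMDiffAt_symm
    ((chartAt F x).map_source hx)).comp x (h2.contMDiff.contMDiffAt.comp x h1)
  refine h3.congr_of_eventuallyEq ?_
  filter_upwards [(chartAt F x).open_source.mem_nhds hx] with y hy
  change _ = (A.chart (A.incl x)).symm (0, chartAt F x y)
  rw [← incl_sliceChart_symm ((chartAt F x).map_source hy)]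
  exact congrArg _ ((chartAt F x).left_inv hy).symm

/-- The slice has the induced topology, so `f` is continuous; in a slice chart `f` becomes the space
component of a static chart composed with its inclusion into `N`. -/
theorem contMDiffAt_slice {f : N → A.Slice} {p : N}
    (hf : ContMDiffAt 𝓘(ℝ, E) 𝓘(ℝ, E) ∞ (fun p => A.incl (f p)) p) :
    ContMDiffAt 𝓘(ℝ, E) 𝓘(ℝ, F) ∞ f p := by
  have hc : ContinuousAt f p :=
    isEmbedding_incl.isInducing.continuousAt_iff.2 hf.continuousAt
  have hx := mem_chart_source F (f p)
  have h1 : ContMDiffAt 𝓘(ℝ, F) 𝓘(ℝ, F) ∞ (chartAt F (f p)).symm (chartAt F (f p) (f p)) :=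
    contMDiffOn_chart_symm.contMDiffAt
      ((chartAt F (f p)).open_target.mem_nhds ((chartAt F (f p)).map_source hx))
  have h2 : ContMDiffAt 𝓘(ℝ, E) 𝓘(ℝ, ℝ × F) ∞
      (fun q => A.chart (A.incl (f p)) (A.incl (f q))) p :=
    ((A.static (A.incl (f p))).smooth.contMDiffAt hx).comp p hf
  have h3 : ContMDiffAt 𝓘(ℝ, E) 𝓘(ℝ, F) ∞ (fun q => chartAt F (f p) (f q)) p :=
    contDiff_snd.contMDiff.contMDiffAt.comp p h2
  refine (h1.comp p h3).congr_of_eventuallyEq ?_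
  filter_upwards [hc.eventually_mem ((chartAt F (f p)).open_source.mem_nhds hx)] with q hq
  exact ((chartAt F (f p)).left_inv hq).symm

end StaticAtlas

end Slice

/-- The signature condition concerns one timelike vector `u`; here it is passed to any timelike `k`.
With `a = g(u, k)` and `b = g(u, w)`, the vector `a w - b k` is orthogonal to `u`, and its square
`a² g(w, w) + b² g(k, k)` can be positive only if `g(w, w)` is. -/
theorem IsLorentzian.pos_of_orthogonal {E : Type*} [NormedAddCommGroup E] [NormedSpace ℝ E]
    {M : Type*} [TopologicalSpace M] [ChartedSpace E M] [IsManifold 𝓘(ℝ, E) ∞ M]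
    {g : PseudoRiemannianMetric E M} (hg : g.IsLorentzian) {x : M} {k w : E}
    (hk : g.form x k k < 0) (hkw : g.form x k w = 0) (hw : w ≠ 0) : 0 < g.form x w w := by
  obtain ⟨u, hu, hpos⟩ := hg x
  let u' : E := u
  have hu' : g.form x u' u' < 0 := hu
  have hpos' : ∀ w : E, g.form x u' w = 0 → w ≠ 0 → 0 < g.form x w w := hpos
  have hk0 : g.form x u' k ≠ 0 := by
    intro h
    by_cases hk0 : k = 0
    · rw [hk0] at hk; simp at hk
    · exact (hpos' k h hk0).not_gt hk
  -- a combination of `k` and `w` orthogonal to `u`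
  set a := g.form x u' k with ha
  set b := g.form x u' w with hb
  have h1 := hpos' (a • w - b • k) (by simp [← ha, ← hb]; ring)
  have hkw' : g.form x w k = 0 := by rw [form_symm]; exact hkw
  have h2 : g.form x (a • w - b • k) (a • w - b • k) =
      a ^ 2 * g.form x w w + b ^ 2 * g.form x k k := by
    simp [hkw, hkw']; ring
  have h3 : a • w - b • k ≠ 0 := by
    intro h
    have h4 : g.form x k (a • w - b • k) = 0 := by rw [h, map_zero]
    simp only [map_sub, map_smul, hkw, smul_eq_mul, mul_zero, zero_sub, neg_eq_zero,
      mul_eq_zero, or_iff_left hk.ne] at h4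
    rw [h4, zero_smul, sub_zero, smul_eq_zero] at h
    exact h.elim hk0 hw
  rw [h2] at h1
  have h5 := h1 h3
  have h6 : b ^ 2 * g.form x k k ≤ 0 := mul_nonpos_of_nonneg_of_nonpos (sq_nonneg b) hk.le
  have h7 : 0 < a ^ 2 := by positivity
  by_contra h8
  have := mul_nonpos_of_nonneg_of_nonpos h7.le (not_lt.1 h8)
  linarith

/-! ### The induced Riemannian metric on the slice -/

namespace StaticAtlas

variable {E : Type*} [NormedAddCommGroup E] [NormedSpace ℝ E]
  {F : Type*} [NormedAddCommGroup F] [NormedSpace ℝ F]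
  {M : Type*} [TopologicalSpace M] [ChartedSpace E M] [IsManifold 𝓘(ℝ, E) ∞ M]
  {N : Type v} [TopologicalSpace N] [ChartedSpace E N]
  {g : PseudoRiemannianMetric E M} {K : (x : M) → TangentSpace 𝓘(ℝ, E) x} {proj : N → M}
  {A : StaticAtlas g K proj F}

variable (A) in
/-- The differential of the map from the slice to `M`. -/
def sliceD (x : A.Slice) : F →L[ℝ] E :=
  mfderiv 𝓘(ℝ, F) 𝓘(ℝ, E) (fun y => proj (A.incl y)) x

/-- The parametrization of a neighbourhood in `M` by a static chart. -/
def param (A : StaticAtlas g K proj F) (p : N) (q : ℝ × F) : M := proj ((A.chart p).symm q)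

theorem contMDiff_proj_incl (hproj : IsLocalDiffeomorph 𝓘(ℝ, E) 𝓘(ℝ, E) ∞ proj) :
    ContMDiff 𝓘(ℝ, F) 𝓘(ℝ, E) ∞ (fun y : A.Slice => proj (A.incl y)) :=
  hproj.contMDiff.comp contMDiff_incl

/-- In a slice chart the map from the slice to `M` is the static parametrization restricted to `t =
0`, so this is the chain rule. -/
theorem sliceD_paramD (hproj : IsLocalDiffeomorph 𝓘(ℝ, E) 𝓘(ℝ, E) ∞ proj) (x₀ : A.Slice)
    {y : A.Slice} (hy : y ∈ (chartAt F x₀).source) (z : F) :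
    A.sliceD y (paramD F (chartAt F x₀).symm (chartAt F x₀ y) z) =
      paramD E (A.param (A.incl x₀)) (0, chartAt F x₀ y) (0, z) := by
  set c := chartAt F x₀ with hc
  have hcs : IsSmoothChart F c := isSmoothChart_chartAt x₀
  have hcy := c.map_source hy
  have h1 := mfderiv_comp (c y) (f := c.symm) (g := fun y => proj (A.incl y))
    ((contMDiff_proj_incl hproj _).mdifferentiableAt (by simp)) (hcs.mdifferentiableAt_symm hcy)
  rw [c.left_inv hy] at h1
  have h2 := DFunLike.congr_fun h1 z
  refine h2.symm.trans ?_
  have h3 : (fun y => proj (A.incl y)) ∘ c.symm =ᶠ[𝓝 (c y)]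
      fun z => A.param (A.incl x₀) (0, z) := by
    filter_upwards [c.open_target.mem_nhds hcy] with z hz
    change proj (A.incl (c.symm z)) = proj _
    rw [hc, chartAt_slice, incl_sliceChart_symm hz]
  rw [h3.mfderiv_eq]
  have h4 : HasFDerivAt (fun z : F => ((0 : ℝ), z)) (ContinuousLinearMap.inr ℝ ℝ F) (c y) :=
    (ContinuousLinearMap.inr ℝ ℝ F).hasFDerivAt
  have h5 := paramD_comp (E := E) (h := A.param (A.incl x₀)) (ψ := fun z : F => ((0 : ℝ), z))
    (q := c y) (((A.static (A.incl x₀)).param.contMDiffOn.contMDiffAt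
      ((A.chart (A.incl x₀)).open_target.mem_nhds hcy)).mdifferentiableAt (by simp))
    h4.differentiableAt
  rw [h4.fderiv] at h5
  exact DFunLike.congr_fun h5 z

/-- The image of `(0, z)` is orthogonal to the timelike `K`, and it is nonzero because both the
chart and `proj` have injective differentials. -/
theorem paramMetric_pos (hproj : IsLocalDiffeomorph 𝓘(ℝ, E) 𝓘(ℝ, E) ∞ proj)
    (hg : g.IsLorentzian) (hneg : ∀ x, g.val x (K x) (K x) < 0)
    (p : N) {q : ℝ × F} (hq : q ∈ (A.chart p).target) {z : F} (hz : z ≠ 0) :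
    0 < g.paramMetric (A.param p) q (0, z) (0, z) := by
  have hs := A.static p
  rw [paramMetric_apply]
  refine IsLorentzian.pos_of_orthogonal hg (k := K (A.param p q)) (hneg _) ?_ ?_
  · have := hs.param.cross q hq z
    rw [paramMetric_apply, hs.param.field q hq] at this
    exact this
  · intro h
    have h1 := DFunLike.congr_fun (paramD_proj_comp hproj (hs.smooth.mdifferentiableAt_symm hq))
      (0, z)
    rw [ContinuousLinearMap.comp_apply] at h1
    have h2 := mapD_injective hproj _ (h1.symm.trans (h.trans (map_zero _).symm))
    have h3 := hs.smooth.chartD_paramD ((A.chart p).map_target hq) (0, z)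
    rw [(A.chart p).right_inv hq, h2, map_zero] at h3
    exact hz (congrArg Prod.snd h3).symm

variable (A) in
/-- The bilinear form induced on the slice. -/
def sliceForm (x : A.Slice) : F →L[ℝ] F →L[ℝ] ℝ :=
  (g.form (proj (A.incl x))).bilinearComp (A.sliceD x) (A.sliceD x)

theorem sliceForm_paramD (hproj : IsLocalDiffeomorph 𝓘(ℝ, E) 𝓘(ℝ, E) ∞ proj) (x₀ : A.Slice)
    {y : A.Slice} (hy : y ∈ (chartAt F x₀).source) (z z' : F) :
    A.sliceForm y (paramD F (chartAt F x₀).symm (chartAt F x₀ y) z)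
      (paramD F (chartAt F x₀).symm (chartAt F x₀ y) z') =
      g.paramMetric (A.param (A.incl x₀)) (0, chartAt F x₀ y) (0, z) (0, z') := by
  rw [sliceForm, ContinuousLinearMap.bilinearComp_apply, sliceD_paramD hproj x₀ hy,
    sliceD_paramD hproj x₀ hy, paramMetric_apply]
  have h1 : A.param (A.incl x₀) (0, chartAt F x₀ y) = proj (A.incl y) := by
    have h2 : (A.chart (A.incl x₀)) (A.incl y) = (0, chartAt F x₀ y) := chart_incl hy
    rw [param, ← h2, (A.chart (A.incl x₀)).left_inv hy]
  rw [h1]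

theorem sliceForm_pos (hproj : IsLocalDiffeomorph 𝓘(ℝ, E) 𝓘(ℝ, E) ∞ proj)
    (hg : g.IsLorentzian) (hneg : ∀ x, g.val x (K x) (K x) < 0) (x : A.Slice) {v : F}
    (hv : v ≠ 0) : 0 < A.sliceForm x v v := by
  have hx := mem_chart_source F x
  have hc : IsSmoothChart F (chartAt F x) := isSmoothChart_chartAt x
  have h1 := sliceForm_paramD hproj x hx (chartD F (chartAt F x) x v) (chartD F (chartAt F x) x v)
  rw [hc.paramD_chartD hx] at h1
  rw [h1]
  refine paramMetric_pos hproj hg hneg _ ((chartAt F x).map_source hx) fun h => hv ?_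
  rw [← hc.paramD_chartD hx v, h, map_zero]

variable (A) in
/-- The Riemannian metric induced on the slice. -/
def sliceMetric [FiniteDimensional ℝ F] (hproj : IsLocalDiffeomorph 𝓘(ℝ, E) 𝓘(ℝ, E) ∞ proj)
    (hg : g.IsLorentzian) (hneg : ∀ x, g.val x (K x) (K x) < 0) :
    PseudoRiemannianMetric F A.Slice where
  val x := A.sliceForm x
  symm x v w := g.form_symm _ _ _
  nondegenerate x v hv := by
    by_contra h
    exact (sliceForm_pos hproj hg hneg x (v := v) h).ne' (hv v)
  contMDiff := by
    refine contMDiff_bilinearSection (fun x => A.sliceForm x) fun x₀ => ?_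
    have h2 : ContDiff ℝ ∞ (fun z : F => ((0 : ℝ), z)) := contDiff_const.prodMk contDiff_id
    let J := ContinuousLinearMap.inr ℝ ℝ F
    refine ⟨fun z => (g.paramMetric (A.param (A.incl x₀)) (0, z)).bilinearComp J J, ?_,
      fun y hy v w => sliceForm_paramD hproj x₀ hy v w⟩
    have hx := (chartAt F x₀).map_source (mem_chart_source F x₀)
    have hU : IsOpen (chartAt F x₀).target := (chartAt F x₀).open_target
    refine ContDiffOn.contDiffAt (s := (chartAt F x₀).target) ?_ (hU.mem_nhds hx)
    refine contDiffOn_clm_apply.2 fun v => contDiffOn_clm_apply.2 fun w => ?_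
    exact (g.contDiffOn_paramMetric_apply (A.chart (A.incl x₀)).open_target
      (A.static (A.incl x₀)).param.contMDiffOn (J v) (J w)).comp h2.contDiffOn fun z hz => hz

theorem contMDiff_field_field (hK : ContMDiff 𝓘(ℝ, E) 𝓘(ℝ, E).tangent ∞
    (fun x ↦ (⟨x, K x⟩ : TangentBundle 𝓘(ℝ, E) M))) :
    ContMDiff 𝓘(ℝ, E) 𝓘(ℝ, ℝ) ∞ (fun x => g.val x (K x) (K x)) := by
  have h0 : ContMDiff 𝓘(ℝ, E) (𝓘(ℝ, E).prod 𝓘(ℝ, E →L[ℝ] E →L[ℝ] ℝ)) ∞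
      (fun q ↦ TotalSpace.mk' (E →L[ℝ] E →L[ℝ] ℝ)
        (E := fun x : M ↦ TangentSpace 𝓘(ℝ, E) x →L[ℝ] TangentSpace 𝓘(ℝ, E) x →L[ℝ]
          Bundle.Trivial M ℝ x) q (g.val q)) := g.contMDiff
  have h1 := ContMDiff.clm_bundle_apply₂ (F₁ := E) (F₂ := E) (F₃ := ℝ)
    (E₁ := fun x : M ↦ TangentSpace 𝓘(ℝ, E) x) (E₂ := fun x : M ↦ TangentSpace 𝓘(ℝ, E) x)
    (E₃ := Bundle.Trivial M ℝ) (b := id) (ψ := fun q ↦ g.val q) h0 hK hK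
  intro q
  have h2 := h1 q
  rw [contMDiffAt_totalSpace] at h2
  exact h2.2

end StaticAtlas

/-! ### The product splitting and its metric -/

namespace StaticAtlas

variable {E : Type*} [NormedAddCommGroup E] [NormedSpace ℝ E]
  {F : Type*} [NormedAddCommGroup F] [NormedSpace ℝ F]
  {M : Type*} [TopologicalSpace M] [ChartedSpace E M] [IsManifold 𝓘(ℝ, E) ∞ M]
  {N : Type v} [TopologicalSpace N] [ChartedSpace E N]
  {g : PseudoRiemannianMetric E M} {K : (x : M) → TangentSpace 𝓘(ℝ, E) x} {proj : N → M}
  {A : StaticAtlas g K proj F} {fl : ℝ → N → N}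

variable (A) in
theorem contMDiff_time : ContMDiff 𝓘(ℝ, E) 𝓘(ℝ, ℝ) ∞ A.time := by
  intro p
  have h1 := contDiff_fst.contMDiff.contMDiffAt.comp p
    ((A.static p).smooth.contMDiffAt (A.mem_source p))
  refine h1.congr_of_eventuallyEq ?_
  filter_upwards [(A.chart p).open_source.mem_nhds (A.mem_source p)] with y hy
  exact (A.chart_fst p y hy).symm

variable (A) in
theorem mfderiv_time (p : N) (v : E) :
    mfderiv 𝓘(ℝ, E) 𝓘(ℝ, ℝ) A.time p v = (chartD E (A.chart p) p v).1 := by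
  have hd : DifferentiableAt ℝ (Prod.fst : ℝ × F → ℝ) (A.chart p p) := differentiableAt_fst
  have h1 := mfderiv_comp p hd.mdifferentiableAt
    ((A.static p).smooth.mdifferentiableAt (A.mem_source p))
  rw [mfderiv_eq_fderiv, fderiv_fst] at h1
  have h2 : A.time =ᶠ[𝓝 p] Prod.fst ∘ A.chart p := by
    filter_upwards [(A.chart p).open_source.mem_nhds (A.mem_source p)] with y hy
    exact (A.chart_fst p y hy).symm
  rw [h2.mfderiv_eq]
  exact DFunLike.congr_fun h1 v

/-- The point of the slice on the same flow line. -/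
def toSlice (hflow : ∀ r p, IsFlowStaticAt g K proj A.time (fl r) r p) (p : N) : A.Slice :=
  ⟨fl (-A.time p) p, by rw [(hflow _ _).time, add_neg_cancel]⟩

variable (A) in
/-- The projection to the level set of the time through `p`, near `p`. -/
def toLevel (p y : N) : N := (A.chart p).symm (A.time p, (A.chart p y).2)

variable (A) in
theorem chart_self (p : N) : A.chart p p = (A.time p, (A.chart p p).2) :=
  Prod.ext (A.chart_fst p p (A.mem_source p)) rfl

variable (A) in
theorem toLevel_self (p : N) : A.toLevel p p = p := by
  rw [toLevel, ← A.chart_self, (A.chart p).left_inv (A.mem_source p)]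

variable (A) in
theorem contMDiffAt_toLevel (p : N) : ContMDiffAt 𝓘(ℝ, E) 𝓘(ℝ, E) ∞ (A.toLevel p) p := by
  have h1 : ContDiff ℝ ∞ (fun q : ℝ × F => (A.time p, q.2)) := contDiff_const.prodMk contDiff_snd
  have h2 := h1.contMDiff.contMDiffAt.comp p ((A.static p).smooth.contMDiffAt (A.mem_source p))
  refine ((A.static p).smooth.contMDiffAt_symm ?_).comp p h2
  rw [← A.chart_self]
  exact (A.chart p).map_source (A.mem_source p)

variable (A) in
theorem chartD_mapD_toLevel (p : N) (v : E) :
    chartD E (A.chart p) p (mapD E (A.toLevel p) p v) = (0, (chartD E (A.chart p) p v).2) := by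
  have hp := (A.chart p).map_source (A.mem_source p)
  have h1 : HasFDerivAt (fun q : ℝ × F => (A.time p, q.2))
      ((0 : ℝ × F →L[ℝ] ℝ).prod (ContinuousLinearMap.snd ℝ ℝ F)) (A.chart p p) :=
    (hasFDerivAt_const _ _).prodMk hasFDerivAt_snd
  have h2 := h1.hasMFDerivAt.comp p
    ((A.static p).smooth.mdifferentiableAt (A.mem_source p)).hasMFDerivAt
  have h3 : MDifferentiableAt 𝓘(ℝ, ℝ × F) 𝓘(ℝ, E) (A.chart p).symm
      (((fun q : ℝ × F => (A.time p, q.2)) ∘ A.chart p) p) := by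
    refine (A.static p).smooth.mdifferentiableAt_symm ?_
    change (A.time p, (A.chart p p).2) ∈ _
    rw [← A.chart_self]
    exact hp
  have h4 : mapD E (A.toLevel p) p v =
      paramD E (A.chart p).symm (A.time p, (A.chart p p).2) (0, (chartD E (A.chart p) p v).2) :=
    DFunLike.congr_fun (h3.hasMFDerivAt.comp p h2).mfderiv v
  rw [h4, ← A.chart_self]
  exact (A.static p).smooth.chartD_paramD (A.mem_source p) _

/-- `toSlice` flows for a time which varies with the point. Moving first to the level set of time
through `p` inside one chart, and then flowing for a fixed time, gives the same point by the group
law; both factors are smooth, and the second is isometric. -/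
theorem incl_toSlice_eventuallyEq (hfl : IsStaticFlow g K proj F fl)
    (hflow : ∀ r p, IsFlowStaticAt g K proj A.time (fl r) r p) (p : N) :
    (fun y => A.incl (toSlice hflow y)) =ᶠ[𝓝 p] fun y => fl (-A.time p) (A.toLevel p y) := by
  have hc : ContinuousAt (fun y => (A.time p, (A.chart p y).2)) p :=
    continuousAt_const.prodMk
      (continuousAt_snd.comp ((A.chart p).continuousAt (A.mem_source p)))
  have hmem : ∀ᶠ y in 𝓝 p, (A.time p, (A.chart p y).2) ∈ (A.chart p).target := by
    refine hc.eventually_mem ((A.chart p).open_target.mem_nhds ?_)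
    rw [← A.chart_self]
    exact (A.chart p).map_source (A.mem_source p)
  filter_upwards [hmem, (A.chart p).open_source.mem_nhds (A.mem_source p)] with y hy hys
  change fl (-A.time y) y = _
  have h1 : A.chart p y + (A.time p - A.time y, 0) = (A.time p, (A.chart p y).2) := by
    rw [← A.chart_fst p y hys]
    ext <;> simp
  have h2 := hfl.chart _ (A.static p) _ ((A.chart p).map_source hys) (A.time p - A.time y)
    (by rw [h1]; exact hy)
  rw [(A.chart p).left_inv hys, h1] at h2
  rw [toLevel, ← h2, ← hfl.add]
  congr 1
  ring

theorem contMDiff_toSlice (hfl : IsStaticFlow g K proj F fl)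
    (hflow : ∀ r p, IsFlowStaticAt g K proj A.time (fl r) r p) :
    ContMDiff 𝓘(ℝ, E) 𝓘(ℝ, F) ∞ (toSlice hflow) := by
  intro p
  refine contMDiffAt_slice (ContMDiffAt.congr_of_eventuallyEq ?_
    (incl_toSlice_eventuallyEq hfl hflow p))
  refine ContMDiffAt.comp p ?_ (A.contMDiffAt_toLevel p)
  exact (hflow _ _).contMDiffAt

/-- Near `(r₀, x₀)` the flow for time `r` is the translation by `r - r₀` in a chart followed by the
flow for the fixed time `r₀`. Hence smoothness at each fixed time gives joint smoothness. -/
theorem contMDiff_flow_slice (hfl : IsStaticFlow g K proj F fl)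
    (hflow : ∀ r p, IsFlowStaticAt g K proj A.time (fl r) r p) :
    ContMDiff (𝓘(ℝ, ℝ).prod 𝓘(ℝ, F)) 𝓘(ℝ, E) ∞ (fun q : ℝ × A.Slice => fl q.1 (A.incl q.2)) := by
  rintro ⟨r₀, x₀⟩
  set p := A.incl x₀ with hp
  have hps := A.mem_source p
  have h0 : A.chart p p + ((r₀ - r₀, 0) : ℝ × F) = A.chart p p := by simp
  have h1 : ContMDiffAt (𝓘(ℝ, ℝ).prod 𝓘(ℝ, F)) 𝓘(ℝ, ℝ) ∞
      (fun q : ℝ × A.Slice => q.1 - r₀) (r₀, x₀) :=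
    contMDiffAt_fst.sub contMDiffAt_const
  have h2 : ContMDiffAt (𝓘(ℝ, ℝ).prod 𝓘(ℝ, F)) 𝓘(ℝ, E) ∞
      (fun q : ℝ × A.Slice => A.incl q.2) (r₀, x₀) :=
    (contMDiff_incl x₀).comp (r₀, x₀) contMDiffAt_snd
  have h3 : ContMDiffAt (𝓘(ℝ, ℝ).prod 𝓘(ℝ, F)) 𝓘(ℝ, ℝ × F) ∞
      (fun q : ℝ × A.Slice => A.chart p (A.incl q.2)) (r₀, x₀) :=
    ((A.static p).smooth.contMDiffAt hps).comp (r₀, x₀) h2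
  have h4 : ContMDiffAt (𝓘(ℝ, ℝ).prod 𝓘(ℝ, F)) 𝓘(ℝ, ℝ × F) ∞
      (fun q : ℝ × A.Slice => A.chart p (A.incl q.2) + (q.1 - r₀, 0)) (r₀, x₀) := by
    refine h3.add ?_
    have h5 : ContDiff ℝ ∞ (fun s : ℝ => (s, (0 : F))) := contDiff_id.prodMk contDiff_const
    exact h5.contMDiff.contMDiffAt.comp (r₀, x₀) h1
  have h5 : ContMDiffAt (𝓘(ℝ, ℝ).prod 𝓘(ℝ, F)) 𝓘(ℝ, E) ∞
      (fun q : ℝ × A.Slice => (A.chart p).symm (A.chart p (A.incl q.2) + (q.1 - r₀, 0)))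
      (r₀, x₀) := by
    refine ContMDiffAt.comp (r₀, x₀) ((A.static p).smooth.contMDiffAt_symm ?_) h4
    change A.chart p p + ((r₀ - r₀, 0) : ℝ × F) ∈ _
    rw [h0]
    exact (A.chart p).map_source hps
  have h6 : ContMDiffAt (𝓘(ℝ, ℝ).prod 𝓘(ℝ, F)) 𝓘(ℝ, E) ∞
      (fun q : ℝ × A.Slice => fl r₀ ((A.chart p).symm (A.chart p (A.incl q.2) + (q.1 - r₀, 0))))
      (r₀, x₀) := ContMDiffAt.comp (r₀, x₀) (hflow _ _).contMDiffAt h5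
  refine h6.congr_of_eventuallyEq ?_
  have h7 : Tendsto (fun q : ℝ × A.Slice => (q.1 - r₀, A.incl q.2)) (𝓝 (r₀, x₀))
      (𝓝 (0, p)) := by
    have := h1.continuousAt.prodMk h2.continuousAt
    rw [ContinuousAt] at this
    simpa using this
  have h8 := hfl.eventuallyEq (A.static p) hps (s := 0) (by
    rw [sub_self] at h0; rw [h0]; exact (A.chart p).map_source hps)
  filter_upwards [h7.eventually h8] with q hq
  rw [← hq, ← hfl.add, add_sub_cancel]

/-- The splitting of the manifold as the product of the time axis and the slice. -/
def splitting (hfl : IsStaticFlow g K proj F fl)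
    (hflow : ∀ r p, IsFlowStaticAt g K proj A.time (fl r) r p) :
    Diffeomorph 𝓘(ℝ, E) (𝓘(ℝ, ℝ).prod 𝓘(ℝ, F)) N (ℝ × A.Slice) ∞ where
  toFun p := (A.time p, toSlice hflow p)
  invFun q := fl q.1 (A.incl q.2)
  left_inv p := by
    change fl (A.time p) (fl (-A.time p) p) = p
    rw [← hfl.add, add_neg_cancel, hfl.zero]
  right_inv q := by
    have h1 : A.time (fl q.1 (A.incl q.2)) = q.1 := by
      rw [(hflow _ _).time, time_incl, zero_add]
    refine Prod.ext h1 (incl_injective ?_)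
    change fl (-A.time (fl q.1 (A.incl q.2))) (fl q.1 (A.incl q.2)) = A.incl q.2
    rw [h1, ← hfl.add, neg_add_cancel, hfl.zero]
  contMDiff_toFun := A.contMDiff_time.prodMk (contMDiff_toSlice hfl hflow)
  contMDiff_invFun := contMDiff_flow_slice hfl hflow

theorem mapD_incl_toSlice (hfl : IsStaticFlow g K proj F fl)
    (hflow : ∀ r p, IsFlowStaticAt g K proj A.time (fl r) r p) (p : N) (v : E) :
    mapD E (fun y => A.incl (toSlice hflow y)) p v =
      mapD E (fl (-A.time p)) p (mapD E (A.toLevel p) p v) := by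
  have h1 := (incl_toSlice_eventuallyEq hfl hflow p).mfderiv_eq (I := 𝓘(ℝ, E)) (I' := 𝓘(ℝ, E))
  have h2 := mfderiv_comp p (g := fl (-A.time p)) (f := A.toLevel p)
    ((hflow _ _).contMDiffAt.mdifferentiableAt (by simp))
    ((A.contMDiffAt_toLevel p).mdifferentiableAt (by simp))
  rw [A.toLevel_self] at h2
  exact DFunLike.congr_fun (h1.trans h2) v

/-- The differential of the projection to the level set removes the time component of a vector, and
the flow to the slice is isometric. -/
theorem sliceForm_toSlice (hproj : IsLocalDiffeomorph 𝓘(ℝ, E) 𝓘(ℝ, E) ∞ proj)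
    (hfl : IsStaticFlow g K proj F fl)
    (hflow : ∀ r p, IsFlowStaticAt g K proj A.time (fl r) r p) (p : N) (v w : E) :
    A.sliceForm (toSlice hflow p) (mfderiv 𝓘(ℝ, E) 𝓘(ℝ, F) (toSlice hflow) p v)
      (mfderiv 𝓘(ℝ, E) 𝓘(ℝ, F) (toSlice hflow) p w) =
      g.paramMetric (A.param p) (A.chart p p) (0, (chartD E (A.chart p) p v).2)
        (0, (chartD E (A.chart p) p w).2) := by
  have hs := (contMDiff_toSlice hfl hflow p).mdifferentiableAt (by simp)
  have h1 : ∀ v : E, A.sliceD (toSlice hflow p) (mfderiv 𝓘(ℝ, E) 𝓘(ℝ, F) (toSlice hflow) p v) =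
      mapD E proj (fl (-A.time p) p) (mapD E (fl (-A.time p)) p (mapD E (A.toLevel p) p v)) := by
    intro v
    have h2 := mfderiv_comp p (g := fun y : A.Slice => proj (A.incl y))
      ((contMDiff_proj_incl hproj _).mdifferentiableAt (by simp)) hs
    have h3 := mfderiv_comp p (g := proj) (f := fun y => A.incl (toSlice hflow y))
      ((hproj.contMDiff _).mdifferentiableAt (by simp))
      (((contMDiff_incl _).comp p (contMDiff_toSlice hfl hflow p)).mdifferentiableAt (by simp))
    rw [← mapD_incl_toSlice hfl hflow]
    exact DFunLike.congr_fun (h2.symm.trans h3) v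
  have h4 := (hflow (-A.time p) p).isometry (mapD E (A.toLevel p) p v) (mapD E (A.toLevel p) p w)
  rw [(A.static p).form_mapD hproj (A.mem_source p), A.chartD_mapD_toLevel,
    A.chartD_mapD_toLevel] at h4
  exact (congrArg₂ (fun a b => g.form (proj (fl (-A.time p) p)) a b) (h1 v) (h1 w)).trans h4

theorem isStaticSplitting [FiniteDimensional ℝ F]
    (hproj : IsLocalDiffeomorph 𝓘(ℝ, E) 𝓘(ℝ, E) ∞ proj)
    (hg : g.IsLorentzian) (hK : g.IsStaticField K) (hfl : IsStaticFlow g K proj F fl)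
    (hflow : ∀ r p, IsFlowStaticAt g K proj A.time (fl r) r p) :
    IsStaticSplitting g K proj (A.sliceMetric hproj hg hK.timelike)
      (fun x => -g.val (proj (A.incl x)) (K (proj (A.incl x))) (K (proj (A.incl x))))
      (splitting hfl hflow) where
  riemannian x v hv := sliceForm_pos hproj hg hK.timelike x hv
  beta_contMDiff := ((contMDiff_field_field hK.contMDiff).comp (contMDiff_proj_incl hproj)).neg
  beta_pos x := neg_pos.2 (hK.timelike _)
  isometry p v w := by
    have hΦ := ((splitting hfl hflow).contMDiff p).mdifferentiableAt (by simp)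
    have h1 : ∀ v : E, mfderiv (𝓘(ℝ, ℝ).prod 𝓘(ℝ, F)) 𝓘(ℝ, ℝ) (Prod.fst : ℝ × A.Slice → ℝ)
        (splitting hfl hflow p)
        (mfderiv 𝓘(ℝ, E) (𝓘(ℝ, ℝ).prod 𝓘(ℝ, F)) (splitting hfl hflow) p v) =
        (chartD E (A.chart p) p v).1 := by
      intro v
      have h2 := mfderiv_comp p (g := (Prod.fst : ℝ × A.Slice → ℝ)) mdifferentiableAt_fst hΦ
      rw [← A.mfderiv_time]
      exact (DFunLike.congr_fun h2 v).symm
    have h3 : ∀ v : E, mfderiv (𝓘(ℝ, ℝ).prod 𝓘(ℝ, F)) 𝓘(ℝ, F) (Prod.snd : ℝ × A.Slice → A.Slice)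
        (splitting hfl hflow p)
        (mfderiv 𝓘(ℝ, E) (𝓘(ℝ, ℝ).prod 𝓘(ℝ, F)) (splitting hfl hflow) p v) =
        mfderiv 𝓘(ℝ, E) 𝓘(ℝ, F) (toSlice hflow) p v := by
      intro v
      have h2 := mfderiv_comp p (g := (Prod.snd : ℝ × A.Slice → A.Slice)) mdifferentiableAt_snd hΦ
      exact (DFunLike.congr_fun h2 v).symm
    have h4 := (A.static p).form_mapD hproj (A.mem_source p) v w
    rw [(A.static p).param.apply_apply ((A.chart p).map_source (A.mem_source p)),
      (A.static p).param.paramMetric_one_one ((A.chart p).map_source (A.mem_source p)),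
      (A.chart p).left_inv (A.mem_source p)] at h4
    have h5 := (hflow (-A.time p) p).field
    have h6 := sliceForm_toSlice hproj hfl hflow p v w
    refine Eq.trans ?_ h4.symm
    unfold standardStaticMetric
    refine congrArg₂ (· + ·) ?_ ?_
    · refine (congrArg₂ (fun a b : ℝ => -(-g.val (proj (fl (-A.time p) p))
        (K (proj (fl (-A.time p) p))) (K (proj (fl (-A.time p) p)))) * (a * b)) (h1 v) (h1 w)).trans
        ?_
      rw [h5]
      ring
    · refine Eq.trans ?_ h6
      exact congrArg₂ (fun a b => A.sliceForm (toSlice hflow p) a b) (h3 v) (h3 w)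
  dt_eq p v := by
    refine Eq.trans ?_ ((A.static p).staticForm_eq hproj hK.timelike (A.mem_source p) v).symm
    exact A.mfderiv_time p v
  -- The curve `s ↦ (s, q.2)` corresponds to a flow line, whose velocity is the lifted field.
  field_eq q := by
    have hΦ := ((splitting hfl hflow).symm.contMDiff q).mdifferentiableAt (by simp)
    have h1 := mfderiv_comp q.1 (g := (splitting hfl hflow).symm) (f := fun s : ℝ => (s, q.2)) hΦ
      (mdifferentiableAt_id.prodMk mdifferentiableAt_const)
    rw [mfderiv_prod_left] at h1
    have h2 : (splitting hfl hflow).symm ∘ (fun s : ℝ => (s, q.2)) =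
        fun s => fl s (A.incl q.2) := rfl
    rw [h2, (hfl.integral _ _).mfderiv] at h1
    have h3 : mfderiv (𝓘(ℝ, ℝ).prod 𝓘(ℝ, F)) 𝓘(ℝ, E) (splitting hfl hflow).symm q
        (timeField F q) = (1 : ℝ) • liftField K proj ((splitting hfl hflow).symm q) :=
      (DFunLike.congr_fun h1 (1 : ℝ)).symm
    rw [one_smul] at h3
    rw [h3]
    exact mapD_liftField hproj _
  beta_eq p := by
    exact congrArg Neg.neg (hflow (-A.time p) p).field

end StaticAtlas

/-! ### The geodesic equation in a normed space -/

section GeodesicEquation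

variable {W : Type*} [NormedAddCommGroup W] [NormedSpace ℝ W]
  {W' : Type*} [NormedAddCommGroup W'] [NormedSpace ℝ W']

/-- The left-hand side of the geodesic equation of the metric `G` on an open set of a normed space,
tested against the vector `c`. -/
def geodRes (G : W → W →L[ℝ] W →L[ℝ] ℝ) (u : ℝ → W) (t : ℝ) (c : W) : ℝ :=
  G (u t) (deriv (deriv u) t) c + (1 / 2) * (fderiv ℝ G (u t) (deriv u t) (deriv u t) c +
    fderiv ℝ G (u t) (deriv u t) (deriv u t) c - fderiv ℝ G (u t) c (deriv u t) (deriv u t))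

theorem geodRes_congr {G G' : W → W →L[ℝ] W →L[ℝ] ℝ} {u u' : ℝ → W} {t : ℝ} (hu : u =ᶠ[𝓝 t] u')
    (hG : G =ᶠ[𝓝 (u t)] G') (c : W) : geodRes G u t c = geodRes G' u' t c := by
  have h1 : deriv u =ᶠ[𝓝 t] deriv u' := hu.deriv
  rw [geodRes, geodRes, h1.deriv_eq, h1.eq_of_nhds, hG.fderiv_eq, hG.eq_of_nhds, hu.eq_of_nhds]

theorem fderiv_clm_apply_apply {G : W → W →L[ℝ] W →L[ℝ] ℝ} {q : W} (hG : DifferentiableAt ℝ G q)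
    (a b c : W) : fderiv ℝ G q a b c = fderiv ℝ (fun q => G q b c) q a := by
  have h1 := ((hG.hasFDerivAt.clm_apply (hasFDerivAt_const b q)).clm_apply
    (hasFDerivAt_const c q)).fderiv
  rw [h1]
  simp

set_option maxSynthPendingDepth 3 in
/-- Invariance of the geodesic equation under changes of coordinates. -/
theorem geodRes_comp {G : W → W →L[ℝ] W →L[ℝ] ℝ} {G' : W' → W' →L[ℝ] W' →L[ℝ] ℝ} {ψ : W' → W}
    {u : ℝ → W'} {t : ℝ} (hu : ContDiffAt ℝ ∞ u t) (hψ : ContDiffAt ℝ ∞ ψ (u t))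
    (hG : DifferentiableAt ℝ G (ψ (u t))) (hG' : DifferentiableAt ℝ G' (u t))
    (hsymm : ∀ᶠ q in 𝓝 (u t), ∀ v w, G (ψ q) v w = G (ψ q) w v)
    (hGG' : ∀ᶠ q in 𝓝 (u t), ∀ v w, G' q v w = G (ψ q) (fderiv ℝ ψ q v) (fderiv ℝ ψ q w))
    (c : W') : geodRes G' u t c = geodRes G (ψ ∘ u) t (fderiv ℝ ψ (u t) c) := by
  have hψ1 : ContDiffAt ℝ ∞ (fderiv ℝ ψ) (u t) := hψ.fderiv_right (by norm_cast)
  have hψ1d := (hψ1.differentiableAt (by simp)).hasFDerivAt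
  have hψd := (hψ.differentiableAt (by simp)).hasFDerivAt
  have hud := (hu.differentiableAt (by simp)).hasDerivAt
  have hu1 : ContDiffAt ℝ ∞ (deriv u) t := by
    have h1 : ContDiffAt ℝ ∞ (fderiv ℝ u) t := hu.fderiv_right (by norm_cast)
    exact h1.clm_apply contDiffAt_const
  have hu1d := (hu1.differentiableAt (by simp)).hasDerivAt
  have h1 : deriv (ψ ∘ u) =ᶠ[𝓝 t] fun s => fderiv ℝ ψ (u s) (deriv u s) := by
    have hev1 : ∀ᶠ s in 𝓝 t, DifferentiableAt ℝ u s := by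
      filter_upwards [(hu.of_le (m := 1) (by norm_cast)).eventually (by simp)] with s hs
      exact hs.differentiableAt (by simp)
    have hev2 : ∀ᶠ s in 𝓝 t, DifferentiableAt ℝ ψ (u s) := by
      refine hu.continuousAt.eventually ?_
      filter_upwards [(hψ.of_le (m := 1) (by norm_cast)).eventually (by simp)] with q hq
      exact hq.differentiableAt (by simp)
    filter_upwards [hev1, hev2] with s hs1 hs2
    exact (hs2.hasFDerivAt.comp_hasDerivAt s hs1.hasDerivAt).deriv
  have h2 : deriv (deriv (ψ ∘ u)) t = fderiv ℝ (fderiv ℝ ψ) (u t) (deriv u t) (deriv u t) +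
      fderiv ℝ ψ (u t) (deriv (deriv u) t) := by
    rw [h1.deriv_eq]
    exact ((hψ1d.comp_hasDerivAt t hud).clm_apply hu1d).deriv
  have h3 : ∀ a b c, fderiv ℝ G' (u t) a b c =
      fderiv ℝ G (ψ (u t)) (fderiv ℝ ψ (u t) a) (fderiv ℝ ψ (u t) b) (fderiv ℝ ψ (u t) c) +
      G (ψ (u t)) (fderiv ℝ (fderiv ℝ ψ) (u t) a b) (fderiv ℝ ψ (u t) c) +
      G (ψ (u t)) (fderiv ℝ ψ (u t) b) (fderiv ℝ (fderiv ℝ ψ) (u t) a c) := by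
    intro a b c
    rw [fderiv_clm_apply_apply hG']
    have h4 : (fun q => G' q b c) =ᶠ[𝓝 (u t)]
        fun q => G (ψ q) (fderiv ℝ ψ q b) (fderiv ℝ ψ q c) := by
      filter_upwards [hGG'] with q hq using hq b c
    have h7 : HasFDerivAt (fun q => G (ψ q))
        ((fderiv ℝ G (ψ (u t))).comp (fderiv ℝ ψ (u t))) (u t) := hG.hasFDerivAt.comp (u t) hψd
    have h5 := ((h7.clm_apply
      (hψ1d.clm_apply (hasFDerivAt_const b (u t)))).clm_apply
        (hψ1d.clm_apply (hasFDerivAt_const c (u t))))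
    have h6 := (h5.congr_of_eventuallyEq h4).fderiv
    rw [h6]
    simp
    ring
  have hS : IsSymmSndFDerivAt ℝ ψ (u t) := hψ.isSymmSndFDerivAt (by rw [minSmoothness_of_isRCLikeNormedField]; norm_cast)
  -- Of the terms with second derivatives of `ψ`, those which involve `c` cancel by symmetry; the
  -- remaining one, `D²ψ(u', u')`, is the extra term of `(ψ ∘ u)''`.
  rw [geodRes, geodRes, h2, h1.eq_of_nhds, h3, h3, hGG'.self_of_nhds, Function.comp_apply,
    hsymm.self_of_nhds (fderiv ℝ (fderiv ℝ ψ) (u t) c (deriv u t)), hS.eq c (deriv u t), map_add,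
    add_apply]
  ring

set_option maxSynthPendingDepth 3 in
/-- Uniqueness of solutions of the geodesic equation. -/
theorem geodRes_unique [FiniteDimensional ℝ W] {G : W → W →L[ℝ] W →L[ℝ] ℝ} {O : Set W}
    (hO : IsOpen O) (hG : ContDiffOn ℝ ∞ G O)
    (hnd : ∀ q ∈ O, ∀ v, (∀ w, G q v w = 0) → v = 0) {u u' : ℝ → W} {t : ℝ} (htO : u t ∈ O)
    (hu : ContDiffAt ℝ ∞ u t) (hu' : ContDiffAt ℝ ∞ u' t)
    (hgu : ∀ᶠ s in 𝓝 t, ∀ c, geodRes G u s c = 0) (hgu' : ∀ᶠ s in 𝓝 t, ∀ c, geodRes G u' s c = 0)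
    (h0 : u t = u' t) (h1 : deriv u t = deriv u' t) : u =ᶠ[𝓝 t] u' := by
  have : CompleteSpace W := FiniteDimensional.complete ℝ W
  have hG1 : ContDiffOn ℝ ∞ (fderiv ℝ G) O := hG.fderiv_of_isOpen (m := ∞) hO (by norm_cast)
  -- the Christoffel symbols of the first kind
  let Γ : W × W → W →L[ℝ] ℝ := fun p => fderiv ℝ G p.1 p.2 p.2 -
    (1 / 2 : ℝ) • ((fderiv ℝ G p.1).flip p.2).flip p.2
  have hΓ : ContDiffOn ℝ ∞ Γ (O ×ˢ univ) := by
    have h2 : ContDiffOn ℝ ∞ (fun p : W × W => fderiv ℝ G p.1) (O ×ˢ univ) :=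
      hG1.comp contDiff_fst.contDiffOn fun p hp => hp.1
    have h3 : ContDiffOn ℝ ∞ (fun p : W × W => p.2) (O ×ˢ univ) := contDiff_snd.contDiffOn
    refine contDiffOn_clm_apply.2 fun c => ?_
    have h4 := (((h2.clm_apply h3).clm_apply h3).clm_apply (contDiffOn_const (c := c))).sub
      ((((h2.clm_apply (contDiffOn_const (c := c))).clm_apply h3).clm_apply h3).const_smul
        (1 / 2 : ℝ))
    exact h4
  have hinv : ∀ q ∈ O, ∃ B : W ≃L[ℝ] (W →L[ℝ] ℝ), (B : W →L[ℝ] W →L[ℝ] ℝ) = G q := by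
    intro q hq
    have hinj : Function.Injective (G q : W →ₗ[ℝ] W →L[ℝ] ℝ) := by
      rw [injective_iff_map_eq_zero]
      intro v hv
      refine hnd q hq v fun w => ?_
      have : G q v = 0 := hv
      rw [this]; rfl
    have hfr : Module.finrank ℝ W = Module.finrank ℝ (W →L[ℝ] ℝ) := by
      rw [(LinearMap.toContinuousLinearMap (𝕜 := ℝ) (E := W) (F' := ℝ)).symm.finrank_eq]
      exact (Subspace.dual_finrank_eq).symm
    refine ⟨(LinearEquiv.ofInjectiveOfFinrankEq _ hinj hfr).toContinuousLinearEquiv, ?_⟩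
    ext v w
    rfl
  -- Nondegeneracy allows the equation to be solved for `u''`, which gives a first-order system on
  -- positions and velocities. Its right-hand side is smooth, hence locally Lipschitz.
  let Θ : W × W → W × W := fun p => (p.2, -(G p.1).inverse (Γ p))
  have hΘ : ContDiffOn ℝ ∞ Θ (O ×ˢ univ) := by
    have h2 : ContDiffOn ℝ ∞ (fun p : W × W => (G p.1).inverse) (O ×ˢ univ) := by
      intro p hp
      obtain ⟨B, hB⟩ := hinv p.1 hp.1
      have h3 : ContDiffAt ℝ ∞ ContinuousLinearMap.inverse (G p.1) := by
        rw [← hB]; exact contDiffAt_map_inverse B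
      exact h3.comp_contDiffWithinAt p
        ((hG.comp contDiff_fst.contDiffOn fun p hp => hp.1) p hp)
    exact contDiff_snd.contDiffOn.prodMk (h2.clm_apply hΓ).neg
  have hOW : IsOpen (O ×ˢ (univ : Set W)) := hO.prod isOpen_univ
  have hsol : ∀ u : ℝ → W, u t ∈ O → ContDiffAt ℝ ∞ u t → (∀ᶠ s in 𝓝 t, ∀ c, geodRes G u s c = 0) →
      ∀ᶠ s in 𝓝 t, HasDerivAt (fun s => (u s, deriv u s)) (Θ (u s, deriv u s)) s := by
    intro u htO hu hgu
    have hev1 : ∀ᶠ s in 𝓝 t, ContDiffAt ℝ 2 u s :=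
      (hu.of_le (m := 2) (by norm_cast)).eventually (by simp)
    filter_upwards [hev1, hgu, hu.continuousAt.eventually_mem (hO.mem_nhds htO)] with s hs hgs hsO
    have hd1 : ContDiffAt ℝ 1 (deriv u) s := by
      have h1 : ContDiffAt ℝ 1 (fderiv ℝ u) s := hs.fderiv_right (by norm_num)
      exact h1.clm_apply contDiffAt_const
    have h2 : deriv (deriv u) s = -(G (u s)).inverse (Γ (u s, deriv u s)) := by
      obtain ⟨B, hB⟩ := hinv (u s) hsO
      rw [← hB, ContinuousLinearMap.inverse_equiv]
      have h3 : B (deriv (deriv u) s) = -Γ (u s, deriv u s) := by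
        ext c
        have h4 := hgs c
        rw [geodRes, ← hB] at h4
        simp only [Γ, neg_apply, sub_apply, smul_apply, ContinuousLinearMap.flip_apply,
          smul_eq_mul]
        have h5 : (B : W →L[ℝ] W →L[ℝ] ℝ) (deriv (deriv u) s) c = B (deriv (deriv u) s) c := rfl
        rw [h5] at h4
        linarith
      rw [← B.symm_apply_apply (deriv (deriv u) s), h3, map_neg]
      rfl
    have h3 := (hs.differentiableAt (by simp)).hasDerivAt.prodMk
      (hd1.differentiableAt (by simp)).hasDerivAt
    rw [h2] at h3
    exact h3
  obtain ⟨κ, U, hU, hL⟩ := ((hΘ.contDiffAt (hOW.mem_nhds (x := (u t, deriv u t))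
    ⟨htO, mem_univ _⟩)).of_le (m := 1) (by norm_cast)).exists_lipschitzOnWith
  have hcont : ∀ u : ℝ → W, ContDiffAt ℝ ∞ u t → ContinuousAt (fun s => (u s, deriv u s)) t := by
    intro u hu
    have h1 : ContDiffAt ℝ ∞ (fderiv ℝ u) t := hu.fderiv_right (by norm_cast)
    exact hu.continuousAt.prodMk (h1.clm_apply contDiffAt_const).continuousAt
  have h2 := ODE_solution_unique_of_eventually (v := fun _ => Θ) (s := fun _ => U) (K := κ)
    (Eventually.of_forall fun _ => hL)
    ((hsol u htO hu hgu).and ((hcont u hu).eventually_mem hU))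
    ((hsol u' (h0 ▸ htO) hu' hgu').and ((hcont u' hu').eventually_mem (by
      simpa only [h0, h1] using hU))) (by simp [h0, h1])
  filter_upwards [h2] with s hs
  exact congrArg Prod.fst hs

end GeodesicEquation

/-- The diagonal of a Hausdorff space is closed. This lets positions and velocities of two geodesics
be compared at a limit of times where they agree. -/
theorem eq_of_frequently_eq {X Y : Type*} [TopologicalSpace X] [TopologicalSpace Y] [T2Space Y]
    {f f' : X → Y} {x : X} (hf : ContinuousAt f x) (hf' : ContinuousAt f' x)
    (h : ∃ᶠ z in 𝓝 x, f z = f' z) : f x = f' x := by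
  by_contra hne
  exact h ((hf.prodMk hf').eventually (isClosed_diagonal.isOpen_compl.eventually_mem hne))

/-! ### Geodesics on a manifold: invariance and uniqueness -/

section GeodesicOnManifold

variable {E : Type*} [NormedAddCommGroup E] [NormedSpace ℝ E]
  {M : Type*} [TopologicalSpace M] [ChartedSpace E M] [IsManifold 𝓘(ℝ, E) ∞ M]
  {W : Type*} [NormedAddCommGroup W] [NormedSpace ℝ W]
  {g : PseudoRiemannianMetric E M} {γ γ' : ℝ → M} {t : ℝ}

/-- The curve `γ` is smooth at time `t` and satisfies the geodesic equation at this time. -/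
structure GeodEqAt (g : PseudoRiemannianMetric E M) (γ : ℝ → M) (t : ℝ) : Prop where
  contMDiffAt : ContMDiffAt 𝓘(ℝ, ℝ) 𝓘(ℝ, E) ∞ γ t
  eq_zero : ∀ x₀ : M, γ t ∈ (chartAt E x₀).source → ∀ c : E,
    geodRes (g.inChart x₀) (fun s => extChartAt 𝓘(ℝ, E) x₀ (γ s)) t c = 0

theorem isGeodesic_iff_forall_geodEqAt : g.IsGeodesic γ ↔ ∀ t, GeodEqAt g γ t :=
  ⟨fun h t => ⟨h.1 t, fun x₀ hx c => h.2 x₀ t hx c⟩,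
    fun h => ⟨fun t => (h t).1, fun x₀ t hx c => (h t).2 x₀ hx c⟩⟩

omit [IsManifold 𝓘(ℝ, E) ∞ M] in
theorem fderiv_chart_comp {e : OpenPartialHomeomorph M W} (he : IsSmoothChart E e)
    {W' : Type*} [NormedAddCommGroup W'] [NormedSpace ℝ W'] {h : W' → M} {q : W'}
    (hh : MDifferentiableAt 𝓘(ℝ, W') 𝓘(ℝ, E) h q) (hq : h q ∈ e.source) :
    fderiv ℝ (fun q => e (h q)) q = (chartD E e (h q)).comp (paramD E h q) := by
  have h1 := mfderiv_comp q (he.mdifferentiableAt hq) hh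
  exact (mfderiv_eq_fderiv (f := fun q => e (h q)) (x := q)).symm.trans h1

omit [IsManifold 𝓘(ℝ, E) ∞ M] in
theorem deriv_chart_comp {e : OpenPartialHomeomorph M W} (he : IsSmoothChart E e)
    (hγ : MDifferentiableAt 𝓘(ℝ, ℝ) 𝓘(ℝ, E) γ t) (ht : γ t ∈ e.source) :
    deriv (fun s => e (γ s)) t = chartD E e (γ t) (paramD E γ t 1) := by
  rw [← fderiv_apply_one_eq_deriv, fderiv_chart_comp he hγ ht]
  rfl

omit [IsManifold 𝓘(ℝ, E) ∞ M] in
theorem contDiffAt_chart_comp {e : OpenPartialHomeomorph M W} (he : IsSmoothChart E e)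
    (hγ : ContMDiffAt 𝓘(ℝ, ℝ) 𝓘(ℝ, E) ∞ γ t) (ht : γ t ∈ e.source) :
    ContDiffAt ℝ ∞ (fun s => e (γ s)) t :=
  contMDiffAt_iff_contDiffAt.1 ((he.contMDiffAt ht).comp t hγ)

/-- Invariance of the equation under `ψ = chart ∘ h`. This map need not be invertible, so only test
vectors in the range of the derivative of `h` are reached. -/
theorem geodRes_param [FiniteDimensional ℝ E] [FiniteDimensional ℝ W] {h : W → M} {U : Set W}
    (hU : IsOpen U) (hh : ContMDiffOn 𝓘(ℝ, W) 𝓘(ℝ, E) ∞ h U) {w : ℝ → W} (hwU : w t ∈ U)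
    (hw : ContDiffAt ℝ ∞ w t) (hγ : γ =ᶠ[𝓝 t] fun s => h (w s)) {x₀ : M}
    (hx₀ : γ t ∈ (chartAt E x₀).source) (c : W) :
    geodRes (g.paramMetric h) w t c =
      geodRes (g.inChart x₀) (fun s => extChartAt 𝓘(ℝ, E) x₀ (γ s)) t
        (chartD E (chartAt E x₀) (γ t) (paramD E h (w t) c)) := by
  have he := isSmoothChart_chartAt (E := E) x₀
  rw [hγ.eq_of_nhds] at hx₀ ⊢
  have hsm := (hh.contMDiffAt (hU.mem_nhds hwU))
  have hev : ∀ᶠ q in 𝓝 (w t), q ∈ U ∧ h q ∈ (chartAt E x₀).source :=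
    (hU.eventually_mem hwU).and
      (hsm.continuousAt.eventually_mem ((chartAt E x₀).open_source.mem_nhds hx₀))
  have hmd : ∀ q ∈ U, MDifferentiableAt 𝓘(ℝ, W) 𝓘(ℝ, E) h q := fun q hq =>
    (hh.contMDiffAt (hU.mem_nhds hq)).mdifferentiableAt (by simp)
  have hψ : ContDiffAt ℝ ∞ (fun q => chartAt E x₀ (h q)) (w t) :=
    contMDiffAt_iff_contDiffAt.1 ((he.contMDiffAt hx₀).comp (w t) hsm)
  have h1 := geodRes_comp (G := g.paramMetric (chartAt E x₀).symm) (G' := g.paramMetric h)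
    (ψ := fun q => chartAt E x₀ (h q)) hw hψ
    (((g.contDiffOn_paramMetric (chartAt E x₀).open_target he.contMDiffOn_symm).contDiffAt
      ((chartAt E x₀).open_target.mem_nhds ((chartAt E x₀).map_source hx₀))).differentiableAt
        (by simp))
    (((g.contDiffOn_paramMetric hU hh).contDiffAt (hU.mem_nhds hwU)).differentiableAt (by simp))
    (Eventually.of_forall fun q v w => g.paramMetric_symm _ _ _ _) ?_ c
  · rw [h1, fderiv_chart_comp he (hmd _ hwU) hx₀]
    refine geodRes_congr ?_ (Eventually.of_forall fun q => rfl) _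
    filter_upwards [hγ] with s hs
    rw [hs]
    rfl
  · filter_upwards [hev.eventually_nhds] with q hq v v'
    obtain ⟨hqU, hqs⟩ := hq.self_of_nhds
    have h2 : h =ᶠ[𝓝 q] fun q => (chartAt E x₀).symm (chartAt E x₀ (h q)) := by
      filter_upwards [hq] with q' hq' using ((chartAt E x₀).left_inv hq'.2).symm
    have h3 : DifferentiableAt ℝ (fun q => chartAt E x₀ (h q)) q :=
      ((he.mdifferentiableAt hqs).comp q (hmd q hqU)).differentiableAt
    rw [g.paramMetric_congr h2, g.paramMetric_comp (h := (chartAt E x₀).symm)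
      (ψ := fun q => chartAt E x₀ (h q))
      (he.mdifferentiableAt_symm ((chartAt E x₀).map_source hqs)) h3]
    rfl

theorem GeodEqAt.geodRes_eq_zero [FiniteDimensional ℝ E] [FiniteDimensional ℝ W]
    (hgeo : GeodEqAt g γ t) {h : W → M} {U : Set W}
    (hU : IsOpen U) (hh : ContMDiffOn 𝓘(ℝ, W) 𝓘(ℝ, E) ∞ h U) {w : ℝ → W} (hwU : w t ∈ U)
    (hw : ContDiffAt ℝ ∞ w t) (hγ : γ =ᶠ[𝓝 t] fun s => h (w s)) (c : W) :
    geodRes (g.paramMetric h) w t c = 0 := by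
  rw [geodRes_param hU hh hwU hw hγ (mem_chart_source E (γ t))]
  exact hgeo.eq_zero _ (mem_chart_source E (γ t)) _

/-- By surjectivity of the derivative of `h`, every test vector in a chart of `M` comes from one in
`W`. -/
theorem geodEqAt_of_geodRes [FiniteDimensional ℝ E] [FiniteDimensional ℝ W]
    {h : W → M} {U : Set W}
    (hU : IsOpen U) (hh : ContMDiffOn 𝓘(ℝ, W) 𝓘(ℝ, E) ∞ h U) {w : ℝ → W} (hwU : w t ∈ U)
    (hw : ContDiffAt ℝ ∞ w t) (hγ : γ =ᶠ[𝓝 t] fun s => h (w s))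
    (hsurj : Function.Surjective (paramD E h (w t)))
    (h0 : ∀ c, geodRes (g.paramMetric h) w t c = 0) : GeodEqAt g γ t := by
  refine ⟨?_, fun x₀ hx c => ?_⟩
  · refine ContMDiffAt.congr_of_eventuallyEq ?_ hγ
    exact (hh.contMDiffAt (hU.mem_nhds hwU)).comp t hw.contMDiffAt
  · have he := isSmoothChart_chartAt (E := E) x₀
    obtain ⟨c', hc'⟩ := hsurj (paramD E (chartAt E x₀).symm (chartAt E x₀ (γ t)) c)
    have h1 := geodRes_param (g := g) hU hh hwU hw hγ hx c'
    rw [h0 c', hc', he.chartD_paramD hx] at h1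
    exact h1.symm

omit [IsManifold 𝓘(ℝ, E) ∞ M] in
theorem IsSmoothChart.paramD_surjective {e : OpenPartialHomeomorph M W} (he : IsSmoothChart E e)
    {q : W} (hq : q ∈ e.target) : Function.Surjective (paramD E e.symm q) := by
  intro v
  have h1 := he.paramD_chartD (e.map_target hq) v
  rw [e.right_inv hq] at h1
  exact ⟨_, h1⟩

theorem IsSmoothChart.paramMetric_nondegenerate {e : OpenPartialHomeomorph M W}
    (he : IsSmoothChart E e) {q : W} (hq : q ∈ e.target) {v : W}
    (hv : ∀ w, g.paramMetric e.symm q v w = 0) : v = 0 := by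
  have h1 : paramD E e.symm q v = 0 := by
    refine g.nondegenerate (e.symm q) _ fun w => ?_
    obtain ⟨w', hw'⟩ := he.paramD_surjective hq w
    rw [← hw']
    exact hv w'
  have h2 := he.chartD_paramD (e.map_target hq) v
  rw [e.right_inv hq, h1, map_zero] at h2
  exact h2.symm

/-- A geodesic is locally determined by its position and velocity. -/
theorem GeodEqAt.eventuallyEq [FiniteDimensional ℝ E] (hγ : ∀ᶠ s in 𝓝 t, GeodEqAt g γ s)
    (hγ' : ∀ᶠ s in 𝓝 t, GeodEqAt g γ' s) (h0 : γ t = γ' t)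
    (h1 : paramD E γ t 1 = paramD E γ' t 1) : γ =ᶠ[𝓝 t] γ' := by
  let e := chartAt E (γ t)
  have he : IsSmoothChart E e := isSmoothChart_chartAt (E := E) (γ t)
  have hs : γ t ∈ e.source := mem_chart_source E (γ t)
  have hs' : γ' t ∈ e.source := h0 ▸ hs
  have hc := hγ.self_of_nhds.contMDiffAt
  have hc' := hγ'.self_of_nhds.contMDiffAt
  have hev := hc.continuousAt.eventually_mem (e.open_source.mem_nhds hs)
  have hev' := hc'.continuousAt.eventually_mem (e.open_source.mem_nhds hs')
  have h2 : (fun s => e (γ s)) =ᶠ[𝓝 t] fun s => e (γ' s) := by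
    refine geodRes_unique (G := g.inChart (γ t)) e.open_target
      (g.contDiffOn_paramMetric e.open_target he.contMDiffOn_symm)
      (fun q hq v hv => he.paramMetric_nondegenerate hq hv) (e.map_source hs)
      (contDiffAt_chart_comp he hc hs) (contDiffAt_chart_comp he hc' hs') ?_ ?_ ?_ ?_
    · filter_upwards [hγ, hev] with s h3 h4 using h3.2 _ h4
    · filter_upwards [hγ', hev'] with s h3 h4 using h3.2 _ h4
    · rw [h0]
    · rw [deriv_chart_comp he (hc.mdifferentiableAt (by simp)) hs,
        deriv_chart_comp he (hc'.mdifferentiableAt (by simp)) hs', h0, h1]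
  filter_upwards [h2, hev, hev'] with s h3 h4 h5
  exact e.injOn h4 h5 h3

/-- Geodesics which have the same germ at one time of an interval agree on this interval. -/
theorem GeodEqAt.eqOn [FiniteDimensional ℝ E] [T2Space M] {J : Set ℝ} (hJ : IsOpen J)
    (hJc : IsPreconnected J) (hγ : ∀ s ∈ J, GeodEqAt g γ s) (hγ' : ∀ s ∈ J, GeodEqAt g γ' s)
    (ht : t ∈ J) (h : γ =ᶠ[𝓝 t] γ') : EqOn γ γ' J := by
  have key : ∀ y ∈ J, γ =ᶠ[𝓝 y] γ' := by
    refine hJc.forall_of_eventually_iff ht (P := fun y => γ =ᶠ[𝓝 y] γ') h fun y hy => ?_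
    by_cases hP : γ =ᶠ[𝓝 y] γ'
    · filter_upwards [nhdsWithin_le_nhds hP.eventuallyEq_nhds] with z hz
      exact iff_of_true hz hP
    -- Coincidence of germs is a closed condition: at a limit of such times positions and velocities
    -- agree by continuity, and local uniqueness applies.
    · have hev : ∀ᶠ z in 𝓝 y, ¬ γ =ᶠ[𝓝 z] γ' := by
        by_contra hcon
        have hfr : ∃ᶠ z in 𝓝 y, γ =ᶠ[𝓝 z] γ' := by
          simpa only [not_eventually, not_not] using hcon
        apply hP
        have hc := (hγ y hy).contMDiffAt
        have hc' := (hγ' y hy).contMDiffAt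
        have h0 : γ y = γ' y := by
          exact eq_of_frequently_eq hc.continuousAt hc'.continuousAt
            (hfr.mono fun z hz => hz.eq_of_nhds)
        let e := chartAt E (γ y)
        have he : IsSmoothChart E e := isSmoothChart_chartAt (E := E) (γ y)
        have hs : γ y ∈ e.source := mem_chart_source E (γ y)
        have hs' : γ' y ∈ e.source := h0 ▸ hs
        have hd : ∀ {c : ℝ → M}, ContMDiffAt 𝓘(ℝ, ℝ) 𝓘(ℝ, E) ∞ c y → c y ∈ e.source →
            ContinuousAt (deriv fun s => e (c s)) y := by
          intro c hcc hcs
          have h2 : ContDiffAt ℝ ∞ (fderiv ℝ fun s => e (c s)) y :=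
            (contDiffAt_chart_comp he hcc hcs).fderiv_right (by norm_cast)
          exact (h2.clm_apply (contDiffAt_const (c := (1 : ℝ)))).continuousAt
        have h1 : deriv (fun s => e (γ s)) y = deriv (fun s => e (γ' s)) y := by
          refine eq_of_frequently_eq (hd hc hs) (hd hc' hs') (hfr.mono fun z hz1 => ?_)
          refine Filter.EventuallyEq.deriv_eq ?_
          filter_upwards [hz1] with s h3
          rw [h3]
        have hJy : ∀ᶠ s in 𝓝 y, s ∈ J := hJ.eventually_mem hy
        refine GeodEqAt.eventuallyEq (hJy.mono hγ) (hJy.mono hγ') h0 ?_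
        rw [deriv_chart_comp he (hc.mdifferentiableAt (by simp)) hs,
          deriv_chart_comp he (hc'.mdifferentiableAt (by simp)) hs', ← h0] at h1
        exact (he.chartDEquiv hs).injective h1
      filter_upwards [nhdsWithin_le_nhds hev] with z hz
      exact iff_of_false hz hP
  exact fun y hy => (key y hy).eq_of_nhds

/-- Local isometries of a chart map geodesics to geodesics. -/
theorem GeodEqAt.map_chart [FiniteDimensional ℝ E] [FiniteDimensional ℝ W]
    (hgeo : GeodEqAt g γ t) {e : OpenPartialHomeomorph M W} (he : IsSmoothChart E e)
    (hs : γ t ∈ e.source) {ψ : W → W} (hψ : ContDiff ℝ ∞ ψ) (hψs : ψ (e (γ t)) ∈ e.target)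
    {L : W →L[ℝ] W} (hL : ∀ q, HasFDerivAt ψ L q) (hLs : Function.Surjective L)
    (hiso : ∀ᶠ q in 𝓝 (e (γ t)), ∀ v w,
      g.paramMetric e.symm (ψ q) (L v) (L w) = g.paramMetric e.symm q v w) :
    GeodEqAt g (fun s => e.symm (ψ (e (γ s)))) t := by
  have hu := contDiffAt_chart_comp he hgeo.1 hs
  have hG : ∀ q ∈ e.target, DifferentiableAt ℝ (g.paramMetric e.symm) q := fun q hq =>
    (((g.contDiffOn_paramMetric e.open_target he.contMDiffOn_symm).contDiffAt
      (e.open_target.mem_nhds hq))).differentiableAt (by simp)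
  refine geodEqAt_of_geodRes (w := fun s => ψ (e (γ s))) e.open_target he.contMDiffOn_symm hψs
    (hψ.contDiffAt.comp t hu) (Eventually.of_forall fun s => rfl) (he.paramD_surjective hψs)
    fun c => ?_
  obtain ⟨c', rfl⟩ := hLs c
  have h1 := geodRes_comp (G := g.paramMetric e.symm) (G' := g.paramMetric e.symm) (ψ := ψ) hu
    hψ.contDiffAt (hG _ hψs) (hG _ (e.map_source hs))
    (Eventually.of_forall fun q v w => g.paramMetric_symm _ _ _ _)
    (by
      filter_upwards [hiso] with q hq v w
      rw [(hL q).fderiv, hq]) c'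
  rw [(hL _).fderiv] at h1
  refine h1.symm.trans (hgeo.geodRes_eq_zero e.open_target he.contMDiffOn_symm (e.map_source hs) hu
    ?_ c')
  filter_upwards [hgeo.1.continuousAt.eventually_mem (e.open_source.mem_nhds hs)] with s hs'
  exact (e.left_inv hs').symm

theorem PseudoRiemannianMetric.GeodesicallyComplete.exists_geodesic
    (hg : g.GeodesicallyComplete) (x : M) (v : E) :
    ∃ γ : ℝ → M, g.IsGeodesic γ ∧ γ 0 = x ∧ paramD E γ 0 1 = v := by
  obtain ⟨γ, hγ, hV⟩ := hg ⟨x, v⟩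
  obtain ⟨h1, h2⟩ := TotalSpace.mk.inj hV
  subst h1
  exact ⟨γ, hγ, rfl, eq_of_heq h2⟩

end GeodesicOnManifold

/-! ### Partial flows and maximal integral curves -/

section FlowTo

variable {E : Type*} [NormedAddCommGroup E] [NormedSpace ℝ E]
  {M : Type*} [TopologicalSpace M] [ChartedSpace E M]
  {K : (x : M) → TangentSpace 𝓘(ℝ, E) x} {x y z : M} {r s : ℝ}

/-- The maximal integral curve of `K` which starts at `x` is defined at time `r`, where it passes
through `y`. -/
def FlowTo (K : (x : M) → TangentSpace 𝓘(ℝ, E) x) (r : ℝ) (x y : M) : Prop :=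
  ∃ (c : ℝ → M) (a b : ℝ), 0 ∈ Ioo a b ∧ r ∈ Ioo a b ∧
    IsMIntegralCurveOn (I := 𝓘(ℝ, E)) c K (Ioo a b) ∧ c 0 = x ∧ c r = y

theorem FlowTo.symm (h : FlowTo K r x y) : FlowTo K (-r) y x := by
  obtain ⟨c, a, b, h0, hr, hc, rfl, rfl⟩ := h
  refine ⟨c ∘ (· + r), a - r, b - r, ?_, ?_, (hc.comp_add r).mono ?_, ?_, ?_⟩
  · constructor <;> linarith [hr.1, hr.2]
  · constructor <;> linarith [h0.1, h0.2]
  · intro t ht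
    exact ⟨by linarith [ht.1], by linarith [ht.2]⟩
  · simp
  · simp

theorem FlowTo.eq [T2Space M] [IsManifold 𝓘(ℝ, E) 1 M] [CompleteSpace E]
    (hK : ContMDiff 𝓘(ℝ, E) 𝓘(ℝ, E).tangent 1 (fun x ↦ (⟨x, K x⟩ : TangentBundle 𝓘(ℝ, E) M)))
    (h : FlowTo K r x y) (h' : FlowTo K r x z) : y = z := by
  obtain ⟨c, a, b, h0, hr, hc, hcx, rfl⟩ := h
  obtain ⟨c', a', b', h0', hr', hc', hcx', rfl⟩ := h'
  have h1 := isMIntegralCurveOn_Ioo_eqOn_of_contMDiff_boundaryless (t₀ := 0)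
    (a := max a a') (b := min b b') ⟨max_lt h0.1 h0'.1, lt_min h0.2 h0'.2⟩ hK
    (hc.mono (Ioo_subset_Ioo (le_max_left _ _) (min_le_left _ _)))
    (hc'.mono (Ioo_subset_Ioo (le_max_right _ _) (min_le_right _ _))) (hcx.trans hcx'.symm)
  exact h1 ⟨max_lt hr.1 hr'.1, lt_min hr.2 hr'.2⟩

theorem FlowTo.trans [T2Space M] [IsManifold 𝓘(ℝ, E) 1 M] [CompleteSpace E]
    (hK : ContMDiff 𝓘(ℝ, E) 𝓘(ℝ, E).tangent 1 (fun x ↦ (⟨x, K x⟩ : TangentBundle 𝓘(ℝ, E) M)))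
    (h : FlowTo K r x y) (h' : FlowTo K s y z) : FlowTo K (r + s) x z := by
  obtain ⟨c, a, b, h0, hr, hc, hcx, hcr⟩ := h
  obtain ⟨c', a', b', h0', hs, hc', hcx', rfl⟩ := h'
  have hc'' : IsMIntegralCurveOn (I := 𝓘(ℝ, E)) (c' ∘ (· + -r)) K (Ioo (a' + r) (b' + r)) :=
    (hc'.comp_add (-r)).mono fun t ht => ⟨by linarith [ht.1], by linarith [ht.2]⟩
  have hr' : r ∈ Ioo (a' + r) (b' + r) := ⟨by linarith [h0'.1], by linarith [h0'.2]⟩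
  have heq : c r = (c' ∘ (· + -r)) r := by simp [hcr, hcx']
  have h1 := isMIntegralCurveOn_piecewise hK hc hc'' ⟨hr, hr'⟩ heq
  have h2 := eqOn_piecewise_of_isMIntegralCurveOn_Ioo hK hc hc'' ⟨hr, hr'⟩ heq
  rw [Ioo_union_Ioo' (hr'.1.trans hr.2) (hr.1.trans hr'.2)] at h1
  refine ⟨_, _, _, ?_, ?_, h1, ?_, ?_⟩
  · exact ⟨(min_le_left _ _).trans_lt h0.1, h0.2.trans_le (le_max_left _ _)⟩
  · exact ⟨(min_le_right _ _).trans_lt (by linarith [hs.1]),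
      lt_of_lt_of_le (by linarith [hs.2]) (le_max_right _ _)⟩
  · rw [piecewise_eq_of_mem _ _ _ h0, hcx]
  · rw [h2 ⟨by linarith [hs.1], by linarith [hs.2]⟩]
    simp

/-- The domain of a maximal integral curve is an interval. -/
theorem FlowTo.exists_of_mem_uIcc (h : FlowTo K r x y) (hs : s ∈ uIcc 0 r) :
    ∃ z, FlowTo K s x z := by
  obtain ⟨c, a, b, h0, hr, hc, hcx, -⟩ := h
  exact ⟨c s, c, a, b, h0, ordConnected_Ioo.uIcc_subset h0 hr hs, hc, hcx, rfl⟩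

/-- Flowing back from `x` to time `-a` and then forward to time `a` produces one integral curve,
which after a shift of its parameter is defined on the interval from `-a` to `a` and passes through
`x` at `0`. -/
theorem isCompleteField_of_flowTo [T2Space M] [IsManifold 𝓘(ℝ, E) 1 M] [CompleteSpace E]
    (hK : ContMDiff 𝓘(ℝ, E) 𝓘(ℝ, E).tangent 1 (fun x ↦ (⟨x, K x⟩ : TangentBundle 𝓘(ℝ, E) M)))
    (h : ∀ x r, ∃ y, FlowTo K r x y) : IsCompleteField K := by
  intro x
  refine (exists_isMIntegralCurve_iff_exists_isMIntegralCurveOn_Ioo hK (x := x)).2 fun a => ?_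
  obtain ⟨y, hy⟩ := h x a
  obtain ⟨z, hz⟩ := h x (-a)
  obtain ⟨c, α, β, h0, hr, hc, hcz, hcy⟩ := hz.symm.trans hK hy
  have h1 : c a = x := by
    rcases le_total 0 a with ha | ha
    · refine FlowTo.eq hK (r := a) (x := z) ⟨c, α, β, h0, ?_, hc, hcz, rfl⟩ ?_
      · exact ⟨by linarith [h0.1], by linarith [hr.2]⟩
      · simpa using hz.symm
    · refine FlowTo.eq hK (r := a) (x := z) ⟨c, α, β, h0, ?_, hc, hcz, rfl⟩ ?_
      · exact ⟨by linarith [hr.1], by linarith [h0.2]⟩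
      · simpa using hz.symm
  refine ⟨c ∘ (· + a), by simp [h1], (hc.comp_add a).mono fun t ht => ?_⟩
  exact ⟨by linarith [ht.1, h0.1], by linarith [ht.2, hr.2]⟩

end FlowTo

/-! ### Local isometries of static charts: translation and reflection of time -/

section StaticChart

variable {E : Type*} [NormedAddCommGroup E] [NormedSpace ℝ E]
  {F : Type*} [NormedAddCommGroup F] [NormedSpace ℝ F]
  {M : Type*} [TopologicalSpace M] [ChartedSpace E M] [IsManifold 𝓘(ℝ, E) ∞ M]
  {g : PseudoRiemannianMetric E M} {K : (x : M) → TangentSpace 𝓘(ℝ, E) x}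
  {e : OpenPartialHomeomorph M (ℝ × F)}

omit [IsManifold 𝓘(ℝ, E) ∞ M] in
theorem isLocalDiffeomorph_id : IsLocalDiffeomorph 𝓘(ℝ, E) 𝓘(ℝ, E) ∞ (id : M → M) :=
  (Diffeomorph.refl 𝓘(ℝ, E) M ∞).isLocalDiffeomorph

omit [IsManifold 𝓘(ℝ, E) ∞ M] in
theorem liftField_id : liftField K (id : M → M) = K := by
  funext x
  have h1 := mapD_liftField (K := K) isLocalDiffeomorph_id x
  have h2 : mapD E (id : M → M) x = ContinuousLinearMap.id ℝ E := mfderiv_id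
  rw [h2] at h1
  exact h1

-- A ball of a product is a product of balls, so a time line meets it in an interval.
omit [NormedSpace ℝ F] in
theorem add_mem_ball_iff {q q₀ : ℝ × F} {R : ℝ} (hq : q ∈ Metric.ball q₀ R) (s : ℝ) :
    q + (s, 0) ∈ Metric.ball q₀ R ↔ s ∈ Ioo (q₀.1 - R - q.1) (q₀.1 + R - q.1) := by
  rw [← ball_prod_same, mem_prod] at hq ⊢
  rw [Prod.fst_add, Prod.snd_add, add_zero, and_iff_left hq.2, Real.ball_eq_Ioo, mem_Ioo, mem_Ioo]
  constructor <;> rintro ⟨h1, h2⟩ <;> constructor <;> linarith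

theorem IsStaticChart.flowTo (he : IsStaticChart g K id e) {q : ℝ × F} (hq : q ∈ e.target) {r : ℝ}
    (hr : q + (r, 0) ∈ e.target) : FlowTo K r (e.symm q) (e.symm (q + (r, 0))) := by
  obtain ⟨q₀, R, hR⟩ := he.target_ball
  have hmem := fun s => add_mem_ball_iff (hR ▸ hq) s
  have hcurve := he.isMIntegralCurveOn isLocalDiffeomorph_id q
  rw [liftField_id] at hcurve
  have hset : {s : ℝ | q + (s, 0) ∈ e.target} = Ioo (q₀.1 - R - q.1) (q₀.1 + R - q.1) := by
    rw [hR]; exact Set.ext hmem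
  rw [hset] at hcurve
  have hq0 : q + ((0 : ℝ), (0 : F)) = q := add_zero q
  refine ⟨_, _, _, ?_, ?_, hcurve, by rw [hq0], rfl⟩
  · rw [← hset, mem_ofPred_eq, hq0]; exact hq
  · rw [← hset]; exact hr

/-- Static charts turn time translations into isometries. -/
theorem IsStaticChart.geodEqAt_translate [FiniteDimensional ℝ E] [FiniteDimensional ℝ F]
    (he : IsStaticChart g K id e) {γ : ℝ → M} {t : ℝ} (hγ : GeodEqAt g γ t)
    (ht : γ t ∈ e.source) {r : ℝ} (hr : e (γ t) + (r, 0) ∈ e.target) :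
    GeodEqAt g (fun s => e.symm (e (γ s) + (r, 0))) t := by
  refine hγ.map_chart he.smooth ht (ψ := fun q => q + (r, 0)) (contDiff_id.add contDiff_const) hr
    (L := ContinuousLinearMap.id ℝ (ℝ × F)) (fun q => (hasFDerivAt_id q).add_const _)
    Function.surjective_id ?_
  have hc : Continuous fun q : ℝ × F => q + (r, 0) := by fun_prop
  filter_upwards [e.open_target.eventually_mem (e.map_source ht),
    hc.continuousAt.eventually_mem (e.open_target.mem_nhds hr)] with q hq1 hq2 v w
  have h1 := he.param.indep _ hq2 _ hq1 (by simp)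
  exact DFunLike.congr_fun (DFunLike.congr_fun h1 v) w

/-- Static charts turn time reflections into isometries. -/
theorem IsStaticChart.geodEqAt_reflect [FiniteDimensional ℝ E] [FiniteDimensional ℝ F]
    (he : IsStaticChart g K id e) {γ : ℝ → M} {t : ℝ} (hγ : GeodEqAt g γ t)
    (ht : γ t ∈ e.source) {a : ℝ} (ha : (2 * a - (e (γ t)).1, (e (γ t)).2) ∈ e.target) :
    GeodEqAt g (fun s => e.symm (2 * a - (e (γ s)).1, (e (γ s)).2)) t := by
  let L : ℝ × F →L[ℝ] ℝ × F := (-ContinuousLinearMap.fst ℝ ℝ F).prod (ContinuousLinearMap.snd ℝ ℝ F)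
  refine hγ.map_chart he.smooth ht (ψ := fun q => (2 * a - q.1, q.2)) (by fun_prop) ha
    (L := L) (fun q => ?_) (fun q => ⟨(-q.1, q.2), by simp [L]⟩) ?_
  · have h1 : HasFDerivAt (fun q : ℝ × F => 2 * a - q.1) (-ContinuousLinearMap.fst ℝ ℝ F) q :=
      hasFDerivAt_fst.const_sub (2 * a)
    exact h1.prodMk hasFDerivAt_snd
  have hc : Continuous fun q : ℝ × F => (2 * a - q.1, q.2) := by fun_prop
  filter_upwards [e.open_target.eventually_mem (e.map_source ht),
    hc.continuousAt.eventually_mem (e.open_target.mem_nhds ha)] with q hq1 hq2 v w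
  have h1 := he.param.indep _ hq2 _ hq1 rfl
  have h2 : g.paramMetric e.symm (2 * a - q.1, q.2) = g.paramMetric e.symm q := h1
  have h3 := he.param.apply_apply hq1 (L v) (L w)
  have h4 := he.param.apply_apply hq1 v w
  have h5 : L v = (-v.1, v.2) := rfl
  have h6 : L w = (-w.1, w.2) := rfl
  rw [h2]
  refine h3.trans (Eq.trans ?_ h4.symm)
  rw [h5, h6]
  simp

end StaticChart

/-! ### Affine reparametrization of geodesics -/

section Reparametrization

variable {W : Type*} [NormedAddCommGroup W] [NormedSpace ℝ W]

theorem deriv_comp_affine (u : ℝ → W) (a b : ℝ) :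
    deriv (fun s => u (a * s + b)) = fun s => a • deriv u (a * s + b) := by
  funext s
  have h1 := deriv_comp_mul_left a (fun s => u (s + b)) s
  rw [deriv_comp_add_const] at h1
  exact h1

-- The acceleration and the quadratic term in the velocity both scale by `a ^ 2`.
set_option maxSynthPendingDepth 3 in
theorem geodRes_affine (G : W → W →L[ℝ] W →L[ℝ] ℝ) (u : ℝ → W) (a b t : ℝ) (c : W) :
    geodRes G (fun s => u (a * s + b)) t c = a ^ 2 * geodRes G u (a * t + b) c := by
  have h1 : deriv (deriv fun s => u (a * s + b)) t = a • a • deriv (deriv u) (a * t + b) := by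
    rw [deriv_comp_affine]
    have h2 := congrFun (deriv_comp_affine (deriv u) a b) t
    rw [← h2]
    exact deriv_fun_const_smul_field a _
  rw [geodRes, geodRes, h1, deriv_comp_affine]
  simp only [map_smul, smul_apply, smul_eq_mul]
  ring

variable {E : Type*} [NormedAddCommGroup E] [NormedSpace ℝ E]
  {M : Type*} [TopologicalSpace M] [ChartedSpace E M] [IsManifold 𝓘(ℝ, E) ∞ M]
  {g : PseudoRiemannianMetric E M} {γ γ' : ℝ → M} {t : ℝ}

theorem GeodEqAt.comp_affine {a b : ℝ} (h : GeodEqAt g γ (a * t + b)) :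
    GeodEqAt g (fun s => γ (a * s + b)) t := by
  refine ⟨?_, fun x₀ hx c => ?_⟩
  · have h1 : ContDiff ℝ ∞ fun s : ℝ => a * s + b := by fun_prop
    exact ContMDiffAt.comp t (g := γ) (f := fun s => a * s + b) h.1 h1.contDiffAt.contMDiffAt
  · have h1 := geodRes_affine (g.inChart x₀) (fun s => extChartAt 𝓘(ℝ, E) x₀ (γ s)) a b t c
    refine h1.trans ?_
    rw [h.2 x₀ hx c, mul_zero]

theorem GeodEqAt.eventuallyEq_of_deriv_eq [FiniteDimensional ℝ E]
    (hγ : ∀ᶠ s in 𝓝 t, GeodEqAt g γ s)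
    (hγ' : ∀ᶠ s in 𝓝 t, GeodEqAt g γ' s) {e : OpenPartialHomeomorph M W} (he : IsSmoothChart E e)
    (hs : γ t ∈ e.source) (h0 : γ t = γ' t)
    (h1 : deriv (fun s => e (γ s)) t = deriv (fun s => e (γ' s)) t) : γ =ᶠ[𝓝 t] γ' := by
  refine GeodEqAt.eventuallyEq hγ hγ' h0 ?_
  rw [deriv_chart_comp he (hγ.self_of_nhds.1.mdifferentiableAt (by simp)) hs,
    deriv_chart_comp he (hγ'.self_of_nhds.1.mdifferentiableAt (by simp)) (h0 ▸ hs), ← h0] at h1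
  exact (he.chartDEquiv hs).injective h1

end Reparametrization

/-! ### Geodesic completeness implies completeness of the static field -/

section CompleteField

variable {E : Type*} [NormedAddCommGroup E] [NormedSpace ℝ E] [FiniteDimensional ℝ E]
  {F : Type*} [NormedAddCommGroup F] [NormedSpace ℝ F] [FiniteDimensional ℝ F]
  {M : Type*} [TopologicalSpace M] [T2Space M] [ChartedSpace E M] [IsManifold 𝓘(ℝ, E) ∞ M]
  {g : PseudoRiemannianMetric E M} {K : (x : M) → TangentSpace 𝓘(ℝ, E) x}
  {e : OpenPartialHomeomorph M (ℝ × F)}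

omit [T2Space M] [FiniteDimensional ℝ E] [FiniteDimensional ℝ F] [NormedSpace ℝ F]
  [IsManifold 𝓘(ℝ, E) ∞ M] in
theorem exists_ball_translate_mem {γ : ℝ → M} {t : ℝ} (hγ : ContinuousAt γ t)
    (ht : γ t ∈ e.source) : ∃ δ > 0, ∀ s ∈ Metric.ball t δ, ∀ r ∈ Metric.ball (0 : ℝ) δ,
      γ s ∈ e.source ∧ e (γ s) + (r, 0) ∈ e.target := by
  have h1 : ∀ᶠ s in 𝓝 t, γ s ∈ e.source := hγ.eventually_mem (e.open_source.mem_nhds ht)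
  have h2 : ContinuousAt (fun p : ℝ × ℝ => e (γ p.1) + (p.2, (0 : F))) (t, 0) := by
    have h3 : ContinuousAt (fun s => e (γ s)) t := (e.continuousAt ht).comp hγ
    have h4 : ContinuousAt (fun p : ℝ × ℝ => e (γ p.1)) (t, 0) :=
      ContinuousAt.comp (f := Prod.fst) (g := fun s => e (γ s)) (x := ((t, 0) : ℝ × ℝ)) h3
        continuousAt_fst
    exact h4.add (continuousAt_snd.prodMk continuousAt_const)
  have h3 : ∀ᶠ p : ℝ × ℝ in 𝓝 (t, 0), e (γ p.1) + (p.2, (0 : F)) ∈ e.target := by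
    refine h2.eventually_mem (e.open_target.mem_nhds ?_)
    change e (γ t) + 0 ∈ e.target
    rw [add_zero]
    exact e.map_source ht
  obtain ⟨δ, hδ, h⟩ := Metric.eventually_nhds_iff_ball.1
    ((continuousAt_fst.eventually h1).and h3)
  refine ⟨δ, hδ, fun s hs r hr => h (s, r) ?_⟩
  rw [← ball_prod_same]
  exact ⟨hs, hr⟩

/-- The flow of a static field transports geodesics of a complete metric to geodesics. -/
theorem IsStaticChart.exists_geodesic_flowTo (hcomp : g.GeodesicallyComplete)
    (hK : ContMDiff 𝓘(ℝ, E) 𝓘(ℝ, E).tangent 1 (fun x ↦ (⟨x, K x⟩ : TangentBundle 𝓘(ℝ, E) M)))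
    (hcharts : ∀ x, ∃ e : OpenPartialHomeomorph M (ℝ × F), IsStaticChart g K id e ∧ x ∈ e.source)
    (he : IsStaticChart g K id e) {q : ℝ × F} (hq : q ∈ e.target) {τ : ℝ}
    (hτ : q + (τ, 0) ∈ e.target) {ρ : ℝ → M} (hρ : g.IsGeodesic ρ) (hρ0 : ρ 0 = e.symm q) :
    ∃ ρ' : ℝ → M, g.IsGeodesic ρ' ∧ ρ' 0 = e.symm (q + (τ, 0)) ∧
      ∀ s, FlowTo K τ (ρ s) (ρ' s) := by
  have : CompleteSpace E := FiniteDimensional.complete ℝ E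
  have : IsManifold 𝓘(ℝ, E) 1 M := IsManifold.of_le (n := ∞) (by norm_cast)
  have hρ' := isGeodesic_iff_forall_geodEqAt.1 hρ
  have hq0 : q + ((0 : ℝ), (0 : F)) = q := add_zero q
  -- The comparison geodesics `σ r` start at the translates of the initial point, with the
  -- coordinate velocity `V` of `ρ`; they exist on all of `ℝ` by completeness.
  let V : ℝ × F := deriv (fun s => e (ρ s)) 0
  choose σ hσg hσ0 hσ1 using fun r : ℝ =>
    hcomp.exists_geodesic (e.symm (q + (r, 0))) (paramD E e.symm (q + (r, 0)) V)
  have hσ := fun r => isGeodesic_iff_forall_geodEqAt.1 (hσg r)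
  have hmd : ∀ r s, MDifferentiableAt 𝓘(ℝ, ℝ) 𝓘(ℝ, E) (σ r) s := fun r s =>
    (hσ r s).1.mdifferentiableAt (by simp)
  obtain ⟨q₀, R, hR⟩ := he.target_ball
  let J : Set ℝ := Ioo (q₀.1 - R - q.1) (q₀.1 + R - q.1)
  have hJ : ∀ r, q + (r, 0) ∈ e.target ↔ r ∈ J := fun r => by
    rw [hR]; exact add_mem_ball_iff (hR ▸ hq) r
  have hsrc : ∀ r ∈ J, σ r 0 ∈ e.source := fun r hr => by
    rw [hσ0]; exact e.map_target ((hJ r).2 hr)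
  have hpos : ∀ r ∈ J, e (σ r 0) = q + (r, 0) := fun r hr => by
    rw [hσ0]; exact e.right_inv ((hJ r).2 hr)
  have hvel : ∀ r ∈ J, deriv (fun s => e (σ r s)) 0 = V := fun r hr => by
    rw [deriv_chart_comp he.smooth (hmd r 0) (hsrc r hr), hσ1, ← hpos r hr]
    exact he.smooth.chartD_paramD (hsrc r hr) V
  -- Infinitesimal form of the claim; the neighbourhood of `r₀` may depend on `s`. Near `s = 0` it
  -- holds because translation in `e` is an isometry which matches the initial data, and it spreads
  -- to all `s` by connectedness.
  have key : ∀ r₀ ∈ J, ∀ s, ∀ᶠ r in 𝓝 r₀, ∀ᶠ s' in 𝓝 s,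
      FlowTo K (r - r₀) (σ r₀ s') (σ r s') := by
    intro r₀ hr₀ s
    refine isPreconnected_univ.forall_of_eventually_iff (x := (0 : ℝ)) (P := fun s =>
      ∀ᶠ r in 𝓝 r₀, ∀ᶠ s' in 𝓝 s, FlowTo K (r - r₀) (σ r₀ s') (σ r s')) (mem_univ _) ?_ ?_ s
      (mem_univ _)
    · obtain ⟨δ, hδ, h⟩ := exists_ball_translate_mem (hσ r₀ 0).1.continuousAt (hsrc r₀ hr₀)
      filter_upwards [Metric.ball_mem_nhds r₀ hδ, isOpen_Ioo.mem_nhds hr₀] with r hr hrJ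
      have hr' : r - r₀ ∈ Metric.ball (0 : ℝ) δ := by simpa [Real.dist_eq] using hr
      have hball : ∀ᶠ s in 𝓝 (0 : ℝ), s ∈ Metric.ball (0 : ℝ) δ := Metric.ball_mem_nhds 0 hδ
      have h1 : σ r =ᶠ[𝓝 0] fun s => e.symm (e (σ r₀ s) + (r - r₀, 0)) := by
        refine GeodEqAt.eventuallyEq_of_deriv_eq (Eventually.of_forall (hσ r)) ?_ he.smooth
          (hsrc r hrJ) ?_ ?_
        · filter_upwards [hball] with s hs
          exact he.geodEqAt_translate (hσ r₀ s) (h s hs _ hr').1 (h s hs _ hr').2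
        · rw [hpos r₀ hr₀, hσ0, add_assoc]
          congr 2
          simp
        · rw [hvel r hrJ]
          have h2 : (fun s => e (e.symm (e (σ r₀ s) + (r - r₀, 0)))) =ᶠ[𝓝 0]
              fun s => e (σ r₀ s) + (r - r₀, 0) := by
            filter_upwards [hball] with s hs using e.right_inv (h s hs _ hr').2
          rw [h2.deriv_eq, deriv_add_const, hvel r₀ hr₀]
      filter_upwards [h1, hball] with s hs hsb
      rw [hs]
      have h3 := he.flowTo (e.map_source (h s hsb _ hr').1) (h s hsb _ hr').2
      rwa [e.left_inv (h s hsb _ hr').1] at h3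
    · intro y _
      rw [nhdsWithin_univ]
      -- In a static chart at `σ r₀ y` the translate of `σ r₀` by `r - r₀` is a geodesic. If it
      -- agrees with `σ r` near one parameter of the ball, it does so on the whole ball.
      obtain ⟨e', he', hye'⟩ := hcharts (σ r₀ y)
      obtain ⟨δ, hδ, h⟩ := exists_ball_translate_mem (hσ r₀ y).1.continuousAt hye'
      have hprop : ∀ s₁ ∈ Metric.ball y δ, ∀ s₂ ∈ Metric.ball y δ,
          (∀ᶠ r in 𝓝 r₀, ∀ᶠ s' in 𝓝 s₁, FlowTo K (r - r₀) (σ r₀ s') (σ r s')) →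
          ∀ᶠ r in 𝓝 r₀, ∀ᶠ s' in 𝓝 s₂, FlowTo K (r - r₀) (σ r₀ s') (σ r s') := by
        intro s₁ hs₁ s₂ hs₂ hev
        filter_upwards [hev, Metric.ball_mem_nhds r₀ hδ] with r hr1 hr
        have hr' : r - r₀ ∈ Metric.ball (0 : ℝ) δ := by simpa [Real.dist_eq] using hr
        have hfl : ∀ s ∈ Metric.ball y δ,
            FlowTo K (r - r₀) (σ r₀ s) (e'.symm (e' (σ r₀ s) + (r - r₀, 0))) := by
          intro s hs
          have h3 := he'.flowTo (e'.map_source (h s hs _ hr').1) (h s hs _ hr').2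
          rwa [e'.left_inv (h s hs _ hr').1] at h3
        have heq := GeodEqAt.eqOn (γ := σ r) (γ' := fun s => e'.symm (e' (σ r₀ s) + (r - r₀, 0)))
          Metric.isOpen_ball (convex_ball y δ).isPreconnected (fun s _ => hσ r s)
          (fun s hs => he'.geodEqAt_translate (hσ r₀ s) (h s hs _ hr').1 (h s hs _ hr').2) hs₁ (by
            filter_upwards [hr1, Metric.isOpen_ball.mem_nhds hs₁] with s h1 h2
            exact FlowTo.eq hK h1 (hfl s h2))
        filter_upwards [Metric.isOpen_ball.mem_nhds hs₂] with s hs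
        rw [heq hs]
        exact hfl s hs
      filter_upwards [Metric.ball_mem_nhds y hδ] with z hz
      exact ⟨hprop z hz y (Metric.mem_ball_self hδ), hprop y (Metric.mem_ball_self hδ) z hz⟩
  have h0J : (0 : ℝ) ∈ J := (hJ 0).1 (by rw [hq0]; exact hq)
  have hρσ : ∀ s, ρ s = σ 0 s := by
    have h1 : ρ =ᶠ[𝓝 0] σ 0 := by
      refine GeodEqAt.eventuallyEq_of_deriv_eq (Eventually.of_forall hρ')
        (Eventually.of_forall (hσ 0)) he.smooth ?_ ?_ (hvel 0 h0J).symm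
      · rw [hρ0]; exact e.map_target hq
      · rw [hρ0, hσ0, hq0]
    exact fun s => GeodEqAt.eqOn isOpen_univ isPreconnected_univ (fun s _ => hρ' s)
      (fun s _ => hσ 0 s) (mem_univ _) h1 (mem_univ s)
  refine ⟨σ τ, hσg τ, hσ0 τ, fun s => ?_⟩
  rw [hρσ s]
  -- With `s` fixed, the small steps in `r` are composed along the interval `J`.
  refine isPreconnected_Ioo.forall_of_eventually_iff h0J
    (P := fun r => FlowTo K r (σ 0 s) (σ r s)) ?_ (fun r₀ hr₀ => ?_) τ ((hJ τ).1 hτ)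
  · have := (key 0 h0J s).self_of_nhds.self_of_nhds
    rwa [sub_zero] at this
  · filter_upwards [nhdsWithin_le_nhds (key r₀ hr₀ s)] with r hr
    have h1 := hr.self_of_nhds
    constructor
    · intro h
      have h2 := h.trans hK h1.symm
      rwa [show r + -(r - r₀) = r₀ by ring] at h2
    · intro h
      have h2 := h.trans hK h1
      rwa [show r₀ + (r - r₀) = r by ring] at h2

/-- The maximal integral curve of a static field through a point of a geodesic is defined at all
times at which the maximal integral curve through the initial point is. -/
theorem FlowTo.exists_geodesic (hcomp : g.GeodesicallyComplete)
    (hK : ContMDiff 𝓘(ℝ, E) 𝓘(ℝ, E).tangent 1 (fun x ↦ (⟨x, K x⟩ : TangentBundle 𝓘(ℝ, E) M)))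
    (hcharts : ∀ x, ∃ e : OpenPartialHomeomorph M (ℝ × F), IsStaticChart g K id e ∧ x ∈ e.source)
    {ρ : ℝ → M} (hρ : g.IsGeodesic ρ) {r : ℝ} {y : M} (h : FlowTo K r (ρ 0) y) (s : ℝ) :
    ∃ z, FlowTo K r (ρ s) z := by
  have : CompleteSpace E := FiniteDimensional.complete ℝ E
  have : IsManifold 𝓘(ℝ, E) 1 M := IsManifold.of_le (n := ∞) (by norm_cast)
  obtain ⟨c, a, b, h0, hr, hc, hc0, -⟩ := h
  suffices hP : ∀ r ∈ Ioo a b, ∃ ρ' : ℝ → M, g.IsGeodesic ρ' ∧ ρ' 0 = c r ∧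
      ∀ s, FlowTo K r (ρ s) (ρ' s) by
    obtain ⟨ρ', -, -, h1⟩ := hP r hr
    exact ⟨_, h1 s⟩
  -- The geodesic is transported along the integral curve `c` through its initial point, from one
  -- static chart to the next. The transported geodesic is always defined on `ℝ`, so all its points
  -- are reached at the same time `r`.
  refine isPreconnected_Ioo.forall_of_eventually_iff h0 (P := fun r => ∃ ρ' : ℝ → M,
    g.IsGeodesic ρ' ∧ ρ' 0 = c r ∧ ∀ s, FlowTo K r (ρ s) (ρ' s)) ?_ fun r₀ hr₀ => ?_
  · obtain ⟨e, he, hxe⟩ := hcharts (ρ 0)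
    obtain ⟨ρ', h1, h2, h3⟩ := he.exists_geodesic_flowTo hcomp hK hcharts (e.map_source hxe)
      (τ := 0) (by
        change e (ρ 0) + 0 ∈ e.target
        rw [add_zero]; exact e.map_source hxe) hρ (e.left_inv hxe).symm
    refine ⟨ρ', h1, ?_, h3⟩
    rw [h2, hc0]
    change e.symm (e (ρ 0) + 0) = _
    rw [add_zero, e.left_inv hxe]
  · obtain ⟨e, he, hxe⟩ := hcharts (c r₀)
    obtain ⟨δ, hδ, hball⟩ := exists_ball_translate_mem (γ := fun _ : ℝ => c r₀) (t := 0)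
      continuousAt_const hxe
    have hflow : ∀ r ∈ Ioo a b, r - r₀ ∈ Metric.ball (0 : ℝ) δ →
        c r = e.symm (e (c r₀) + (r - r₀, 0)) := by
      intro r hrab hrδ
      have h1 := he.flowTo (e.map_source hxe) (hball 0 (Metric.mem_ball_self hδ) _ hrδ).2
      rw [e.left_inv hxe] at h1
      refine FlowTo.eq hK (r := r - r₀) (x := c r₀) ⟨c ∘ (· + r₀), a - r₀, b - r₀, ?_, ?_,
        (hc.comp_add r₀).mono fun t ht => ⟨by linarith [ht.1], by linarith [ht.2]⟩, ?_, ?_⟩ h1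
      · exact ⟨by linarith [hr₀.1], by linarith [hr₀.2]⟩
      · exact ⟨by linarith [hrab.1], by linarith [hrab.2]⟩
      · simp
      · simp
    filter_upwards [self_mem_nhdsWithin, nhdsWithin_le_nhds (Metric.ball_mem_nhds r₀ hδ)]
      with r hrab hrδ
    have hr' : r - r₀ ∈ Metric.ball (0 : ℝ) δ := by simpa [Real.dist_eq] using hrδ
    have hq := (hball 0 (Metric.mem_ball_self hδ) _ hr').2
    have hcr := hflow r hrab hr'
    have hsub : e (c r₀) + (r - r₀, (0 : F)) + (r₀ - r, 0) = e (c r₀) := by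
      rw [add_assoc]
      have : ((r - r₀, 0) + (r₀ - r, 0) : ℝ × F) = 0 := by simp
      rw [this, add_zero]
    constructor
    · rintro ⟨ρ', h1, h2, h3⟩
      obtain ⟨ρ'', h4, h5, h6⟩ := he.exists_geodesic_flowTo hcomp hK hcharts hq (τ := r₀ - r)
        (by rw [hsub]; exact e.map_source hxe) h1 (h2.trans hcr)
      refine ⟨ρ'', h4, ?_, fun s => ?_⟩
      · rw [h5, hsub, e.left_inv hxe]
      · have := (h3 s).trans hK (h6 s)
        rwa [add_sub_cancel] at this
    · rintro ⟨ρ', h1, h2, h3⟩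
      obtain ⟨ρ'', h4, h5, h6⟩ := he.exists_geodesic_flowTo hcomp hK hcharts (e.map_source hxe)
        (τ := r - r₀) hq h1 (h2.trans (e.left_inv hxe).symm)
      refine ⟨ρ'', h4, h5.trans hcr.symm, fun s => ?_⟩
      have := (h3 s).trans hK (h6 s)
      rwa [add_sub_cancel] at this

/-- A vector field which is `∂_t` in static charts is complete if the metric is geodesically
complete. -/
theorem isCompleteField_of_geodesicallyComplete (hcomp : g.GeodesicallyComplete)
    (hK : ContMDiff 𝓘(ℝ, E) 𝓘(ℝ, E).tangent 1 (fun x ↦ (⟨x, K x⟩ : TangentBundle 𝓘(ℝ, E) M)))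
    (hcharts : ∀ x, ∃ e : OpenPartialHomeomorph M (ℝ × F), IsStaticChart g K id e ∧ x ∈ e.source) :
    IsCompleteField K := by
  have : CompleteSpace E := FiniteDimensional.complete ℝ E
  have : IsManifold 𝓘(ℝ, E) 1 M := IsManifold.of_le (n := ∞) (by norm_cast)
  refine isCompleteField_of_flowTo hK fun p => ?_
  obtain ⟨e, he, hpe⟩ := hcharts p
  obtain ⟨σ, hσg, hσ0, hσ1⟩ := hcomp.exists_geodesic p (K p)
  have hσ := isGeodesic_iff_forall_geodEqAt.1 hσg
  have hσe : σ 0 ∈ e.source := hσ0 ▸ hpe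
  -- the geodesic is symmetric with respect to the reflection of the static chart
  have hd : deriv (fun s => e (σ s)) 0 = (1, 0) := by
    rw [deriv_chart_comp he.smooth ((hσ 0).1.mdifferentiableAt (by simp)) hσe, hσ1, hσ0]
    have h1 := he.param.field _ (e.map_source hpe)
    have h2 : paramD E e.symm (e p) (1, 0) = K (e.symm (e p)) := h1
    rw [e.left_inv hpe] at h2
    rw [← h2]
    exact he.smooth.chartD_paramD hpe (1, 0)
  have hed : HasDerivAt (fun s => e (σ s)) (1, 0) 0 := by
    rw [← hd]
    exact ((contDiffAt_chart_comp he.smooth (hσ 0).1 hσe).differentiableAt (by simp)).hasDerivAt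
  have hed1 : HasDerivAt (fun s => (e (σ s)).1) 1 0 :=
    (ContinuousLinearMap.fst ℝ ℝ F).hasFDerivAt.comp_hasDerivAt (0 : ℝ) hed
  have hed2 : HasDerivAt (fun s => (e (σ s)).2) 0 0 :=
    (ContinuousLinearMap.snd ℝ ℝ F).hasFDerivAt.comp_hasDerivAt (0 : ℝ) hed
  let a : ℝ := (e p).1
  have hrefl0 : (2 * a - (e (σ 0)).1, (e (σ 0)).2) = e p := by
    rw [hσ0]
    ext
    · simp only [a]; ring
    · rfl
  have hcont : ContinuousAt (fun s => (2 * a - (e (σ s)).1, (e (σ s)).2)) 0 := by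
    have h1 : ContinuousAt (fun s => e (σ s)) 0 := hed.continuousAt
    exact (continuousAt_const.sub (continuousAt_fst.comp h1)).prodMk (continuousAt_snd.comp h1)
  have hev1 : ∀ᶠ s in 𝓝 (0 : ℝ), σ s ∈ e.source :=
    (hσ 0).1.continuousAt.eventually_mem (e.open_source.mem_nhds hσe)
  have hev2 : ∀ᶠ s in 𝓝 (0 : ℝ), (2 * a - (e (σ s)).1, (e (σ s)).2) ∈ e.target := by
    refine hcont.eventually_mem (e.open_target.mem_nhds ?_)
    rw [hrefl0]; exact e.map_source hpe
  have hneg : ∀ s, GeodEqAt g (fun s => σ (-1 * s + 0)) s := fun s => (hσ _).comp_affine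
  have hsym : (fun s => σ (-1 * s + 0)) =ᶠ[𝓝 0]
      fun s => e.symm (2 * a - (e (σ s)).1, (e (σ s)).2) := by
    refine GeodEqAt.eventuallyEq_of_deriv_eq (Eventually.of_forall hneg) ?_ he.smooth ?_ ?_ ?_
    · filter_upwards [hev1, hev2] with s hs1 hs2
      exact he.geodEqAt_reflect (hσ s) hs1 hs2
    · simpa using hσe
    · rw [hrefl0, e.left_inv hpe]
      simpa using hσ0
    · have h1 := congrFun (deriv_comp_affine (fun s => e (σ s)) (-1) 0) 0
      have h2 : (fun s => e (e.symm (2 * a - (e (σ s)).1, (e (σ s)).2))) =ᶠ[𝓝 0]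
          fun s => (2 * a - (e (σ s)).1, (e (σ s)).2) := by
        filter_upwards [hev2] with s hs using e.right_inv hs
      rw [h1, h2.deriv_eq]
      have h3 : HasDerivAt (fun s => (2 * a - (e (σ s)).1, (e (σ s)).2)) (-1, 0) 0 :=
        (hed1.const_sub (2 * a)).prodMk hed2
      rw [h3.deriv]
      simp [hd]
  -- The time coordinate of `σ` has derivative `1` at `0`, so it cannot remain equal to `a`.
  have hne : ∃ s, σ s ∈ e.source ∧ (2 * a - (e (σ s)).1, (e (σ s)).2) ∈ e.target ∧
      σ (-s) = e.symm (2 * a - (e (σ s)).1, (e (σ s)).2) ∧ (e (σ s)).1 ≠ a := by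
    by_contra hcon
    push Not at hcon
    have h1 : (fun s => (e (σ s)).1) =ᶠ[𝓝 0] fun _ => a := by
      filter_upwards [hev1, hev2, hsym] with s h2 h3 h4
      refine hcon s h2 h3 ?_
      rw [← h4]
      simp
    have h2 := h1.deriv_eq
    rw [hed1.deriv, deriv_const] at h2
    exact one_ne_zero h2
  obtain ⟨s₀, hs1, hs2, hs3, hs4⟩ := hne
  -- `σ (-s₀)` and `σ s₀` are mirror images about the level `a`; they lie on one time line at
  -- distance `T`.
  set T : ℝ := 2 * ((e (σ s₀)).1 - a) with hT
  have hT0 : T ≠ 0 := mul_ne_zero two_ne_zero (sub_ne_zero.2 hs4)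
  have hflow : FlowTo K T (σ (-s₀)) (σ s₀) := by
    have h1 : (2 * a - (e (σ s₀)).1, (e (σ s₀)).2) + (T, (0 : F)) = e (σ s₀) := by
      ext
      · simp only [Prod.fst_add, hT]; ring
      · simp
    have h2 := he.flowTo hs2 (r := T) (by rw [h1]; exact e.map_source hs1)
    rwa [h1, e.left_inv hs1, ← hs3] at h2
  -- After a shift of the parameter of `σ`, any of its points can play the role of the initial
  -- point.
  have hshift : ∀ b s : ℝ, ∀ {r y}, FlowTo K r (σ b) y → ∃ z, FlowTo K r (σ s) z := by
    intro b s r y h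
    have h1 : g.IsGeodesic fun s => σ (1 * s + b) :=
      isGeodesic_iff_forall_geodEqAt.2 fun t => (hσ _).comp_affine
    obtain ⟨z, hz⟩ := FlowTo.exists_geodesic hcomp hK hcharts h1 (r := r) (y := y)
      (by simpa using h) (s - b)
    exact ⟨z, by simpa using hz⟩
  -- A time `r` available at `p` is available at `σ s₀`, so `T + r` is available at `σ (-s₀)`, and
  -- hence at `p`. Exchanging the two points gives `r - T`.
  have hstep : ∀ {r y}, FlowTo K r p y →
      (∃ z, FlowTo K (r + T) p z) ∧ ∃ z, FlowTo K (r - T) p z := by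
    intro r y h
    rw [← hσ0] at h ⊢
    constructor
    · obtain ⟨z, hz⟩ := hshift 0 s₀ h
      have h1 := hflow.trans hK hz
      rw [add_comm] at h1
      exact hshift _ 0 h1
    · obtain ⟨z, hz⟩ := hshift 0 (-s₀) h
      have h1 := hflow.symm.trans hK hz
      rw [neg_add_eq_sub] at h1
      exact hshift _ 0 h1
  have h0 : ∃ y, FlowTo K 0 p y := by
    have h1 := he.flowTo (e.map_source hpe) (r := 0) (by
      change e p + 0 ∈ e.target
      rw [add_zero]; exact e.map_source hpe)
    rw [e.left_inv hpe] at h1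
    exact ⟨_, h1⟩
  have hnat : ∀ n : ℕ, (∃ y, FlowTo K (n * T) p y) ∧ ∃ y, FlowTo K (-(n * T)) p y := by
    intro n
    induction n with
    | zero => simpa using h0
    | succ n ih =>
      obtain ⟨⟨y, hy⟩, z, hz⟩ := ih
      constructor
      · obtain ⟨y', hy'⟩ := (hstep hy).1
        exact ⟨y', by rwa [show ((n + 1 : ℕ) : ℝ) * T = n * T + T by push_cast; ring]⟩
      · obtain ⟨y', hy'⟩ := (hstep hz).2
        exact ⟨y', by rwa [show -(((n + 1 : ℕ) : ℝ) * T) = -(n * T) - T by push_cast; ring]⟩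
  intro r
  -- Multiples of `T` exhaust both directions, and the domain of an integral curve is an interval.
  obtain ⟨n, hn⟩ := exists_nat_ge (|r| / |T|)
  have hn' : |r| ≤ |n * T| := by
    rw [abs_mul, Nat.abs_cast]
    exact (div_le_iff₀ (abs_pos.2 hT0)).1 hn
  have hcase : r ∈ uIcc 0 (n * T) ∨ r ∈ uIcc 0 (-(n * T)) := by
    rw [mem_uIcc, mem_uIcc]
    rcases abs_cases r with ⟨h1, h2⟩ | ⟨h1, h2⟩ <;>
      rcases abs_cases ((n : ℝ) * T) with ⟨h3, h4⟩ | ⟨h3, h4⟩ <;> rw [h1, h3] at hn'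
    · exact Or.inl (Or.inl ⟨h2, hn'⟩)
    · exact Or.inr (Or.inl ⟨h2, hn'⟩)
    · exact Or.inr (Or.inr ⟨by linarith, by linarith⟩)
    · exact Or.inl (Or.inr ⟨by linarith, by linarith⟩)
  rcases hcase with h | h
  · obtain ⟨y, hy⟩ := (hnat n).1
    exact hy.exists_of_mem_uIcc h
  · obtain ⟨y, hy⟩ := (hnat n).2
    exact hy.exists_of_mem_uIcc h

end CompleteField

/-! ### Conserved momentum of geodesics -/

section Conservation

variable {W : Type*} [NormedAddCommGroup W] [NormedSpace ℝ W]

set_option maxSynthPendingDepth 3 in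
/-- A translation-invariant direction gives a conserved momentum of geodesics. -/
theorem hasDerivAt_momentum {G : W → W →L[ℝ] W →L[ℝ] ℝ} {u : ℝ → W} {t : ℝ}
    (hG : DifferentiableAt ℝ G (u t)) (hu : ContDiffAt ℝ ∞ u t) {c : W}
    (hc : ∀ v w, fderiv ℝ G (u t) c v w = 0) :
    HasDerivAt (fun s => G (u s) (deriv u s) c) (geodRes G u t c) t := by
  have hud := (hu.differentiableAt (by simp)).hasDerivAt
  have hu1 : ContDiffAt ℝ ∞ (deriv u) t := by
    have h1 : ContDiffAt ℝ ∞ (fderiv ℝ u) t := hu.fderiv_right (by norm_cast)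
    exact h1.clm_apply contDiffAt_const
  have hu1d := (hu1.differentiableAt (by simp)).hasDerivAt
  have h1 : HasDerivAt (fun s => G (u s)) (fderiv ℝ G (u t) (deriv u t)) t :=
    hG.hasFDerivAt.comp_hasDerivAt t hud
  have h2 := (h1.clm_apply hu1d).clm_apply (hasDerivAt_const t c)
  refine h2.congr_deriv ?_
  simp only [geodRes, hc, add_apply, map_zero, add_zero]
  ring

end Conservation

/-! ### Completeness of the base of a static splitting -/

section Splitting

variable {E : Type*} [NormedAddCommGroup E] [NormedSpace ℝ E]
  {F : Type*} [NormedAddCommGroup F] [NormedSpace ℝ F]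
  {M : Type*} [TopologicalSpace M] [ChartedSpace E M] [IsManifold 𝓘(ℝ, E) ∞ M]
  {N : Type*} [TopologicalSpace N] [ChartedSpace E N]
  {S : Type*} [TopologicalSpace S] [ChartedSpace F S] [IsManifold 𝓘(ℝ, F) ∞ S]
  {g : PseudoRiemannianMetric E M} {K : (x : M) → TangentSpace 𝓘(ℝ, E) x} {proj : N → M}
  {gS : PseudoRiemannianMetric F S} {β : S → ℝ}
  {Φ : Diffeomorph 𝓘(ℝ, E) (𝓘(ℝ, ℝ).prod 𝓘(ℝ, F)) N (ℝ × S) ∞}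

-- By continuity the lift is locally the composite of its projection with a smooth local inverse of
-- `proj`.
omit [IsManifold 𝓘(ℝ, E) ∞ M] in
theorem contMDiff_of_contMDiff_proj_comp (hproj : IsLocalDiffeomorph 𝓘(ℝ, E) 𝓘(ℝ, E) ∞ proj)
    {c : ℝ → N} (hc : Continuous c) (h : ContMDiff 𝓘(ℝ, ℝ) 𝓘(ℝ, E) ∞ (proj ∘ c)) :
    ContMDiff 𝓘(ℝ, ℝ) 𝓘(ℝ, E) ∞ c := by
  intro r
  obtain ⟨Ψ, hrΨ, hΨ⟩ := hproj (c r)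
  have hmem : (proj ∘ c) r ∈ Ψ.target := by
    change proj (c r) ∈ Ψ.target
    rw [hΨ hrΨ]
    exact Ψ.map_source' hrΨ
  have h2 := (Ψ.contMDiffOn_invFun.contMDiffAt (Ψ.open_target.mem_nhds hmem)).comp r (h r)
  refine h2.congr_of_eventuallyEq ?_
  filter_upwards [hc.continuousAt.eventually_mem (Ψ.open_source.mem_nhds hrΨ)] with s hs
  change c s = Ψ.invFun (proj (c s))
  rw [hΨ hs]
  exact (Ψ.left_inv' hs).symm

/-- The parametrization of `N` by `ℝ` times a chart of the base of a splitting. -/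
def splitParam (Φ : Diffeomorph 𝓘(ℝ, E) (𝓘(ℝ, ℝ).prod 𝓘(ℝ, F)) N (ℝ × S) ∞) (y : S)
    (q : ℝ × F) : N :=
  Φ.symm (q.1, (chartAt F y).symm q.2)

theorem contMDiffOn_chart_prod (y : S) :
    ContMDiffOn 𝓘(ℝ, ℝ × F) (𝓘(ℝ, ℝ).prod 𝓘(ℝ, F)) ∞
      (fun q : ℝ × F => (q.1, (chartAt F y).symm q.2)) (univ ×ˢ (chartAt F y).target) := by
  have h1 : ContMDiffOn 𝓘(ℝ, ℝ × F) 𝓘(ℝ, ℝ) ∞ (fun q : ℝ × F => q.1)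
      (univ ×ˢ (chartAt F y).target) := contDiff_fst.contMDiff.contMDiffOn
  have h2 : ContMDiffOn 𝓘(ℝ, ℝ × F) 𝓘(ℝ, F) ∞ (fun q : ℝ × F => q.2)
      (univ ×ˢ (chartAt F y).target) := contDiff_snd.contMDiff.contMDiffOn
  exact h1.prodMk ((isSmoothChart_chartAt (E := F) y).contMDiffOn_symm.comp h2 fun q hq => hq.2)

theorem contMDiffOn_splitParam (y : S) :
    ContMDiffOn 𝓘(ℝ, ℝ × F) 𝓘(ℝ, E) ∞ (splitParam Φ y) (univ ×ˢ (chartAt F y).target) :=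
  Φ.symm.contMDiff.comp_contMDiffOn (contMDiffOn_chart_prod y)

/-- The components of the metric in a product chart of a static splitting. -/
theorem IsStaticSplitting.paramMetric_eq (hs : IsStaticSplitting g K proj gS β Φ)
    (hproj : IsLocalDiffeomorph 𝓘(ℝ, E) 𝓘(ℝ, E) ∞ proj) (y : S) {q : ℝ × F}
    (hq : q.2 ∈ (chartAt F y).target) (v w : ℝ × F) :
    g.paramMetric (fun q => proj (splitParam Φ y q)) q v w =
      -β ((chartAt F y).symm q.2) * (v.1 * w.1) + gS.inChart y q.2 v.2 w.2 := by
  have hU : IsOpen ((univ : Set ℝ) ×ˢ (chartAt F y).target) :=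
    isOpen_univ.prod (chartAt F y).open_target
  have hqU : q ∈ (univ : Set ℝ) ×ˢ (chartAt F y).target := ⟨mem_univ _, hq⟩
  have hmd : MDifferentiableAt 𝓘(ℝ, ℝ × F) 𝓘(ℝ, E) (splitParam Φ y) q :=
    ((contMDiffOn_splitParam y).contMDiffAt (hU.mem_nhds hqU)).mdifferentiableAt (by simp)
  have hmd' : MDifferentiableAt 𝓘(ℝ, ℝ × F) (𝓘(ℝ, ℝ).prod 𝓘(ℝ, F))
      (fun q : ℝ × F => (q.1, (chartAt F y).symm q.2)) q :=
    ((contMDiffOn_chart_prod y).contMDiffAt (hU.mem_nhds hqU)).mdifferentiableAt (by simp)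
  have hΦ := (Φ.contMDiff (splitParam Φ y q)).mdifferentiableAt (by simp)
  have hΦq : Φ (splitParam Φ y q) = (q.1, (chartAt F y).symm q.2) := Φ.apply_symm_apply _
  have hfun : Φ ∘ splitParam Φ y = fun q : ℝ × F => (q.1, (chartAt F y).symm q.2) :=
    funext fun q => Φ.apply_symm_apply _
  have h1 : ∀ v : ℝ × F, mfderiv (𝓘(ℝ, ℝ).prod 𝓘(ℝ, F)) 𝓘(ℝ, ℝ) (Prod.fst : ℝ × S → ℝ)
      (Φ (splitParam Φ y q)) (mfderiv 𝓘(ℝ, E) (𝓘(ℝ, ℝ).prod 𝓘(ℝ, F)) Φ (splitParam Φ y q)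
        (paramD E (splitParam Φ y) q v)) = v.1 := by
    intro v
    have h2 := mfderiv_comp q hΦ hmd
    have h3 := mfderiv_comp q (g := (Prod.fst : ℝ × S → ℝ)) (f := Φ ∘ splitParam Φ y)
      mdifferentiableAt_fst (hΦ.comp q hmd)
    have h4 : (Prod.fst : ℝ × S → ℝ) ∘ (Φ ∘ splitParam Φ y) = Prod.fst := by rw [hfun]; rfl
    rw [h4, h2, mfderiv_eq_fderiv, fderiv_fst] at h3
    exact (DFunLike.congr_fun h3 v).symm
  have h5 : ∀ v : ℝ × F, mfderiv (𝓘(ℝ, ℝ).prod 𝓘(ℝ, F)) 𝓘(ℝ, F) (Prod.snd : ℝ × S → S)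
      (Φ (splitParam Φ y q)) (mfderiv 𝓘(ℝ, E) (𝓘(ℝ, ℝ).prod 𝓘(ℝ, F)) Φ (splitParam Φ y q)
        (paramD E (splitParam Φ y) q v)) = paramD F (chartAt F y).symm q.2 v.2 := by
    intro v
    have h2 := mfderiv_comp q hΦ hmd
    have h3 := mfderiv_comp q (g := (Prod.snd : ℝ × S → S)) (f := Φ ∘ splitParam Φ y)
      mdifferentiableAt_snd (hΦ.comp q hmd)
    have h4 : (Prod.snd : ℝ × S → S) ∘ (Φ ∘ splitParam Φ y) =
        fun q => (chartAt F y).symm q.2 := by rw [hfun]; rfl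
    have h6 := paramD_comp (E := F) (h := (chartAt F y).symm) (ψ := (Prod.snd : ℝ × F → F))
      (q := q) ((isSmoothChart_chartAt (E := F) y).mdifferentiableAt_symm hq) differentiableAt_snd
    rw [fderiv_snd] at h6
    rw [h4, h2] at h3
    exact (DFunLike.congr_fun h3 v).symm.trans (DFunLike.congr_fun h6 v)
  have h7 := hs.isometry (splitParam Φ y q) (paramD E (splitParam Φ y) q v)
    (paramD E (splitParam Φ y) q w)
  have h8 : g.paramMetric (fun q => proj (splitParam Φ y q)) q v w = g.pullback proj
      (splitParam Φ y q) (paramD E (splitParam Φ y) q v) (paramD E (splitParam Φ y) q w) := by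
    rw [paramMetric_apply, paramD_proj_comp hproj hmd]
    rfl
  refine h8.trans (h7.symm.trans ?_)
  unfold standardStaticMetric
  refine congrArg₂ (· + ·) ?_ ?_
  · refine (congrArg₂ (fun a b : ℝ => -β (Φ (splitParam Φ y q)).2 * (a * b)) (h1 v) (h1 w)).trans ?_
    rw [hΦq]
  · refine (congrArg₂ (fun a b => gS.form (Φ (splitParam Φ y q)).2 a b) (h5 v) (h5 w)).trans ?_
    rw [hΦq]
    rfl

/-- The base of a static splitting of a geodesically complete manifold is complete. -/
theorem IsStaticSplitting.geodesicallyComplete [FiniteDimensional ℝ E] [FiniteDimensional ℝ F]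
    (hs : IsStaticSplitting g K proj gS β Φ)
    (hproj : IsLocalDiffeomorph 𝓘(ℝ, E) 𝓘(ℝ, E) ∞ proj) (hcov : IsCoveringMap proj)
    (hg : g.GeodesicallyComplete) : gS.GeodesicallyComplete := by
  rintro ⟨y₀, v⟩
  let vF : F := v
  let p : N := Φ.symm (0, y₀)
  -- The initial velocity has no time component: it is tangent to the slice through `p`.
  let V : E := mfderiv (𝓘(ℝ, ℝ).prod 𝓘(ℝ, F)) 𝓘(ℝ, E) Φ.symm (0, y₀) ((0, vF) : ℝ × F)
  obtain ⟨γ, hγg, hγ0, hγ1⟩ := hg.exists_geodesic (proj p) (mapD E proj p V)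
  have hγ := isGeodesic_iff_forall_geodEqAt.1 hγg
  obtain ⟨c, ⟨hc0, hc⟩, -⟩ :=
    hcov.existsUnique_continuousMap_lifts ⟨γ, hγg.1.continuous⟩ 0 p hγ0.symm
  replace hc : proj ∘ c = γ := hc
  have hcs : ContMDiff 𝓘(ℝ, ℝ) 𝓘(ℝ, E) ∞ c :=
    contMDiff_of_contMDiff_proj_comp hproj c.continuous (by rw [hc]; exact hγg.1)
  let τ : ℝ → ℝ := fun s => (Φ (c s)).1
  let x : ℝ → S := fun s => (Φ (c s)).2
  have hΦc : ContMDiff 𝓘(ℝ, ℝ) (𝓘(ℝ, ℝ).prod 𝓘(ℝ, F)) ∞ fun s => Φ (c s) := Φ.contMDiff.comp hcs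
  have hτ : ContDiff ℝ ∞ τ := (contMDiff_fst.comp hΦc).contDiff
  have hx : ContMDiff 𝓘(ℝ, ℝ) 𝓘(ℝ, F) ∞ x := contMDiff_snd.comp hΦc
  -- the initial velocities
  have hV : paramD E c 0 1 = V := by
    apply mapD_injective hproj (c 0)
    have h1 := mfderiv_comp (0 : ℝ) ((hproj.contMDiff (c 0)).mdifferentiableAt (by simp))
      ((hcs 0).mdifferentiableAt (by simp))
    have h2 : paramD E (proj ∘ c) 0 1 = mapD E proj (c 0) (paramD E c 0 1) :=
      DFunLike.congr_fun h1 (1 : ℝ)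
    rw [← h2, hc, hγ1, hc0]
  have hvel : mfderiv 𝓘(ℝ, ℝ) (𝓘(ℝ, ℝ).prod 𝓘(ℝ, F)) (fun s => Φ (c s)) 0 (1 : ℝ) =
      ((0, vF) : ℝ × F) := by
    have h1 := mfderiv_comp (0 : ℝ) (g := Φ) (f := c) ((Φ.contMDiff _).mdifferentiableAt (by simp))
      ((hcs 0).mdifferentiableAt (by simp))
    have h2 := mfderiv_comp ((0, y₀) : ℝ × S) (g := Φ) (f := Φ.symm)
      ((Φ.contMDiff _).mdifferentiableAt (by simp))
      ((Φ.symm.contMDiff _).mdifferentiableAt (by simp))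
    have h3 : Φ ∘ Φ.symm = id := funext fun q => Φ.apply_symm_apply q
    rw [h3, mfderiv_id] at h2
    let D : N → E →L[ℝ] ℝ × F := fun p => mfderiv 𝓘(ℝ, E) (𝓘(ℝ, ℝ).prod 𝓘(ℝ, F)) Φ p
    have h4 : D p V = (0, vF) := (DFunLike.congr_fun h2 ((0, vF) : ℝ × F)).symm
    refine (DFunLike.congr_fun h1 (1 : ℝ)).trans ?_
    change D (c 0) (paramD E c 0 1) = _
    rw [hV, hc0, h4]
  have hτ0 : deriv τ 0 = 0 := by
    have h1 := mfderiv_comp (0 : ℝ) (g := (Prod.fst : ℝ × S → ℝ)) (f := fun s => Φ (c s))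
      mdifferentiableAt_fst ((hΦc 0).mdifferentiableAt (by simp))
    rw [mfderiv_fst] at h1
    have h2 : mfderiv 𝓘(ℝ, ℝ) 𝓘(ℝ, ℝ) τ 0 (1 : ℝ) = (((0, vF) : ℝ × F)).1 :=
      (DFunLike.congr_fun h1 (1 : ℝ)).trans (congrArg (fun z : ℝ × F => z.1) hvel)
    rw [mfderiv_eq_fderiv] at h2
    exact h2
  have hx0 : paramD F x 0 1 = vF := by
    have h1 := mfderiv_comp (0 : ℝ) (g := (Prod.snd : ℝ × S → S)) (f := fun s => Φ (c s))
      mdifferentiableAt_snd ((hΦc 0).mdifferentiableAt (by simp))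
    rw [mfderiv_snd] at h1
    exact (DFunLike.congr_fun h1 (1 : ℝ)).trans (congrArg (fun z : ℝ × F => z.2) hvel)
  -- the geodesic equation in product charts
  let h : S → ℝ × F → M := fun y q => proj (splitParam Φ y q)
  let G : S → ℝ × F → ℝ × F →L[ℝ] ℝ × F →L[ℝ] ℝ := fun y => g.paramMetric (h y)
  let w : S → ℝ → ℝ × F := fun y s => (τ s, chartAt F y (x s))
  have hU : ∀ y : S, IsOpen ((univ : Set ℝ) ×ˢ (chartAt F y).target) := fun y =>
    isOpen_univ.prod (chartAt F y).open_target
  have hh : ∀ y, ContMDiffOn 𝓘(ℝ, ℝ × F) 𝓘(ℝ, E) ∞ (h y) (univ ×ˢ (chartAt F y).target) :=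
    fun y => hproj.contMDiff.comp_contMDiffOn (contMDiffOn_splitParam y)
  have hwU : ∀ y s, x s ∈ (chartAt F y).source → w y s ∈ univ ×ˢ (chartAt F y).target :=
    fun y s hy => ⟨mem_univ _, (chartAt F y).map_source hy⟩
  have hw2 : ∀ y s, x s ∈ (chartAt F y).source →
      ContDiffAt ℝ ∞ (fun s => chartAt F y (x s)) s := fun y s hy =>
    contDiffAt_chart_comp (isSmoothChart_chartAt (E := F) y) (hx s) hy
  have hw : ∀ y s, x s ∈ (chartAt F y).source → ContDiffAt ℝ ∞ (w y) s := fun y s hy =>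
    hτ.contDiffAt.prodMk (hw2 y s hy)
  have hsrc : ∀ y s, x s ∈ (chartAt F y).source → ∀ᶠ s' in 𝓝 s, x s' ∈ (chartAt F y).source :=
    fun y s hy => (hx s).continuousAt.eventually_mem ((chartAt F y).open_source.mem_nhds hy)
  have hG : ∀ y, ContDiffOn ℝ ∞ (G y) (univ ×ˢ (chartAt F y).target) := fun y =>
    g.contDiffOn_paramMetric (hU y) (hh y)
  have hGd : ∀ y s, x s ∈ (chartAt F y).source → DifferentiableAt ℝ (G y) (w y s) :=
    fun y s hy => ((hG y).contDiffAt ((hU y).mem_nhds (hwU y s hy))).differentiableAt (by simp)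
  have hgeo : ∀ y s, x s ∈ (chartAt F y).source → ∀ a, geodRes (G y) (w y) s a = 0 := by
    intro y s hy a
    refine (hγ s).geodRes_eq_zero (hU y) (hh y) (hwU y s hy) (hw y s hy) ?_ a
    filter_upwards [hsrc y s hy] with s' hs'
    change γ s' = proj (Φ.symm (τ s', (chartAt F y).symm (chartAt F y (x s'))))
    rw [(chartAt F y).left_inv hs', ← hc]
    exact congrArg proj (Φ.symm_apply_apply (c s')).symm
  have hGeq : ∀ y (q : ℝ × F), q.2 ∈ (chartAt F y).target → ∀ a b, G y q a b =
      -β ((chartAt F y).symm q.2) * (a.1 * b.1) + gS.inChart y q.2 a.2 b.2 := fun y q hq a b =>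
    hs.paramMetric_eq hproj y hq a b
  -- the energy `β τ'` is conserved
  have hmom : ∀ s, HasDerivAt (fun s => β (x s) * deriv τ s) 0 s := by
    intro s
    have hy := mem_chart_source F (x s)
    -- In product charts the components are functions of the space variable alone.
    have hinv : ∀ a b, fderiv ℝ (G (x s)) (w (x s) s) (1, 0) a b = 0 := by
      intro a b
      rw [fderiv_clm_apply_apply (hGd _ s hy)]
      have h1 : DifferentiableAt ℝ (fun q => G (x s) q a b) (w (x s) s) :=
        ((hGd _ s hy).clm_apply (differentiableAt_const a)).clm_apply (differentiableAt_const b)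
      have h2 : HasDerivAt (fun r : ℝ => (r, (w (x s) s).2)) (1, 0) (τ s) :=
        (hasDerivAt_id _).prodMk (hasDerivAt_const _ _)
      have h3 := HasFDerivAt.comp_hasDerivAt (f := fun r : ℝ => (r, (w (x s) s).2)) (τ s)
        h1.hasFDerivAt h2
      have h4 : (fun q => G (x s) q a b) ∘ (fun r : ℝ => (r, (w (x s) s).2)) = fun _ =>
          G (x s) (w (x s) s) a b := by
        funext r
        have h5 := (chartAt F (x s)).map_source hy
        exact (hGeq _ (r, (w (x s) s).2) h5 a b).trans (hGeq _ (w (x s) s) h5 a b).symm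
      rw [h4] at h3
      exact h3.unique (hasDerivAt_const _ _)
    have h1 := hasDerivAt_momentum (hGd _ s hy) (hw _ s hy) hinv
    rw [hgeo _ s hy] at h1
    -- The momentum in the direction `∂_t` is `-β τ'`.
    have h2 := h1.neg
    rw [neg_zero] at h2
    refine h2.congr_of_eventuallyEq ?_
    filter_upwards [hsrc _ s hy] with s' hs'
    have h3 : deriv (w (x s)) s' = (deriv τ s', deriv (fun s' => chartAt F (x s) (x s')) s') :=
      ((hτ.contDiffAt.differentiableAt (by simp)).hasDerivAt.prodMk
        ((hw2 _ s' hs').differentiableAt (by simp)).hasDerivAt).deriv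
    have h4 := hGeq (x s) (w (x s) s') ((chartAt F (x s)).map_source hs') (deriv (w (x s)) s') (1, 0)
    have h5 : (chartAt F (x s)).symm (w (x s) s').2 = x s' := (chartAt F (x s)).left_inv hs'
    rw [h5, h3] at h4
    change _ = -(G (x s) (w (x s) s') (deriv (w (x s)) s') (1, 0))
    rw [h3, h4]
    simp
  have hτ' : ∀ s, deriv τ s = 0 := by
    intro s
    have h1 := is_const_of_deriv_eq_zero (f := fun s => β (x s) * deriv τ s)
      (fun s => (hmom s).differentiableAt) (fun s => (hmom s).deriv) s 0
    rw [hτ0, mul_zero] at h1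
    exact (mul_eq_zero.1 h1).resolve_left (hs.beta_pos _).ne'
  have hτc : ∀ s, τ s = τ 0 := fun s =>
    is_const_of_deriv_eq_zero (hτ.differentiable (by simp)) hτ' s 0
  refine ⟨x, isGeodesic_iff_forall_geodEqAt.2 fun s => ⟨hx s, fun y hy a => ?_⟩, ?_⟩
  · have h1 : ∀ q : F, HasFDerivAt (fun q : F => (τ 0, q)) (ContinuousLinearMap.inr ℝ ℝ F) q :=
      fun q => hasFDerivAt_prodMk_right _ _
    have he := isSmoothChart_chartAt (E := F) y
    have h2 : w y = (fun q : F => (τ 0, q)) ∘ fun s => chartAt F y (x s) := by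
      funext s
      exact Prod.ext (hτc s) rfl
    -- As `τ` is constant, the curve factors through the inclusion of one slice, which pulls the
    -- product metric back to `gS`. Testing the geodesic equation against vectors tangent to the
    -- slice gives that of `gS`.
    have h3 := geodRes_comp (G := G y) (G' := gS.inChart y) (ψ := fun q : F => (τ 0, q))
      (hw2 y s hy) (by fun_prop) (by
        have := hGd y s hy
        rwa [h2] at this)
      (((gS.contDiffOn_paramMetric (chartAt F y).open_target he.contMDiffOn_symm).contDiffAt
        ((chartAt F y).open_target.mem_nhds ((chartAt F y).map_source hy))).differentiableAt
          (by simp))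
      (Eventually.of_forall fun q v w => g.paramMetric_symm _ _ _ _)
      (by
        filter_upwards [(chartAt F y).open_target.eventually_mem ((chartAt F y).map_source hy)]
          with q hq b b'
        rw [(h1 q).fderiv, hGeq y (τ 0, q) hq]
        simp) a
    rw [← h2, hgeo y s hy] at h3
    exact h3
  · have h1 : x 0 = y₀ := by
      change (Φ (c 0)).2 = y₀
      rw [hc0]
      exact congrArg Prod.snd (Φ.apply_symm_apply (0, y₀))
    clear_value x
    subst h1
    exact congrArg (TotalSpace.mk (x 0)) hx0

end Splitting

/-! ### Assembly of the two statements -/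

/-- The universal covering of a manifold with a complete static field is standard static. -/
theorem exists_isStaticSplitting {E F : Type u} [NormedAddCommGroup E] [NormedSpace ℝ E]
    [FiniteDimensional ℝ E] [NormedAddCommGroup F] [NormedSpace ℝ F] [FiniteDimensional ℝ F]
    (hd : Module.finrank ℝ E = Module.finrank ℝ F + 1)
    {M : Type*} [TopologicalSpace M] [ChartedSpace E M] [IsManifold 𝓘(ℝ, E) ∞ M]
    {g : PseudoRiemannianMetric E M} (hg : g.IsLorentzian)
    {K : (x : M) → TangentSpace 𝓘(ℝ, E) x} (hK : g.IsStaticField K)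
    {N : Type v} [TopologicalSpace N] [T2Space N] [SecondCountableTopology N]
    [ChartedSpace E N] [IsManifold 𝓘(ℝ, E) ∞ N]
    {proj : N → M} (hproj : IsUniversalCovering E proj) (hcomp : IsCompleteField K) :
    ∃ (S : Type v) (_ : TopologicalSpace S) (_ : T2Space S) (_ : SecondCountableTopology S)
      (_ : ChartedSpace F S) (_ : IsManifold 𝓘(ℝ, F) ∞ S)
      (gS : PseudoRiemannianMetric F S) (β : S → ℝ)
      (Φ : Diffeomorph 𝓘(ℝ, E) (𝓘(ℝ, ℝ).prod 𝓘(ℝ, F)) N (ℝ × S) ∞),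
      IsStaticSplitting g K proj gS β Φ := by
  have : SimplyConnectedSpace N := hproj.simplyConnected
  have : CompleteSpace E := FiniteDimensional.complete ℝ E
  obtain ⟨t, ht⟩ := exists_staticTime (F := F) hd hK hproj.isLocalDiffeomorph
  choose e he hpe hte using ht
  let A : StaticAtlas g K proj F := ⟨t, e, he, hpe, hte⟩
  obtain ⟨fl, hfl⟩ := exists_isStaticFlow (g := g) (F := F) hproj.isLocalDiffeomorph hK.contMDiff
    hproj.isCoveringMap hcomp
  have hflow := hfl.isFlowStaticAt (t := A.time) hproj.isLocalDiffeomorph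
    fun p => ⟨e p, he p, hpe p, hte p⟩
  exact ⟨A.Slice, inferInstance, inferInstance, inferInstance, inferInstance, inferInstance, _, _, _,
    StaticAtlas.isStaticSplitting (A := A) hproj.isLocalDiffeomorph hg hK hfl hflow⟩

/-- A static field on a geodesically complete manifold is complete. -/
theorem isCompleteField_of_isStaticField {E F : Type u} [NormedAddCommGroup E] [NormedSpace ℝ E]
    [FiniteDimensional ℝ E] [NormedAddCommGroup F] [NormedSpace ℝ F] [FiniteDimensional ℝ F]
    (hd : Module.finrank ℝ E = Module.finrank ℝ F + 1)
    {M : Type*} [TopologicalSpace M] [T2Space M] [ChartedSpace E M] [IsManifold 𝓘(ℝ, E) ∞ M]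
    {g : PseudoRiemannianMetric E M} {K : (x : M) → TangentSpace 𝓘(ℝ, E) x}
    (hK : g.IsStaticField K) (hg : g.GeodesicallyComplete) : IsCompleteField K :=
  isCompleteField_of_geodesicallyComplete (F := F) hg (hK.contMDiff.of_le (by norm_cast))
    (exists_isStaticChart hd hK isLocalDiffeomorph_id)

end

theorem theorem2p1 {n : ℕ} (hn : 2 ≤ n + 1)
    {M : Type u} [TopologicalSpace M] [T2Space M] [SecondCountableTopology M] [ConnectedSpace M]
    [ChartedSpace (EuclideanSpace ℝ (Fin (n + 1))) M] [IsManifold (𝓡 (n + 1)) ∞ M]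
    (g : PseudoRiemannianMetric (EuclideanSpace ℝ (Fin (n + 1))) M) (hg : g.IsLorentzian)
    (K : (x : M) → TangentSpace (𝓡 (n + 1)) x) (hK : g.IsStaticField K)
    {N : Type v} [TopologicalSpace N] [T2Space N] [SecondCountableTopology N]
    [ChartedSpace (EuclideanSpace ℝ (Fin (n + 1))) N] [IsManifold (𝓡 (n + 1)) ∞ N]
    (proj : N → M) (hproj : IsUniversalCovering (EuclideanSpace ℝ (Fin (n + 1))) proj) :
    (IsCompleteField K →
      ∃ (S : Type v) (_ : TopologicalSpace S) (_ : T2Space S) (_ : SecondCountableTopology S)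
        (_ : ChartedSpace (EuclideanSpace ℝ (Fin n)) S) (_ : IsManifold (𝓡 n) ∞ S)
        (gS : PseudoRiemannianMetric (EuclideanSpace ℝ (Fin n)) S) (β : S → ℝ)
        (Φ : Diffeomorph (𝓡 (n + 1)) (𝓘(ℝ, ℝ).prod (𝓡 n)) N (ℝ × S) ∞),
        IsStaticSplitting g K proj gS β Φ) ∧
    (g.GeodesicallyComplete →
      IsCompleteField K ∧
      ∀ (S : Type w) [TopologicalSpace S] [ChartedSpace (EuclideanSpace ℝ (Fin n)) S]
        [IsManifold (𝓡 n) ∞ S]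
        (gS : PseudoRiemannianMetric (EuclideanSpace ℝ (Fin n)) S) (β : S → ℝ)
        (Φ : Diffeomorph (𝓡 (n + 1)) (𝓘(ℝ, ℝ).prod (𝓡 n)) N (ℝ × S) ∞),
        IsStaticSplitting g K proj gS β Φ → gS.GeodesicallyComplete) := by
  have hd : Module.finrank ℝ (EuclideanSpace ℝ (Fin (n + 1))) =
      Module.finrank ℝ (EuclideanSpace ℝ (Fin n)) + 1 := by simp
  refine ⟨fun hcomp => exists_isStaticSplitting hd hg hK hproj hcomp, fun hcomp => ⟨?_, ?_⟩⟩
  · exact isCompleteField_of_isStaticField hd hK hcomp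
  · intro S _ _ _ gS β Φ hs
    exact hs.geodesicallyComplete hproj.isLocalDiffeomorph hproj.isCoveringMap hcomp
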